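/- **Setting.** Let $n\ge 2$, let $(i_1,\dots,i_l)$ be a word in $1,\dots,n-1$ for a positive braid $\beta$ on $n$ strands ($l\ge 0$), and let $1\le i\le n-1$. For a word $w$ let $\Lambda_w$ be its rainbow closure: the Legendrian link in $\mathbb R^3$ whose front consists of $n$ nested left cusps, the braid $w$ on the $n$ bottom strands (level $1$ innermost, level $n$ outermost), and $n$ nested right cusps. Let $\mathcal A(\Lambda_w)$ be its fully noncommutative Chekanov–Eliashberg dga over $\mathbb Z/2$, with one marked point $t_j$ at the right cusp of level $j$: it is freely generated by the degree $0$ Reeb chords of the crossings of $w$, the degree $1$ Reeb chords $a_1,\dots,a_n$ of the right cusps, and the invertible $t_1^{\pm1},\dots,t_n^{\pm1}$ of degree $0$. For a commutative ring $R$, $\mathrm{Aug}(\Lambda_w)(R)$ is the set of unital dga morphisms $\mathcal A(\Lambda_w)\to (R,0)$, with $R$ in degree $0$. Write $b_1,\dots,b_{l+1}$ for the degree $0$ chords of $\Lambda_{s_i\beta}$, $b'_1,\dots,b'_{l+1}$ for those of $\Lambda_{\beta s_i}$, in the order of the words $(i,i_1,\dots,i_l)$ and $(i_1,\dots,i_l,i)$.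 *Cyclic rotation.* The Legendrian isotopy $\rho_i:\Lambda_{s_i\beta}\to\Lambda_{\beta s_i}$ consists of four Reidemeister II moves and planar isotopies: read backwards, the last crossing $s_i$ of $\Lambda_{\beta s_i}$ is moved from the bottom to the top strands through the right cusps of levels $i,i+1$ (two moves: one creates two crossings, the next removes two), slid to the left, and moved back to the bottom strands through the left cusps of levels $i,i+1$ (again one creating and one removing move). A move that removes two crossings induces the corresponding destabilization $\pi$ of the dga; a move that creates two crossings induces a dga morphism that is a section of the corresponding $\pi$ (it is determined up to dga homotopy). A map $\Phi^*_{\rho_i}:\mathcal A(\Lambda_{\beta s_i})\to\mathcal A(\Lambda_{s_i\beta})$ *induced by* $\rho_i$ is a composite of four such maps, and $\Phi_{\rho_i}:\varepsilon\mapsto\varepsilon\circ\Phi^*_{\rho_i}$ is the induced map on augmentations. *Matrices.* $Z_i(b)$ is the $n\times n$ identity matrix with the block $\begin{pmatrix} b&1\\1&0\end{pmatrix}$ in rows and columns $i,i+1$. Put $M^{(1)}=Z_i(b_1)Z_{i_1}(b_2)\cdots Z_{i_l}(b_{l+1})$ over $\mathcal A(\Lambda_{s_i\beta})$ and $M^{(k+1)}_{jm}=M^{(k)}_{jm}+M^{(k)}_{jk}\,t_k\,M^{(k)}_{km}$.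 *Double Bott–Samelson cells.* Let $\mathbb F$ be a field of characteristic $2$, $G=\mathrm{SL}_n(\mathbb F)$, let $B_\pm$ be the subgroups of upper and lower triangular matrices, $U_\pm$ their unipotent parts, and $\bar s_i$ the image of $\begin{pmatrix}0&-1\\1&0\end{pmatrix}$ under the $i$-th embedding $\mathrm{SL}_2\to \mathrm{SL}_n$. Flags $xB_+,x'B_+$ are in position $s_i$, written $xB_+\xrightarrow{s_i}x'B_+$, if $x^{-1}x'\in B_+\bar s_iB_+$; flags $B_-y,B_-y'$ are in position $s_i$ if $yy'^{-1}\in B_-\bar s_iB_-$; $B_-y$ and $xB_+$ are in position $u\in\{e,s_i\}$, and in general position if $u=e$, if $yx\in B_-\bar uB_+$. For words $w=(w_1,\dots,w_p)$ and $v=(v_1,\dots,v_m)$, $\mathrm{Conf}^v_w(\mathcal C)$ is the set of $G$-orbits of a bottom chain $B^0\xrightarrow{s_{w_1}}\cdots\xrightarrow{s_{w_p}}B^p$ in $G/B_+$ and a top chain $B_0\xrightarrow{s_{v_1}}\cdots\xrightarrow{s_{v_m}}B_m$ in $B_-\backslash G$, together with a decoration $A_m\in U_-\backslash G$ of $B_m$,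 such that $(B_0,B^0)$ and $(B_m,B^p)$ are in general position. The map $\gamma:\mathrm{Aug}(\Lambda_w)(\mathbb F)\to\mathrm{Conf}^e_w(\mathcal C)$ sends $\varepsilon$ to the orbit of $A_0=U_-$, $B^k=R_{w_1}(q_1)\cdots R_{w_k}(q_k)B_+$ $(0\le k\le p)$, where $q_k$ is the value of $\varepsilon$ on the $k$-th degree $0$ chord and $R_j(q)$ is the image of $\begin{pmatrix}q&-1\\1&0\end{pmatrix}$ under the $j$-th embedding $\mathrm{SL}_2\to\mathrm{SL}_n$. *Reflections.* If $w$ starts with $i$, the left reflection ${}_ir$ adds to the left of the top chain the flag $B_{-1}\xrightarrow{s_i}B_0$ that is in position $s_i$ with $B^0$, and deletes $B^0$. If the top chain ends with $B_m\xrightarrow{s_i}A_{m+1}$, the right reflection $r^i$ moves the decoration to the compatible decoration $A_m$ of $B_m$ (if $A_m=U_-y$ and $A_{m+1}=U_-y'$, compatible means $yy'^{-1}\in U_-\bar s_i^{-1}U_-$), adds to the right of the bottom chain the flag $B^{l+1}$ with $B^l\xrightarrow{s_i}B^{l+1}$ that is in position $s_i$ with $B_{m+1}$, and deletes $B_{m+1}$.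 **Proposition.** 1. There is a map $\Phi^*_{\rho_i}$ induced by $\rho_i$ with $$\Phi^*_{\rho_i}(b'_k)=b_{k+1}\quad(1\le k\le l),\qquad \Phi^*_{\rho_i}(b'_{l+1})=t_i\,M^{(i)}_{i,i+1}.$$ 2. Every map $\Phi^*_{\rho_i}$ induced by $\rho_i$ is a dga morphism, satisfies these equalities modulo boundaries, and induces an isomorphism of augmentation varieties: for every commutative ring $R$, $\Phi_{\rho_i}:\mathrm{Aug}(\Lambda_{s_i\beta})(R)\to\mathrm{Aug}(\Lambda_{\beta s_i})(R)$ is a bijection. 3. For every field $\mathbb F$ of characteristic $2$, the reflections are well-defined bijections ${}_ir:\mathrm{Conf}^e_{s_i\beta}(\mathcal C)\to\mathrm{Conf}^{s_i}_{\beta}(\mathcal C)$ and $r^i:\mathrm{Conf}^{s_i}_{\beta}(\mathcal C)\to\mathrm{Conf}^e_{\beta s_i}(\mathcal C)$, both maps $\gamma:\mathrm{Aug}(\Lambda_{s_i\beta})(\mathbb F)\to\mathrm{Conf}^e_{s_i\beta}(\mathcal C)$ and $\gamma:\mathrm{Aug}(\Lambda_{\beta s_i})(\mathbb F)\to\mathrm{Conf}^e_{\beta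 s_i}(\mathcal C)$ are bijections, and for every map $\Phi^*_{\rho_i}$ induced by $\rho_i$ $$\gamma\circ\Phi_{\rho_i}=r^i\circ{}_ir\circ\gamma .$$ -/

import Mathlib

/-! ## Chekanov-Eliashberg dga of a front diagram -/

namespace CE

/-- Elementary pieces of a front diagram, read from left to right.  At each moment the strands
over a vertical dashed line are numbered `0, 1, 2, …` from top to bottom.

* `leftCusp k`: a left cusp creates two new strands, in positions `k` and `k + 1`;
* `crossing k b`: the strands in positions `k`, `k + 1` cross; the Reeb chord is labelled `b`;
* `rightCusp k j`: a right cusp joins the strands in positions `k`, `k + 1`; the link is oriented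
  from the lower to the upper strand there, and the cusp carries a Reeb chord (the crossing of the
  loop that resolves the cusp in the Lagrangian projection) and, on the loop, a marked point; both
  are labelled `j`. -/
inductive Event (B J : Type) : Type
  | leftCusp (k : ℕ)
  | crossing (k : ℕ) (b : B)
  | rightCusp (k : ℕ) (j : J)

/-- The free product of the free monoid on the Reeb chords and the free group on the marked
points: its elements are the reduced words in the letters `c`, `t_j`, `t_j⁻¹`. -/
abbrev Words (B J : Type) : Type := Monoid.Coprod (FreeMonoid (B ⊕ J)) (FreeGroup J)

/-- The fully noncommutative unital `ℤ/2`-algebra freely generated by the Reeb chords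
(`Sum.inl b`: crossings, `Sum.inr j`: right cusps) and the invertible `t_j`. -/
abbrev Alg (B J : Type) : Type := MonoidAlgebra (ZMod 2) (Words B J)

section Algebra

variable {B J : Type}

/-- The generator given by a Reeb chord. -/
noncomputable def chord (c : B ⊕ J) : Alg B J :=
  MonoidAlgebra.of (ZMod 2) (Words B J) (Monoid.Coprod.inl (FreeMonoid.of c))

/-- The invertible generator given by a marked point. -/
noncomputable def marked (j : J) : (Alg B J)ˣ :=
  Units.map ((MonoidAlgebra.of (ZMod 2) (Words B J)).comp Monoid.Coprod.inr)
    (toUnits (FreeGroup.of j))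

/-- The marked point `t_j`, as an element of the algebra. -/
noncomputable def markedVal (j : J) : Alg B J := ((marked j : (Alg B J)ˣ) : Alg B J)

/-- The algebra homomorphism with prescribed values on the generators. -/
noncomputable def lift {R : Type*} [Ring R] [Algebra (ZMod 2) R] (f : B ⊕ J → R) (t : J → Rˣ) :
    Alg B J →ₐ[ZMod 2] R :=
  MonoidAlgebra.lift (ZMod 2) R (Words B J)
    (Monoid.Coprod.lift (FreeMonoid.lift f) ((Units.coeHom R).comp (FreeGroup.lift t)))

/-- What is recorded at a vertical dashed line.  `maslov k` is the Maslov potential of the strand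
in position `k`.  For `i < j`, `disks i j` is the sum of the words of all immersed half-disks to
the left of the dashed line whose boundary meets the line in the strands `i` (top side) and `j`
(bottom side), and all of whose corners are convex and at negative quadrants; a word is read along
the boundary from the top side to the bottom side.  It is `0` unless `i < j`. -/
structure Slice (B J : Type) where
  maslov : ℕ → ℤ
  disks : ℕ → ℕ → Alg B J

/-- The effect of a crossing `c` of the strands `k`, `k + 1` on the half-disk counts.  A bottom
side leaving in position `k` came either straight from position `k + 1`, or from position `k` with
a negative corner at `c`; a bottom side leaving in position `k + 1` came from position `k`.
Symmetrically for top sides.  No half-disk leaves between the two crossing strands. -/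
noncomputable def passCrossing (D : ℕ → ℕ → Alg B J) (k : ℕ) (c : Alg B J) :
    ℕ → ℕ → Alg B J :=
  let E : ℕ → ℕ → Alg B J := fun i j =>
    if j = k then D i (k + 1) + D i k * c else if j = k + 1 then D i k else D i j
  fun i j =>
    if i < j then
      (if i = k then E (k + 1) j else if i = k + 1 then E k j + c * E (k + 1) j else E i j)
    else 0

/-- Passing one elementary piece.

* A left cusp creates one half-disk between its two strands, and nothing else with a side there.
* A right cusp is, in the Lagrangian projection, a crossing (its Reeb chord) followed by a loop
  which joins the strands `k` and `k + 1`: a half-disk seen after it either ignores the loop, or is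
  glued from one with bottom side `k` and one with top side `k + 1` along the loop, whose marked
  point contributes `t_j`. -/
noncomputable def Slice.step (s : Slice B J) : Event B J → Slice B J
  | .leftCusp k =>
    { maslov := fun i =>
        if i < k then s.maslov i else if i = k then 1 else if i = k + 1 then 0
        else s.maslov (i - 2)
      disks := fun i j =>
        let old : ℕ → ℕ := fun a => if a < k then a else a - 2
        if i = k ∧ j = k + 1 then 1
        else if i = k ∨ i = k + 1 ∨ j = k ∨ j = k + 1 then 0
        else s.disks (old i) (old j) }
  | .crossing k b =>
    { maslov := fun i =>
        if i = k then s.maslov (k + 1) else if i = k + 1 then s.maslov k else s.maslov i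
      disks := passCrossing s.disks k (chord (Sum.inl b)) }
  | .rightCusp k j₀ =>
    { maslov := fun i => if i < k then s.maslov i else s.maslov (i + 2)
      disks := fun i j =>
        let E := passCrossing s.disks k (chord (Sum.inr j₀))
        let old : ℕ → ℕ := fun a => if a < k then a else a + 2
        E (old i) (old j) + E (old i) k * markedVal j₀ * E (k + 1) (old j) }

/-- The empty slice, left of the diagram. -/
noncomputable def Slice.empty : Slice B J := ⟨fun _ => 0, fun _ _ => 0⟩

/-- The slice at the right end of a (partial) diagram. -/
noncomputable def Slice.after (L : List (Event B J)) : Slice B J := L.foldl Slice.step Slice.empty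

variable [DecidableEq B] [DecidableEq J]

/-- The differential of a Reeb chord: the count of the immersed disks with one positive corner,
there.  A disk with positive corner at a crossing is a half-disk between the two strands about to
cross; at a right cusp there is moreover the disk bounded by the loop, with word `t_j⁻¹`. -/
noncomputable def diffGenFrom (s : Slice B J) : List (Event B J) → B ⊕ J → Alg B J
  | [], _ => 0
  | .leftCusp k :: L, x => diffGenFrom (s.step (.leftCusp k)) L x
  | .crossing k b :: L, x =>
    (if x = Sum.inl b then s.disks k (k + 1) else 0) + diffGenFrom (s.step (.crossing k b)) L x
  | .rightCusp k j :: L, x =>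
    (if x = Sum.inr j then (((marked j)⁻¹ : (Alg B J)ˣ) : Alg B J) + s.disks k (k + 1) else 0)
      + diffGenFrom (s.step (.rightCusp k j)) L x

/-- The degree of a Reeb chord: the difference of the Maslov potentials at a crossing, and `1` at a
right cusp. -/
noncomputable def degreeGenFrom (s : Slice B J) : List (Event B J) → B ⊕ J → ℤ
  | [], _ => 0
  | .leftCusp k :: L, x => degreeGenFrom (s.step (.leftCusp k)) L x
  | .crossing k b :: L, x =>
    (if x = Sum.inl b then s.maslov k - s.maslov (k + 1) else 0)
      + degreeGenFrom (s.step (.crossing k b)) L x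
  | .rightCusp k j :: L, x =>
    (if x = Sum.inr j then 1 else 0) + degreeGenFrom (s.step (.rightCusp k j)) L x

/-- The differential of the dga of a front: the derivation with the above values on Reeb chords
and `0` on marked points (no signs, as the characteristic is two).  It is written as the
infinitesimal part of the homomorphism `x ↦ x + ε ∂x` to the dual numbers. -/
noncomputable def diff (L : List (Event B J)) (x : Alg B J) : Alg B J :=
  TrivSqZeroExt.snd
    (lift (R := TrivSqZeroExt (Alg B J) (Alg B J))
      (fun c => TrivSqZeroExt.inl (chord c) +
        TrivSqZeroExt.inr (diffGenFrom Slice.empty L c))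
      (fun j => Units.map (TrivSqZeroExt.inlHom (Alg B J) (Alg B J)).toMonoidHom (marked j)) x)

/-- The degree of a word; marked points have degree `0`. -/
noncomputable def wordDegree (L : List (Event B J)) : Words B J →* Multiplicative ℤ :=
  Monoid.Coprod.lift
    (FreeMonoid.lift fun c => Multiplicative.ofAdd (degreeGenFrom Slice.empty L c)) 1

/-- `x` is homogeneous of degree `d`: it is a combination of words of degree `d`. -/
def IsHomogeneous (L : List (Event B J)) (d : ℤ) (x : Alg B J) : Prop :=
  ∀ w : Words B J, x.coeff w ≠ 0 → wordDegree L w = Multiplicative.ofAdd d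

/-- Unital dga morphisms between the dga's of two fronts. -/
def IsDGAMorphism {B' : Type} [DecidableEq B'] (L : List (Event B J)) (L' : List (Event B' J))
    (φ : Alg B J →ₐ[ZMod 2] Alg B' J) : Prop :=
  (∀ x, φ (diff L x) = diff L' (φ x)) ∧ ∀ d x, IsHomogeneous L d x → IsHomogeneous L' d (φ x)

/-- The `R`-points of the augmentation variety: unital dga morphisms to `(R, 0)`, with `R` in
degree `0`. -/
def Aug (L : List (Event B J)) (R : Type*) [CommRing R] : Set (Alg B J →+* R) :=
  {ε | (∀ x, ε (diff L x) = 0) ∧ ∀ d x, d ≠ 0 → IsHomogeneous L d x → ε x = 0}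

end Algebra

/-! ## Rainbow closures of positive braids

There are `n = N + 1` strands; the levels `0, …, N` are counted from the inside, and `i : Fin N`
stands for the braid generator which exchanges the levels `i` and `i + 1`.  Over the braid, the top
strand of level `j` is in position `N - j`, the bottom one in position `N + 1 + j`. -/

section Rainbow

variable {B : Type} {N : ℕ}

/-- The left cusps, from the outermost one to the innermost one. -/
def leftCusps (B : Type) (N : ℕ) : List (Event B (Fin (N + 1))) :=
  (List.range (N + 1)).map Event.leftCusp

/-- The crossing `s_i` between bottom strands. -/
def bottomCrossing (i : Fin N) (b : B) : Event B (Fin (N + 1)) := .crossing (N + 1 + i) b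

/-- The crossing between the top strands of levels `i` and `i + 1`. -/
def topCrossing (i : Fin N) (b : B) : Event B (Fin (N + 1)) := .crossing (N - 1 - i) b

/-- The right cusps of the levels that satisfy `p`, from the inside to the outside. -/
def rightCusps (B : Type) (N : ℕ) (p : Fin (N + 1) → Prop) [DecidablePred p] :
    List (Event B (Fin (N + 1))) :=
  ((List.finRange (N + 1)).filter (fun j => p j)).map fun j => .rightCusp (N - j.val) j

/-- A braid word on the bottom strands, with labelled crossings. -/
def braidWord {m : ℕ} (w : Fin m → Fin N) (lab : Fin m → B) : List (Event B (Fin (N + 1))) :=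
  List.ofFn fun k => bottomCrossing (w k) (lab k)

/-- The front of the positive braid Legendrian link of the word `w` (rainbow closure), with one
marked point at each right cusp.  The crossings are labelled by the letters of `w`. -/
def rainbow {m : ℕ} (w : Fin m → Fin N) : List (Event (Fin m) (Fin (N + 1))) :=
  leftCusps _ N ++ braidWord w id ++ rightCusps _ N (fun _ => True)

end Rainbow

/-! ## The cyclic rotation `Λ_{s_i β} → Λ_{β s_i}`

A front Reidemeister II move pushes a cusp through a strand and creates two crossings.  Let `Λ'` be
the diagram with the two additional crossings and `Λ` the other one.  Eliminating the two
additional chords gives an explicit surjective dga morphism `π : A(Λ') → A(Λ)` (a destabilization).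
The move `Λ' ⇝ Λ` that removes the crossings induces `π`; the inverse move induces a dga morphism
`A(Λ) → A(Λ')` which is a section of `π` (unique up to dga homotopy).

The chain of diagrams, with the moves between them (`β` stays the same throughout):

`Λ_{β s_i} = Λ₁` —(RII)— `Λ₂` = `Λ₂'` —(RII)— `Λ₃` = `Λ₃'` —(RII)— `Λ₄` = `Λ₄'` —(RII)— `Λ_{s_i β}`

where `Λ₂` and `Λ₄` have two additional crossings, and the equality signs are planar isotopies, i.e.
changes of the order in which disjoint pieces of the diagram are met (all generators are kept). -/

section Rotation

variable {N l : ℕ}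

/-- The word `s_i β`. -/
def wordLeft (i : Fin N) (β : Fin l → Fin N) : Fin (l + 1) → Fin N :=
  Fin.cons (α := fun _ => Fin N) i β

/-- The word `β s_i`. -/
def wordRight (β : Fin l → Fin N) (i : Fin N) : Fin (l + 1) → Fin N :=
  Fin.snoc (α := fun _ => Fin N) β i

/-- Crossings of the diagrams with additional crossings: those of `β`, the crossing of bottom
strands, the crossing of top strands, and the crossing of a top with a bottom strand. -/
inductive Cross (l : ℕ) : Type
  | beta (k : Fin l)
  | bot
  | top
  | mid
  deriving DecidableEq

/-- Crossings of the diagrams where the rotated crossing is at the top: those of `β`, and it. -/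
inductive Cross₁ (l : ℕ) : Type
  | beta (k : Fin l)
  | top
  deriving DecidableEq

/-- `Λ₂`: from `Λ_{β s_i}`, push the right cusp of level `i` up through the top strand of level
`i + 1`. -/
def front₂ (β : Fin l → Fin N) (i : Fin N) : List (Event (Cross l) (Fin (N + 1))) :=
  leftCusps _ N ++ braidWord β Cross.beta ++ [bottomCrossing i Cross.bot]
    ++ rightCusps _ N (fun j => j < i.castSucc)
    ++ [topCrossing i Cross.top, .crossing (N - i) Cross.mid,
        .rightCusp (N - 1 - i) i.succ, .rightCusp (N - 1 - i) i.castSucc]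
    ++ rightCusps _ N (fun j => i.succ < j)

/-- `Λ₂'`: the same link diagram as `Λ₂`, with its pieces met in another order; also what one gets
from `Λ₃` on pushing the right cusp of level `i` down through the bottom strand of level `i + 1`. -/
def front₂' (β : Fin l → Fin N) (i : Fin N) : List (Event (Cross l) (Fin (N + 1))) :=
  leftCusps _ N ++ braidWord β Cross.beta
    ++ rightCusps _ N (fun j => j < i.castSucc)
    ++ [topCrossing i Cross.top, .crossing (N - i + 1) Cross.bot, .crossing (N - i) Cross.mid,
        .rightCusp (N - i + 1) i.castSucc, .rightCusp (N - 1 - i) i.succ]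
    ++ rightCusps _ N (fun j => i.succ < j)

/-- The part of `Λ₃` before the right cusps of levels `≥ i`. -/
def front₃Left (β : Fin l → Fin N) (i : Fin N) : List (Event (Cross₁ l) (Fin (N + 1))) :=
  leftCusps _ N ++ braidWord β Cross₁.beta
    ++ rightCusps _ N (fun j => j < i.castSucc) ++ [topCrossing i Cross₁.top]

/-- `Λ₃`: the closure of `β`, with a crossing of the top strands of levels `i`, `i + 1` at the right
end. -/
def front₃ (β : Fin l → Fin N) (i : Fin N) : List (Event (Cross₁ l) (Fin (N + 1))) :=
  front₃Left β i ++ rightCusps _ N (fun j => i.castSucc ≤ j)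

/-- `Λ₃'`: the crossing of top strands has been moved to the left end. -/
def front₃' (β : Fin l → Fin N) (i : Fin N) : List (Event (Cross₁ l) (Fin (N + 1))) :=
  leftCusps _ N ++ [topCrossing i Cross₁.top] ++ braidWord β Cross₁.beta
    ++ rightCusps _ N (fun _ => True)

/-- `Λ₄`: from `Λ₃'`, push the left cusp of level `i` down through the bottom strand of level
`i + 1`. -/
def front₄ (β : Fin l → Fin N) (i : Fin N) : List (Event (Cross l) (Fin (N + 1))) :=
  (List.range (N - i)).map Event.leftCusp
    ++ [.leftCusp (N - i + 1), .crossing (N - i) Cross.mid, .crossing (N - i + 1) Cross.bot]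
    ++ (List.range i).map (fun q => Event.leftCusp (N - i + 1 + q))
    ++ [topCrossing i Cross.top] ++ braidWord β Cross.beta ++ rightCusps _ N (fun _ => True)

/-- `Λ₄'`: the same link diagram as `Λ₄`, with its pieces met in another order; also what one gets
from `Λ_{s_i β}` on pushing the left cusp of level `i` up through the top strand of level `i + 1`. -/
def front₄' (β : Fin l → Fin N) (i : Fin N) : List (Event (Cross l) (Fin (N + 1))) :=
  (List.range (N - i)).map Event.leftCusp
    ++ [.leftCusp (N - 1 - i), .crossing (N - i) Cross.mid, topCrossing i Cross.top]
    ++ (List.range i).map (fun q => Event.leftCusp (N - i + 1 + q))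
    ++ [bottomCrossing i Cross.bot] ++ braidWord β Cross.beta ++ rightCusps _ N (fun _ => True)

/-- Half-disk counts in `Λ_{β s_i}` just before the right cusp of level `i`. -/
noncomputable def disks₁ (β : Fin l → Fin N) (i : Fin N) :
    ℕ → ℕ → Alg (Fin (l + 1)) (Fin (N + 1)) :=
  (Slice.after (leftCusps _ N ++ braidWord (wordRight β i) id
    ++ rightCusps _ N (fun j => j < i.castSucc))).disks

/-- Destabilization `A(Λ₂) → A(Λ_{β s_i})`.  With `k = N - i` the position of the upper strand at
the cusp of level `i`, with chord `a = a_i` and marked point `t = t_i`, the top crossing goes to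
`u = (D_{k-1,k+1} + D_{k-1,k} a) t` and the middle one to `u a`.  The right cusps of levels `i`,
`i + 1` are exchanged by the move. -/
noncomputable def destab₁ (β : Fin l → Fin N) (i : Fin N) :
    Alg (Cross l) (Fin (N + 1)) →ₐ[ZMod 2] Alg (Fin (l + 1)) (Fin (N + 1)) :=
  let a : Alg (Fin (l + 1)) (Fin (N + 1)) := chord (Sum.inr i.castSucc)
  let u : Alg (Fin (l + 1)) (Fin (N + 1)) :=
    (disks₁ β i (N - 1 - i) (N - i + 1) + disks₁ β i (N - 1 - i) (N - i) * a)
      * markedVal i.castSucc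
  lift
    (fun
      | .inl (.beta k) => chord (Sum.inl k.castSucc)
      | .inl .bot => chord (Sum.inl (Fin.last l))
      | .inl .top => u
      | .inl .mid => u * a
      | .inr j => chord (Sum.inr (Equiv.swap i.castSucc i.succ j)))
    (fun j => marked (Equiv.swap i.castSucc i.succ j))

/-- Destabilization `A(Λ₂') → A(Λ₃)`.  With `k = N - i` the position of the upper strand at the
cusp of level `i`, the bottom crossing goes to `v = t (D_{k,k+2} + a D_{k+1,k+2})` and the middle
one to `a v`. -/
noncomputable def destab₂ (β : Fin l → Fin N) (i : Fin N) :
    Alg (Cross l) (Fin (N + 1)) →ₐ[ZMod 2] Alg (Cross₁ l) (Fin (N + 1)) :=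
  let a : Alg (Cross₁ l) (Fin (N + 1)) := chord (Sum.inr i.castSucc)
  let D := (Slice.after (front₃Left β i)).disks
  let v : Alg (Cross₁ l) (Fin (N + 1)) :=
    markedVal i.castSucc
      * (D (N - i) (N - i + 2) + a * D (N - i + 1) (N - i + 2))
  lift
    (fun
      | .inl (.beta k) => chord (Sum.inl (.beta k))
      | .inl .bot => v
      | .inl .top => chord (Sum.inl .top)
      | .inl .mid => a * v
      | .inr j => chord (Sum.inr j))
    marked

/-- Destabilization `A(Λ₄) → A(Λ₃')`: the bottom and the middle crossing go to `0`. -/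
noncomputable def destab₃ (l N : ℕ) :
    Alg (Cross l) (Fin (N + 1)) →ₐ[ZMod 2] Alg (Cross₁ l) (Fin (N + 1)) :=
  lift
    (fun
      | .inl (.beta k) => chord (Sum.inl (.beta k))
      | .inl .bot => 0
      | .inl .top => chord (Sum.inl .top)
      | .inl .mid => 0
      | .inr j => chord (Sum.inr j))
    marked

/-- Destabilization `A(Λ₄') → A(Λ_{s_i β})`: the top and the middle crossing go to `0`. -/
noncomputable def destab₄ (l N : ℕ) :
    Alg (Cross l) (Fin (N + 1)) →ₐ[ZMod 2] Alg (Fin (l + 1)) (Fin (N + 1)) :=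
  lift
    (fun
      | .inl (.beta k) => chord (Sum.inl k.succ)
      | .inl .bot => chord (Sum.inl 0)
      | .inl .top => 0
      | .inl .mid => 0
      | .inr j => chord (Sum.inr j))
    marked

/-- `Φ : A(Λ) → A(Λ')` is induced by the Reidemeister II move that creates two crossings: a dga
morphism that is a section of the destabilization `π : A(Λ') → A(Λ)`. -/
def IsStabilization {B B' J : Type} [DecidableEq B] [DecidableEq B'] [DecidableEq J]
    (L : List (Event B J)) (L' : List (Event B' J)) (π : Alg B' J →ₐ[ZMod 2] Alg B J)
    (Φ : Alg B J →ₐ[ZMod 2] Alg B' J) : Prop :=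
  IsDGAMorphism L L' Φ ∧ ∀ x, π (Φ x) = x

/-- `Φ : A(Λ_{β s_i}) → A(Λ_{s_i β})` is induced by the cyclic rotation `Λ_{s_i β} → Λ_{β s_i}`:
it is a composite of dga morphisms induced by the four Reidemeister II moves. -/
def IsRotationMap (β : Fin l → Fin N) (i : Fin N)
    (Φ : Alg (Fin (l + 1)) (Fin (N + 1)) →ₐ[ZMod 2] Alg (Fin (l + 1)) (Fin (N + 1))) : Prop :=
  ∃ Φ₁ Φ₃, IsStabilization (rainbow (wordRight β i)) (front₂ β i) (destab₁ β i) Φ₁ ∧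
    IsStabilization (front₃' β i) (front₄ β i) (destab₃ l N) Φ₃ ∧
    Φ = (destab₄ l N).comp (Φ₃.comp ((destab₂ β i).comp Φ₁))

end Rotation

/-! ## The matrices `Z_i(b)` and `M^{(k)}` -/

section Matrices

variable {A : Type*} [Ring A] {N : ℕ}

/-- `Z_i(b)`: the identity matrix with the block `(b, 1; 1, 0)` in rows and columns `i`, `i + 1`. -/
def Z (i : Fin N) (b : A) : Matrix (Fin (N + 1)) (Fin (N + 1)) A :=
  Matrix.of fun r c =>
    if r = i.castSucc ∧ c = i.castSucc then b
    else if r = i.castSucc ∧ c = i.succ then 1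
    else if r = i.succ ∧ c = i.castSucc then 1
    else if r = i.succ ∧ c = i.succ then 0
    else if r = c then 1 else 0

/-- `elim M t k` is obtained from `M` by the first `k` steps of the recursion
`M_{rc} ↦ M_{rc} + M_{rk} t_k M_{kc}` (only entries with `r, c ≥ k` are meaningful). -/
def elim (M : Matrix (Fin (N + 1)) (Fin (N + 1)) A) (t : Fin (N + 1) → A) :
    ℕ → Matrix (Fin (N + 1)) (Fin (N + 1)) A
  | 0 => M
  | k + 1 => Matrix.of fun r c =>
      if h : k < N + 1 then
        elim M t k r c + elim M t k r ⟨k, h⟩ * t ⟨k, h⟩ * elim M t k ⟨k, h⟩ c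
      else elim M t k r c

/-- The product `Z_{w_1}(b_1) ⋯ Z_{w_m}(b_m)` for the closure of the word `w`. -/
noncomputable def diskMatrix {m : ℕ} (w : Fin m → Fin N) :
    Matrix (Fin (N + 1)) (Fin (N + 1)) (Alg (Fin m) (Fin (N + 1))) :=
  (List.ofFn fun k => Z (w k) (chord (Sum.inl k))).prod

/-- The element `t_i M^{(i)}_{i,i+1}` of `A(Λ_{s_i β})`; levels count from `0` here, so that
`M^{(i)}` is reached after the levels `< i` have been eliminated. -/
noncomputable def newChordImage {l : ℕ} (β : Fin l → Fin N) (i : Fin N) :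
    Alg (Fin (l + 1)) (Fin (N + 1)) :=
  markedVal i.castSucc *
    elim (diskMatrix (wordLeft i β)) markedVal i
      i.castSucc i.succ

end Matrices

end CE

/-! ## Double Bott-Samelson cells for `SL_n` -/

namespace DBS

open Matrix

variable {N : ℕ} {F : Type*} [Field F]

/-- `SL_n`, `n = N + 1`. -/
abbrev G (N : ℕ) (F : Type*) [Field F] : Type _ := SpecialLinearGroup (Fin (N + 1)) F

section Triangular

variable {α : Type*} [LinearOrder α]

theorem blockTriangular_inv (f : Fin (N + 1) → α) (g : G N F) (hg : BlockTriangular g.1 f) :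
    BlockTriangular (g⁻¹).1 f := by
  have h1 : (g⁻¹).1 * g.1 = 1 := congrArg Subtype.val (inv_mul_cancel g)
  have h2 : g.1 * (g⁻¹).1 = 1 := congrArg Subtype.val (mul_inv_cancel g)
  let _ : Invertible g.1 := ⟨(g⁻¹).1, h1, h2⟩
  have h3 := blockTriangular_inv_of_blockTriangular hg
  rwa [Matrix.inv_eq_left_inv h1] at h3

/-- The matrices in `SL_n` that are upper triangular for the order of the indices given by `f`. -/
def triangular (F : Type*) [Field F] (f : Fin (N + 1) → α) : Subgroup (G N F) where
  carrier := {g | BlockTriangular g.1 f}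
  one_mem' := blockTriangular_one
  mul_mem' ha hb := BlockTriangular.mul ha hb
  inv_mem' {g} hg := blockTriangular_inv f g hg

theorem diag_mul {f : Fin (N + 1) → α} (hf : Function.Injective f) {a b : G N F}
    (ha : BlockTriangular a.1 f) (hb : BlockTriangular b.1 f) (r : Fin (N + 1)) :
    (a.1 * b.1) r r = a.1 r r * b.1 r r := by
  rw [Matrix.mul_apply]
  refine Finset.sum_eq_single r (fun k _ hk => ?_) (fun h => absurd (Finset.mem_univ r) h)
  rcases lt_or_gt_of_ne (fun h => hk (hf h) : f k ≠ f r) with h | h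
  · rw [ha h, zero_mul]
  · rw [hb h, mul_zero]

/-- The unipotent matrices among them. -/
def unitriangular (F : Type*) [Field F] (f : Fin (N + 1) → α) (hf : Function.Injective f) :
    Subgroup (G N F) where
  carrier := {g | BlockTriangular g.1 f ∧ ∀ r, g.1 r r = 1}
  one_mem' := ⟨blockTriangular_one, fun r => Matrix.one_apply_eq r⟩
  mul_mem' {a b} ha hb := by
    refine ⟨BlockTriangular.mul ha.1 hb.1, fun r => ?_⟩
    have h := diag_mul hf ha.1 hb.1 r
    rw [ha.2, hb.2, mul_one] at h
    exact h
  inv_mem' {g} hg := by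
    refine ⟨blockTriangular_inv f g hg.1, fun r => ?_⟩
    have h := diag_mul hf hg.1 (blockTriangular_inv f g hg.1) r
    have h2 : g.1 * (g⁻¹).1 = 1 := congrArg Subtype.val (mul_inv_cancel g)
    rw [h2, Matrix.one_apply_eq, hg.2, one_mul] at h
    exact h.symm

end Triangular

/-- `B₊`: upper triangular matrices. -/
def Bplus (N : ℕ) (F : Type*) [Field F] : Subgroup (G N F) :=
  triangular F (id : Fin (N + 1) → Fin (N + 1))

/-- `B₋`: lower triangular matrices. -/
def Bminus (N : ℕ) (F : Type*) [Field F] : Subgroup (G N F) :=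
  triangular F (OrderDual.toDual : Fin (N + 1) → (Fin (N + 1))ᵒᵈ)

/-- `U₋`: unipotent lower triangular matrices. -/
def Uminus (N : ℕ) (F : Type*) [Field F] : Subgroup (G N F) :=
  unitriangular F (OrderDual.toDual : Fin (N + 1) → (Fin (N + 1))ᵒᵈ) OrderDual.toDual.injective

theorem Uminus_le_Bminus : Uminus N F ≤ Bminus N F := fun _ hg => hg.1

/-- `e_i(q)`: the image of `(1, q; 0, 1)` under the homomorphism `SL_2 → SL_n` of the `i`-th simple
root. -/
def e (i : Fin N) (q : F) : G N F :=
  SpecialLinearGroup.transvection (i := i.castSucc) (j := i.succ) i.castSucc_lt_succ.ne q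

/-- `e_{-i}(q)`: the image of `(1, 0; q, 1)`. -/
def eNeg (i : Fin N) (q : F) : G N F :=
  SpecialLinearGroup.transvection (i := i.succ) (j := i.castSucc) i.castSucc_lt_succ.ne' q

/-- The representative `s̄_i` of the simple reflection: the image of
`(0, -1; 1, 0) = (1, -1; 0, 1) (1, 0; 1, 1) (1, -1; 0, 1)`. Its inverse is the image of
`(0, 1; -1, 0)`. -/
def sBar (N : ℕ) (F : Type*) [Field F] (i : Fin N) : G N F := e i (-1) * eNeg i 1 * e i (-1)

/-- `R_i(q) = e_i(q) s̄_i`, the image of `(q, -1; 1, 0)`. -/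
def R (i : Fin N) (q : F) : G N F := e i q * sBar N F i

/-- Relative positions.  `PosPlus s x x'` : the flags `x B₊` and `x' B₊` are in position `s`. -/
def PosPlus (s x x' : G N F) : Prop :=
  x⁻¹ * x' ∈ DoubleCoset.doubleCoset s (Bplus N F : Set (G N F)) (Bplus N F)

/-- The flags `B₋ y` and `B₋ y'` are in position `s`. -/
def PosMinus (s y y' : G N F) : Prop :=
  y * y'⁻¹ ∈ DoubleCoset.doubleCoset s (Bminus N F : Set (G N F)) (Bminus N F)

/-- The flags `B₋ y` and `x B₊` are in position `s` (`s = 1`: general position). -/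
def PosMixed (s y x : G N F) : Prop :=
  y * x ∈ DoubleCoset.doubleCoset s (Bminus N F : Set (G N F)) (Bplus N F)

/-- The decorated flags `U₋ y` and `U₋ y'`, in position `s_i`, are compatible. -/
def Compatible (i : Fin N) (y y' : G N F) : Prop :=
  y * y'⁻¹ ∈ DoubleCoset.doubleCoset (sBar N F i)⁻¹ (Uminus N F : Set (G N F)) (Uminus N F)

/-- Coset representatives of a bottom chain of flags `B^k = x_k B₊`, `0 ≤ k ≤ l`, and of a top chain
`B_j = B₋ y_j`, `0 ≤ j ≤ m`, whose last flag has the decoration `A_m = U₋ y_m`. -/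
structure Chains (N : ℕ) (F : Type*) [Field F] (l m : ℕ) where
  x : Fin (l + 1) → G N F
  y : Fin (m + 1) → G N F

/-- Two families of representatives give collections of flags in the same `G`-orbit: some `g` takes
every `x_k B₊` to `g x_k B₊ = x'_k B₊`, every `B₋ y_j` to `B₋ y_j g⁻¹ = B₋ y'_j`, and the decoration
`U₋ y_m` to `U₋ y_m g⁻¹ = U₋ y'_m`. -/
def SameOrbit {l m : ℕ} (c c' : Chains N F l m) : Prop :=
  ∃ g : G N F, (∀ k, (g * c.x k)⁻¹ * c'.x k ∈ Bplus N F) ∧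
    (∀ j, c'.y j * (c.y j * g⁻¹)⁻¹ ∈ Bminus N F) ∧
    c'.y (Fin.last m) * (c.y (Fin.last m) * g⁻¹)⁻¹ ∈ Uminus N F

instance chainsSetoid (N : ℕ) (F : Type*) [Field F] (l m : ℕ) : Setoid (Chains N F l m) where
  r := SameOrbit
  iseqv := by
    refine ⟨fun c => ⟨1, ?_, ?_, ?_⟩, ?_, ?_⟩
    · intro k; simpa using (Bplus N F).one_mem
    · intro j; simpa using (Bminus N F).one_mem
    · simpa using (Uminus N F).one_mem
    · rintro c c' ⟨g, h1, h2, h3⟩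
      refine ⟨g⁻¹, fun k => ?_, fun j => ?_, ?_⟩
      · have := (Bplus N F).inv_mem (h1 k)
        simpa [mul_assoc] using this
      · have := (Bminus N F).inv_mem (h2 j)
        simpa [mul_assoc] using this
      · have := (Uminus N F).inv_mem h3
        simpa [mul_assoc] using this
    · rintro c c' c'' ⟨g, h1, h2, h3⟩ ⟨g', h1', h2', h3'⟩
      refine ⟨g' * g, fun k => ?_, fun j => ?_, ?_⟩
      · have := (Bplus N F).mul_mem (h1 k) (h1' k)
        simpa [mul_assoc] using this
      · have := (Bminus N F).mul_mem (h2' j) (h2 j)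
        simpa [mul_assoc] using this
      · have := (Uminus N F).mul_mem h3' h3
        simpa [mul_assoc] using this

/-- `G`-orbits of pairs of chains of flags, the last flag of the top chain being decorated. -/
abbrev Orbits (N : ℕ) (F : Type*) [Field F] (l m : ℕ) : Type _ := Quotient (chainsSetoid N F l m)

/-- The half decorated double Bott-Samelson cell `Conf^v_w(𝒞)` of the words `w` (bottom) and `v`
(top), as a set of orbits: consecutive flags are in the positions prescribed by the words, and the
first pair and the last pair of a top and a bottom flag are in general position. -/
def Conf {l m : ℕ} (w : Fin l → Fin N) (v : Fin m → Fin N) : Set (Orbits N F l m) :=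
  {o | ∃ c : Chains N F l m, o = ⟦c⟧ ∧
    (∀ k : Fin l, PosPlus (sBar N F (w k)) (c.x k.castSucc) (c.x k.succ)) ∧
    (∀ j : Fin m, PosMinus (sBar N F (v j)) (c.y j.castSucc) (c.y j.succ)) ∧
    PosMixed 1 (c.y 0) (c.x 0) ∧ PosMixed 1 (c.y (Fin.last m)) (c.x (Fin.last l))}

/-- The left reflection `_ir` takes `o` to `o'`: one adds on the left of the top chain the flag
`B_{-1} = B₋ z` with `B^0 —s_i— B_{-1}` and `B_{-1} →s_i B_0`, and forgets `B^0`. -/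
def LeftReflects {l m : ℕ} (i : Fin N) (o : Orbits N F (l + 1) m) (o' : Orbits N F l (m + 1)) :
    Prop :=
  ∃ (c : Chains N F (l + 1) m) (z : G N F), o = ⟦c⟧ ∧
    PosMixed (sBar N F i) z (c.x 0) ∧ PosMinus (sBar N F i) z (c.y 0) ∧
    o' = ⟦⟨fun k => c.x k.succ, Fin.cons (α := fun _ => G N F) z c.y⟩⟧

/-- The right reflection `r^i` takes `o` to `o'`: one moves the decoration of the last top flag
`A_{m+1}` to a compatible decoration of `B_m`, adds on the right of the bottom chain the flag
`B^{l+1} = z B₊` with `B^l →s_i B^{l+1}` and `B^{l+1} —s_i— B_{m+1}`, and forgets `B_{m+1}`. -/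
def RightReflects {l m : ℕ} (i : Fin N) (o : Orbits N F l (m + 1)) (o' : Orbits N F (l + 1) m) :
    Prop :=
  ∃ (c : Chains N F l (m + 1)) (z : G N F), o = ⟦c⟧ ∧
    Compatible i (c.y (Fin.last m).castSucc) (c.y (Fin.last (m + 1))) ∧
    PosPlus (sBar N F i) (c.x (Fin.last l)) z ∧
    PosMixed (sBar N F i) (c.y (Fin.last (m + 1))) z ∧
    o' = ⟦⟨Fin.snoc (α := fun _ => G N F) c.x z, fun j => c.y j.castSucc⟩⟧

/-- The point of `Conf^e_w(𝒞)` with affine coordinates `q`: the orbit of `A_0 = U₋`, `B^0 = B₊` and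
`B^k = R_{w_1}(q_1) ⋯ R_{w_k}(q_k) B₊`. -/
def point {m : ℕ} (w : Fin m → Fin N) (q : Fin m → F) : Orbits N F m 0 :=
  ⟦⟨fun k => ((List.ofFn fun j => R (w j) (q j)).take k).prod, fun _ => 1⟩⟧

/-- The map `γ` from augmentations of the closure of the word `w` to `Conf^e_w(𝒞)`: the affine
coordinate `q_k` of the image is the value of the augmentation on the Reeb chord `b_k`. -/
noncomputable def gamma {m : ℕ} (w : Fin m → Fin N)
    (ε : CE.Alg (Fin m) (Fin (N + 1)) →+* F) : Orbits N F m 0 :=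
  point w fun k => ε (CE.chord (Sum.inl k))

end DBS

/-! Everything is computed with matrices. In a rainbow closure half-disks run only from a top strand
to a bottom strand, so a slice is a matrix with rows indexed by top levels and columns by bottom
levels (`IsRainbow`). A bottom crossing multiplies it by $Z_i$ on the right, a top crossing on the
left, and a right cusp performs one step of Gaussian elimination. Hence crossings are cycles and
$\partial a_j$ is $t_j^{-1}$ plus the $j$-th pivot. Row and column operations commute with each
other and with eliminations at smaller levels, which is why isotopic fronts have equal
differentials. Two other shapes of slices occur: interlaced ones, after a right cusp is pushed
through a strand (`IsInterlaced`), and zigzags, after a left cusp is.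

The destabilizations are chain maps by matrix computation. Explicit sections `stab₁`, `stab₃` of the
two that must be inverted give the map `rotation`, which has the stated values because `destab₂`
sends the bottom crossing to $t_iQ_{i,i+1}$, $Q$ being the matrix after the levels below $i$ are
eliminated. Any other section $\varphi$ of a destabilization $\pi$ agrees with the explicit one
$\psi$ on cycles up to boundaries: $\psi\pi$ is homotopic to the identity, so
$\varphi\sim\psi\pi\varphi=\psi$. The homotopies are twisted derivations, hence determined on
generators. Augmentations kill boundaries and degree one chords, so all induced maps act on them as
`rotation` does, bijectively factor by factor.

For flags, in characteristic two $R_i(q)$ equals $Z_i(q)$. Augmentations over a field are the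
coordinates $q$ for which the product $P$ of these matrices has invertible pivots, the $t_j$ being
the inverse pivots. This means $P\in B_-B_+$, that is, the last pair of flags is in general
position; and orbits have unique normal forms with such coordinates. Writing $P=LU$, the left
reflection adds $B_-\bar s_i$ and the right one adds $L\bar s_iB_+$. Translating by $R_i(q_1)^{-1}$
restores the normal form, with new coordinate $U_{i,i+1}/U_{ii}$. The rows of $U$ are the eliminated
rows of $P$ and $U_{ii}$ is a pivot, so this is $t_iM^{(i)}_{i,i+1}$. Bijectivity of $r^i$ then
follows from the commutative square. -/

namespace CE

/-! ### The free algebra: induction on generators and homomorphisms out of it -/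

section Basic

variable {B J : Type}

/-- Words are products of letters, and the scalars in `ZMod 2` are only `0` and `1`, so linear
combinations need no case beyond sums. -/
theorem Alg.induction {P : Alg B J → Prop} (h0 : P 0) (h1 : P 1)
    (hadd : ∀ x y, P x → P y → P (x + y)) (hmul : ∀ x y, P x → P y → P (x * y))
    (hc : ∀ c, P (chord c)) (ht : ∀ j, P (markedVal j))
    (hti : ∀ j, P (((marked j)⁻¹ : (Alg B J)ˣ) : Alg B J)) (x : Alg B J) : P x := by
  have hof : ∀ w : Words B J, P (MonoidAlgebra.of (ZMod 2) (Words B J) w) := by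
    intro w
    induction w using Monoid.Coprod.induction_on with
    | inl m =>
      induction m using FreeMonoid.inductionOn' with
      | one => rw [map_one, map_one]; exact h1
      | of_mul c m ih =>
        rw [map_mul, map_mul]
        exact hmul _ _ (hc c) ih
    | inr g =>
      induction g using FreeGroup.induction_on with
      | C1 => rw [map_one, map_one]; exact h1
      | of j => exact ht j
      | inv_of j _ => exact hti j
      | mul a b ha hb => 
        rw [map_mul, map_mul]
        exact hmul _ _ ha hb
    | mul a b ha hb =>
      rw [map_mul]
      exact hmul _ _ ha hb
  induction x using MonoidAlgebra.induction_on with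
  | of w => exact hof w
  | add x y hx hy => exact hadd x y hx hy
  | smul r x hx =>
    fin_cases r
    · exact (zero_smul (ZMod 2) x).symm ▸ h0
    · exact (one_smul (ZMod 2) x).symm ▸ hx

section Lift

variable {R : Type*} [Ring R] [Algebra (ZMod 2) R] (f : B ⊕ J → R) (t : J → Rˣ)

@[simp] theorem lift_chord (c : B ⊕ J) : lift f t (chord c) = f c := by
  simp [lift, chord]

@[simp] theorem lift_markedVal (j : J) : lift f t (markedVal j) = t j := by
  simp [lift, markedVal, marked]

@[simp] theorem lift_marked_inv (j : J) :
    lift f t (((marked j)⁻¹ : (Alg B J)ˣ) : Alg B J) = ((t j)⁻¹ : Rˣ) := by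
  have h : Units.map (lift f t : Alg B J →* R) (marked j) = t j :=
    Units.ext (lift_markedVal f t j)
  rw [← h]
  rfl

end Lift

/-- Ring homomorphisms preserve units, so inverse marked points need no hypothesis. Augmentations
are plain ring homomorphisms, hence this generality. -/
theorem Alg.ringHom_ext {R : Type*} [Ring R] {φ ψ : Alg B J →+* R}
    (hc : ∀ c, φ (chord c) = ψ (chord c)) (ht : ∀ j, φ (markedVal j) = ψ (markedVal j)) :
    φ = ψ := by
  refine RingHom.ext fun x => ?_
  induction x using Alg.induction with
  | h0 => simp
  | h1 => simp
  | hadd x y hx hy => rw [map_add, map_add, hx, hy]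
  | hmul x y hx hy => rw [map_mul, map_mul, hx, hy]
  | hc c => exact hc c
  | ht j => exact ht j
  | hti j =>
    have : Units.map (φ : Alg B J →* R) (marked j) = Units.map (ψ : Alg B J →* R) (marked j) :=
      Units.ext (ht j)
    have h2 := congrArg (fun u : Rˣ => ((u⁻¹ : Rˣ) : R)) this
    simpa using h2

theorem Alg.algHom_ext {R : Type*} [Ring R] [Algebra (ZMod 2) R] {φ ψ : Alg B J →ₐ[ZMod 2] R}
    (hc : ∀ c, φ (chord c) = ψ (chord c)) (ht : ∀ j, φ (markedVal j) = ψ (markedVal j)) :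
    φ = ψ :=
  AlgHom.coe_ringHom_injective (Alg.ringHom_ext hc ht)

theorem add_self_eq_zero' (x : Alg B J) : x + x = 0 := by
  have : (2 : ZMod 2) • x = 0 := by
    rw [show (2 : ZMod 2) = 0 from rfl, zero_smul]
  rwa [two_smul] at this

@[simp] theorem marked_mul_inv (j : J) :
    (markedVal j : Alg B J) * ((marked j)⁻¹ : (Alg B J)ˣ) = 1 := Units.mul_inv _

@[simp] theorem marked_inv_mul (j : J) :
    (((marked j)⁻¹ : (Alg B J)ˣ) : Alg B J) * markedVal j = 1 := Units.inv_mul _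

@[simp] theorem marked_coe (j : J) : ((marked j : (Alg B J)ˣ) : Alg B J) = markedVal j := rfl

end Basic

/-! ### The differential as a derivation -/

section Diff

variable {B J : Type} [DecidableEq B] [DecidableEq J] (L : List (Event B J))

theorem diff_add (x y : Alg B J) : diff L (x + y) = diff L x + diff L y := by
  simp [diff]

@[simp] theorem diff_zero : diff L (0 : Alg B J) = 0 := by simp [diff]

@[simp] theorem diff_one : diff L (1 : Alg B J) = 0 := by simp [diff]

theorem diff_mul (x y : Alg B J) : diff L (x * y) = x * diff L y + diff L x * y := by
  -- The dual-number homomorphism lifts the identity, so the second component of a product is given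
  -- by the Leibniz rule.
  have h : ∀ x : Alg B J, TrivSqZeroExt.fst
      (lift (R := TrivSqZeroExt (Alg B J) (Alg B J))
      (fun c => TrivSqZeroExt.inl (chord c) +
        TrivSqZeroExt.inr (diffGenFrom Slice.empty L c))
      (fun j => Units.map (TrivSqZeroExt.inlHom (Alg B J) (Alg B J)).toMonoidHom (marked j)) x)
      = x := by
    intro x
    induction x using Alg.induction with
    | h0 => simp
    | h1 => simp
    | hadd x y hx hy => rw [map_add, TrivSqZeroExt.fst_add, hx, hy]
    | hmul x y hx hy => rw [map_mul, TrivSqZeroExt.fst_mul, hx, hy]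
    | hc c => simp
    | ht j => simp
    | hti j => 
      rw [lift_marked_inv, ← map_inv]
      simp
  rw [diff, map_mul, TrivSqZeroExt.snd_mul, h, h]
  rfl

@[simp] theorem diff_chord (c : B ⊕ J) : diff L (chord c) = diffGenFrom Slice.empty L c := by
  simp [diff]

@[simp] theorem diff_markedVal (j : J) : diff L (markedVal j) = 0 := by
  simp [diff]

@[simp] theorem diff_marked_inv (j : J) :
    diff L (((marked j)⁻¹ : (Alg B J)ˣ) : Alg B J) = 0 := by
  rw [diff, lift_marked_inv, ← map_inv]
  simp

theorem diff_congr {L L' : List (Event B J)}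
    (h : ∀ c, diffGenFrom Slice.empty L c = diffGenFrom Slice.empty L' c) : diff L = diff L' := by
  funext x
  simp only [diff, h]

/-- Both sides are derivations along the homomorphism, and marked points are cycles. The map `σ` is
there for the move that exchanges two levels. -/
theorem diff_comm_of_chord {B' : Type} [DecidableEq B'] {L : List (Event B J)}
    {L' : List (Event B' J)} {f : B ⊕ J → Alg B' J} {σ : J → J}
    (h : ∀ c, lift f (fun j => marked (σ j)) (diffGenFrom Slice.empty L c) = diff L' (f c))
    (x : Alg B J) :
    lift f (fun j => marked (σ j)) (diff L x) = diff L' (lift f (fun j => marked (σ j)) x) := by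
  induction x using Alg.induction with
  | h0 => simp
  | h1 => simp
  | hadd x y hx hy => rw [diff_add, map_add, map_add, diff_add, hx, hy]
  | hmul x y hx hy => rw [diff_mul, map_add, map_mul, map_mul, map_mul, diff_mul, hx, hy]
  | hc c => rw [diff_chord, h, lift_chord]
  | ht j => simp
  | hti j => simp

end Diff

/-! ### The grading -/

section Degree

variable {B J : Type} [DecidableEq B] [DecidableEq J] {L : List (Event B J)}

theorem isHomogeneous_zero (d : ℤ) : IsHomogeneous L d 0 := by
  intro w hw; simp at hw

theorem isHomogeneous_of (w : Words B J) {d : ℤ} (h : wordDegree L w = Multiplicative.ofAdd d) :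
    IsHomogeneous L d (MonoidAlgebra.of (ZMod 2) (Words B J) w) := by
  intro v hv
  by_cases hvw : v = w
  · rw [hvw, h]
  · simp [MonoidAlgebra.of_apply, Ne.symm hvw] at hv

theorem IsHomogeneous.add {d : ℤ} {x y : Alg B J} (hx : IsHomogeneous L d x)
    (hy : IsHomogeneous L d y) : IsHomogeneous L d (x + y) := by
  intro w hw
  by_cases h : x.coeff w = 0
  · refine hy w fun h' => hw ?_
    simp [h, h']
  · exact hx w h

theorem IsHomogeneous.mul {d e : ℤ} {x y : Alg B J} (hx : IsHomogeneous L d x)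
    (hy : IsHomogeneous L e y) : IsHomogeneous L (d + e) (x * y) := by
  classical
  intro w hw
  have := MonoidAlgebra.support_coeff_mul_subset x y (Finsupp.mem_support_iff.2 hw)
  obtain ⟨a, ha, b, hb, rfl⟩ := Finset.mem_mul.1 this
  rw [map_mul, hx a (Finsupp.mem_support_iff.1 ha), hy b (Finsupp.mem_support_iff.1 hb)]
  rfl

theorem isHomogeneous_one : IsHomogeneous L 0 (1 : Alg B J) := by
  have := isHomogeneous_of (L := L) (1 : Words B J) (d := 0) (by simp)
  rwa [map_one] at this

theorem isHomogeneous_chord (c : B ⊕ J) :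
    IsHomogeneous L (degreeGenFrom Slice.empty L c) (chord c) :=
  isHomogeneous_of _ (by simp [wordDegree])

theorem isHomogeneous_markedVal (j : J) : IsHomogeneous L 0 (markedVal j) :=
  isHomogeneous_of _ (by simp [wordDegree])

theorem isHomogeneous_marked_inv (j : J) :
    IsHomogeneous L 0 (((marked j)⁻¹ : (Alg B J)ˣ) : Alg B J) :=
  isHomogeneous_of (Monoid.Coprod.inr (FreeGroup.of j)⁻¹) (by simp [wordDegree])

theorem isHomogeneous_congr {L L' : List (Event B J)}
    (h : ∀ c, degreeGenFrom Slice.empty L c = degreeGenFrom Slice.empty L' c) (d : ℤ)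
    (x : Alg B J) : IsHomogeneous L d x ↔ IsHomogeneous L' d x := by
  simp only [IsHomogeneous, wordDegree, h]

/-- Degrees add along words, so respecting them on generators suffices for words; nonzero
coefficients are `1`, so an element is the sum of the words in its support. -/
theorem IsHomogeneous.lift {B' : Type} [DecidableEq B'] {L' : List (Event B' J)}
    {f : B ⊕ J → Alg B' J} {σ : J → J}
    (h : ∀ c, IsHomogeneous L' (degreeGenFrom Slice.empty L c) (f c))
    {d : ℤ} {x : Alg B J} (hx : IsHomogeneous L d x) :
    IsHomogeneous L' d (CE.lift f (fun j => marked (σ j)) x) := by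
  have hof : ∀ w : Words B J, IsHomogeneous L' (wordDegree L w).toAdd
      (CE.lift f (fun j => marked (σ j)) (MonoidAlgebra.of (ZMod 2) (Words B J) w)) := by
    intro w
    have hm : ∀ a b : Words B J, (wordDegree L (a * b)).toAdd
        = (wordDegree L a).toAdd + (wordDegree L b).toAdd := fun a b => by rw [map_mul]; rfl
    have h1 : (wordDegree L (1 : Words B J)).toAdd = 0 := by rw [map_one]; rfl
    induction w using Monoid.Coprod.induction_on with
    | inl m =>
      induction m using FreeMonoid.inductionOn' with
      | one => rw [map_one, h1, map_one, map_one]; exact isHomogeneous_one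
      | of_mul c m ih =>
        rw [map_mul, hm, map_mul, map_mul]
        refine IsHomogeneous.mul ?_ ih
        have : MonoidAlgebra.of (ZMod 2) (Words B J) (Monoid.Coprod.inl (FreeMonoid.of c))
          = chord c := rfl
        rw [this, lift_chord]
        simpa [wordDegree] using h c
    | inr g =>
      have h0 : (wordDegree L (Monoid.Coprod.inr g)).toAdd = 0 := by simp [wordDegree]
      rw [h0]
      induction g using FreeGroup.induction_on with
      | C1 => rw [map_one, map_one, map_one]; exact isHomogeneous_one
      | of j => 
        have : MonoidAlgebra.of (ZMod 2) (Words B J) (Monoid.Coprod.inr (FreeGroup.of j))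
          = markedVal j := rfl
        rw [this, lift_markedVal]
        exact isHomogeneous_markedVal _
      | inv_of j _ => 
        have : MonoidAlgebra.of (ZMod 2) (Words B J) (Monoid.Coprod.inr (FreeGroup.of j)⁻¹)
          = ((marked j)⁻¹ : (Alg B J)ˣ) := rfl
        rw [this, lift_marked_inv]
        exact isHomogeneous_marked_inv _
      | mul a b ha hb => 
        rw [map_mul, map_mul, map_mul, ← add_zero (0 : ℤ)]
        exact (ha (by simp [wordDegree])).mul (hb (by simp [wordDegree]))
    | mul a b ha hb =>
      rw [hm, map_mul, map_mul]
      exact ha.mul hb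
  have hsum : x = ∑ w ∈ x.coeff.support, MonoidAlgebra.single w (x.coeff w) :=
    (MonoidAlgebra.sum_coeff_single x).symm
  rw [hsum, map_sum]
  refine Finset.sum_induction _ (IsHomogeneous L' d) (fun _ _ => IsHomogeneous.add)
    (isHomogeneous_zero d) fun w hw => ?_
  have h1 : x.coeff w = 1 := by
    have := Finsupp.mem_support_iff.1 hw
    generalize x.coeff w = r at this
    fin_cases r
    · exact absurd rfl this
    · rfl
  have h2 := hof w
  rw [hx w (Finsupp.mem_support_iff.1 hw)] at h2
  rw [h1]
  exact h2

end Degree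

/-! ### Twisted derivations and chain homotopies -/

section Derivation

variable {B J : Type} 

/-- The hom to upper triangular matrices encoding a twisted derivation. -/
noncomputable def twistedHom (σ : Alg B J →ₐ[ZMod 2] Alg B J) (f : B ⊕ J → Alg B J) :
    Alg B J →ₐ[ZMod 2] Matrix (Fin 2) (Fin 2) (Alg B J) :=
  lift (fun c => !![σ (chord c), f c; 0, chord c])
    (fun j => Units.map (Matrix.diagonalRingHom (Fin 2) (Alg B J)).toMonoidHom
      (MulEquiv.piUnits.symm ![Units.map (σ : Alg B J →* Alg B J) (marked j), marked j]))

/-- The `(σ, id)`-derivation which vanishes on marked points, with given values on chords. -/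
noncomputable def twistedDer (σ : Alg B J →ₐ[ZMod 2] Alg B J) (f : B ⊕ J → Alg B J)
    (x : Alg B J) : Alg B J := twistedHom σ f x 0 1

variable (σ : Alg B J →ₐ[ZMod 2] Alg B J) (f : B ⊕ J → Alg B J)

theorem twistedHom_markedVal (j : J) : twistedHom σ f (markedVal j) =
    !![σ (markedVal j), 0; 0, markedVal j] := by
  rw [twistedHom, lift_markedVal]
  ext a b
  fin_cases a <;> fin_cases b <;> simp

theorem twistedHom_marked_inv (j : J) :
    twistedHom σ f (((marked j)⁻¹ : (Alg B J)ˣ) : Alg B J) =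
    !![σ (((marked j)⁻¹ : (Alg B J)ˣ) : Alg B J), 0;
      0, (((marked j)⁻¹ : (Alg B J)ˣ) : Alg B J)] := by
  rw [twistedHom, lift_marked_inv, ← map_inv, ← map_inv]
  ext a b
  fin_cases a <;> fin_cases b <;> simp

/-- The diagonal entries are homomorphisms determined on generators; matrix multiplication then
forces the twisted Leibniz rule on the corner. -/
theorem twistedHom_apply (x : Alg B J) :
    twistedHom σ f x = !![σ x, twistedDer σ f x; 0, x] := by
  suffices h : twistedHom σ f x 0 0 = σ x ∧ twistedHom σ f x 1 0 = 0 ∧ twistedHom σ f x 1 1 = x by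
    ext a b
    fin_cases a <;> fin_cases b <;> simp [h, twistedDer]
  induction x using Alg.induction with
  | h0 => simp
  | h1 => simp
  | hadd x y hx hy => simp [hx, hy]
  | hmul x y hx hy => simp [hx, hy, Matrix.mul_apply, Fin.sum_univ_two]
  | hc c => simp [twistedHom]
  | ht j => simp [twistedHom_markedVal]
  | hti j => simp [twistedHom_marked_inv]

theorem twistedDer_add (x y : Alg B J) :
    twistedDer σ f (x + y) = twistedDer σ f x + twistedDer σ f y := by
  simp [twistedDer]

@[simp] theorem twistedDer_zero : twistedDer σ f 0 = 0 := by simp [twistedDer]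

@[simp] theorem twistedDer_one : twistedDer σ f 1 = 0 := by simp [twistedDer]

theorem twistedDer_mul (x y : Alg B J) :
    twistedDer σ f (x * y) = twistedDer σ f x * y + σ x * twistedDer σ f y := by
  have := congrFun (congrFun (map_mul (twistedHom σ f) x y) 0) 1
  rw [twistedHom_apply σ f x, twistedHom_apply σ f y] at this
  simpa [Matrix.mul_apply, Fin.sum_univ_two, twistedDer, add_comm] using this

@[simp] theorem twistedDer_chord (c : B ⊕ J) : twistedDer σ f (chord c) = f c := by
  simp [twistedDer, twistedHom]

@[simp] theorem twistedDer_markedVal (j : J) : twistedDer σ f (markedVal j) = 0 := by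
  simp [twistedDer, twistedHom_markedVal]

@[simp] theorem twistedDer_marked_inv (j : J) :
    twistedDer σ f (((marked j)⁻¹ : (Alg B J)ˣ) : Alg B J) = 0 := by
  simp [twistedDer, twistedHom_marked_inv]

variable [DecidableEq B] [DecidableEq J]

/-- A chain homotopy between `σ` and the identity may be checked on generators. -/
theorem homotopy_of_chord {L : List (Event B J)} (hσ : ∀ x, σ (diff L x) = diff L (σ x))
    (hσt : ∀ j, σ (markedVal j) = markedVal j)
    (h : ∀ c, diff L (f c) + twistedDer σ f (diff L (chord c)) = chord c + σ (chord c))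
    (x : Alg B J) :
    diff L (twistedDer σ f x) + twistedDer σ f (diff L x) = x + σ x := by
  induction x using Alg.induction with
  | h0 => simp
  | h1 => simp [add_self_eq_zero']
  | hadd x y hx hy => 
    rw [twistedDer_add, diff_add, diff_add, twistedDer_add, map_add, add_add_add_comm, hx, hy,
      add_add_add_comm]
  | hmul x y hx hy =>
    rw [twistedDer_mul, diff_add, diff_mul, diff_mul, diff_mul, twistedDer_add, twistedDer_mul,
      twistedDer_mul, map_mul, hσ]
    -- Once the induction hypotheses are solved for the boundary terms, the mixed terms of the
    -- product occur twice and cancel in characteristic two.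
    have e1 : diff L (twistedDer σ f x) = x + σ x + twistedDer σ f (diff L x) := by
      rw [← hx, add_assoc, add_self_eq_zero', add_zero]
    have e2 : diff L (twistedDer σ f y) = y + σ y + twistedDer σ f (diff L y) := by
      rw [← hy, add_assoc, add_self_eq_zero', add_zero]
    rw [e1, e2]
    have c2 : ∀ z : Alg B J, z + z = 0 := add_self_eq_zero'
    have c3 : ∀ z : Alg B J, (2 : ℤ) • z = 0 := fun z => by rw [two_smul, c2]
    simp only [mul_add, add_mul]
    have := c2 (twistedDer σ f x * diff L y)
    have := c2 (σ x * y)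
    have := c2 (twistedDer σ f (diff L x) * y)
    have := c2 (diff L (σ x) * twistedDer σ f y)
    have := c2 (σ x * twistedDer σ f (diff L y))
    grind
  | hc c => rw [twistedDer_chord, h]
  | ht j => simp [hσt, add_self_eq_zero']
  | hti j => 
    have : σ (((marked j)⁻¹ : (Alg B J)ˣ) : Alg B J) = (((marked j)⁻¹ : (Alg B J)ˣ) : Alg B J) := by
      have h1 : Units.map (σ : Alg B J →* Alg B J) (marked j) = marked j := Units.ext (hσt j)
      have h2 := congrArg (fun u : (Alg B J)ˣ => ((u⁻¹ : (Alg B J)ˣ) : Alg B J)) h1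
      simpa using h2
    simp [this, add_self_eq_zero']

end Derivation

end CE


namespace CE

/-! ### Row, column and elimination operations on matrices indexed by natural numbers -/

section Ops

variable {A : Type*} [Ring A]

/-- Left multiplication by `Z_i(b)`, for matrices indexed by natural numbers. -/
def rowop (i : ℕ) (b : A) (M : ℕ → ℕ → A) : ℕ → ℕ → A := fun r c =>
  if r = i then b * M i c + M (i + 1) c else if r = i + 1 then M i c else M r c

/-- Right multiplication by `Z_i(b)`. -/
def colop (i : ℕ) (b : A) (M : ℕ → ℕ → A) : ℕ → ℕ → A := fun r c =>
  if c = i then M r i * b + M r (i + 1) else if c = i + 1 then M r i else M r c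

/-- The elimination step at level `k`. -/
def estep (t : ℕ → A) (k : ℕ) (M : ℕ → ℕ → A) : ℕ → ℕ → A := fun r c =>
  M r c + M r k * t k * M k c

/-- The elimination steps at the levels `a, …, a + d - 1`. -/
def esteps (t : ℕ → A) (a : ℕ) (M : ℕ → ℕ → A) : ℕ → ℕ → ℕ → A
  | 0 => M
  | d + 1 => estep t (a + d) (esteps t a M d)

/-- The identity matrix. -/
def idMat (A : Type*) [Ring A] : ℕ → ℕ → A := fun r c => if r = c then 1 else 0

/-- Right multiplication by a product of matrices `Z_i(b)`. -/
def colops (M : ℕ → ℕ → A) (P : List (ℕ × A)) : ℕ → ℕ → A :=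
  P.foldl (fun M p => colop p.1 p.2 M) M

/-- The matrix of a braid word. -/
def wordMat {N m : ℕ} (w : Fin m → Fin N) (b : Fin m → A) : ℕ → ℕ → A :=
  colops (idMat A) (List.ofFn fun k => ((w k : ℕ), b k))

end Ops

/-! ### Half-disk counts after a crossing or a cusp -/

section Eval

variable {B J : Type}

section Crossing

variable (D : ℕ → ℕ → Alg B J) {k p q : ℕ} (c : Alg B J)

theorem passCrossing_of_le (h : q ≤ p) : passCrossing D k c p q = 0 := by
  simp [passCrossing, Nat.not_lt.2 h]

/-- For actual half-disk counts the right-hand side is zero, since its first index exceeds the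
second. -/
theorem passCrossing_self : passCrossing D k c k (k + 1) = D (k + 1) k := by
  simp [passCrossing]

theorem passCrossing_col (h : p < k) : passCrossing D k c p k = D p (k + 1) + D p k * c := by
  simp only [passCrossing]
  split_ifs <;> first | rfl | omega

theorem passCrossing_col_succ (h : p < k) : passCrossing D k c p (k + 1) = D p k := by
  simp only [passCrossing]
  split_ifs <;> first | rfl | omega

theorem passCrossing_row (h : k + 1 < q) : passCrossing D k c k q = D (k + 1) q := by
  simp only [passCrossing]
  split_ifs <;> first | rfl | omega

theorem passCrossing_row_succ (h : k + 1 < q) :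
    passCrossing D k c (k + 1) q = D k q + c * D (k + 1) q := by
  simp only [passCrossing]
  split_ifs <;> first | rfl | omega

theorem passCrossing_of_ne (h : p < q) (h1 : p ≠ k) (h2 : p ≠ k + 1) (h3 : q ≠ k)
    (h4 : q ≠ k + 1) : passCrossing D k c p q = D p q := by
  simp only [passCrossing]
  split_ifs
  rfl

end Crossing

variable (s : Slice B J) {k : ℕ} (j : J) {p q : ℕ}

theorem rightCusp_of_le (h : q ≤ p) : (s.step (.rightCusp k j)).disks p q = 0 := by
  simp only [Slice.step]
  rw [passCrossing_of_le _ _ (by split_ifs <;> omega), zero_add]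
  by_cases hp : p < k
  · rw [passCrossing_of_le (p := k + 1) _ _ (by split_ifs; omega; omega), mul_zero]
  · rw [passCrossing_of_le (q := k) _ _ (by split_ifs <;> omega), zero_mul, zero_mul]

/-- The new half-disks are glued along the loop; the chord of the cusp enters through the corner
that either half may have at it. -/
theorem rightCusp_across (h : p < k) (h' : k ≤ q) :
    (s.step (.rightCusp k j)).disks p q = s.disks p (q + 2) +
      (s.disks p (k + 1) + s.disks p k * chord (.inr j)) * markedVal j *
        (s.disks k (q + 2) + chord (.inr j) * s.disks (k + 1) (q + 2)) := by
  simp only [Slice.step, if_pos h, if_neg (Nat.not_lt.2 h')]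
  rw [passCrossing_of_ne _ _ (by omega) (by omega) (by omega) (by omega) (by omega),
    passCrossing_col _ _ h, passCrossing_row_succ _ _ (by omega)]

/-- A glued half-disk has its top side above the cusp and its bottom side below it, so two strands
on the same side of the cusp gain nothing. -/
theorem rightCusp_before (h : p < q) (h' : q < k) :
    (s.step (.rightCusp k j)).disks p q = s.disks p q := by
  simp only [Slice.step, if_pos h', if_pos (h.trans h')]
  rw [passCrossing_of_ne _ _ (by omega) (by omega) (by omega) (by omega) (by omega),
    passCrossing_of_le (p := k + 1) _ _ (by omega), mul_zero, add_zero]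

theorem rightCusp_after (h : p < q) (h' : k ≤ p) :
    (s.step (.rightCusp k j)).disks p q = s.disks (p + 2) (q + 2) := by
  simp only [Slice.step, if_neg (Nat.not_lt.2 h'), if_neg (Nat.not_lt.2 (h'.trans h.le))]
  rw [passCrossing_of_ne _ _ (by omega) (by omega) (by omega) (by omega) (by omega),
    passCrossing_of_le (q := k) _ _ (by omega), zero_mul, zero_mul, add_zero]

/-- The `2 * i` new strands form nested pairs, symmetric about the middle of the block that starts
at `K`; the other strands keep their counts, with shifted positions. -/
theorem leftCusps_disks (K i : ℕ) (s : Slice B J) (p q : ℕ) :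
    (((List.range i).map fun a => Event.leftCusp (K + a)).foldl Slice.step s).disks p q =
      if K ≤ p ∧ p < K + 2 * i then
        (if K ≤ q ∧ q < K + 2 * i ∧ p < q ∧ p + q + 1 = 2 * (K + i) then 1 else 0)
      else if K ≤ q ∧ q < K + 2 * i then 0
      else s.disks (if p < K then p else p - 2 * i) (if q < K then q else q - 2 * i) := by
  induction i generalizing p q with
  | zero =>
    rw [if_neg (by omega), if_neg (by omega)]
    simp
  | succ i ih =>
    rw [List.range_succ, List.map_append, List.foldl_append]
    simp only [List.map_cons, List.map_nil, List.foldl_cons, List.foldl_nil, Slice.step, ih]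
    by_cases h1 : p = K + i ∧ q = K + i + 1
    · rw [if_pos h1, if_pos (by omega), if_pos (by omega)]
    · rw [if_neg h1]
      by_cases h2 : p = K + i ∨ p = K + i + 1 ∨ q = K + i ∨ q = K + i + 1
      · rw [if_pos h2]
        split_ifs <;> first | rfl | omega
      · rw [if_neg h2]
        -- The last cusp is the innermost one. Removing its two strands turns a block of `i + 1`
        -- cusps into one of `i`; this is the bookkeeping for a single index.
        have e : ∀ a, a ≠ K + i → a ≠ K + i + 1 →
          (K ≤ (if a < K + i then a else a - 2) ∧ (if a < K + i then a else a - 2) < K + 2 * i ↔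
            K ≤ a ∧ a < K + 2 * (i + 1)) ∧
          (¬(K ≤ a ∧ a < K + 2 * (i + 1)) →
            (if (if a < K + i then a else a - 2) < K then (if a < K + i then a else a - 2) else
            (if a < K + i then a else a - 2) - 2 * i) = if a < K then a else a - 2 * (i + 1)) := by
          intro a h1 h2
          split_ifs <;> omega
        have ep := e p (by omega) (by omega)
        have eq := e q (by omega) (by omega)
        by_cases hp : K ≤ p ∧ p < K + 2 * (i + 1)
        · rw [if_pos (ep.1.2 hp), if_pos hp]
          apply if_congr _ rfl rfl
          split_ifs <;> omega
        · rw [if_neg (fun h => hp (ep.1.1 h)), if_neg hp, ep.2 hp]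
          by_cases hq : K ≤ q ∧ q < K + 2 * (i + 1)
          · rw [if_pos (eq.1.2 hq), if_pos hq]
          · rw [if_neg (fun h => hq (eq.1.1 h)), if_neg hq, eq.2 hq]

theorem leftCusps_maslov (K i : ℕ) (s : Slice B J) (p : ℕ) :
    (((List.range i).map fun a => Event.leftCusp (K + a)).foldl Slice.step s).maslov p =
      if p < K then s.maslov p else if p < K + i then 1 else if p < K + 2 * i then 0
      else s.maslov (p - 2 * i) := by
  induction i generalizing p with
  | zero =>
    simp
    grind
  | succ i ih =>
    rw [List.range_succ, List.map_append, List.foldl_append]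
    simp only [List.map_cons, List.map_nil, List.foldl_cons, List.foldl_nil, Slice.step, ih]
    have : p - 2 - 2 * i = p - 2 * (i + 1) := by omega
    split_ifs <;> first | rfl | omega | (rw [this])

end Eval

/-! ### Reading a front piece by piece -/

section Append

variable {B J : Type} [DecidableEq B] [DecidableEq J]

theorem diffGenFrom_append (s : Slice B J) (L L' : List (Event B J)) (x : B ⊕ J) :
    diffGenFrom s (L ++ L') x = diffGenFrom s L x + diffGenFrom (L.foldl Slice.step s) L' x := by
  induction L generalizing s with
  | nil => simp [diffGenFrom]
  | cons e L ih => cases e <;> simp [diffGenFrom, ih, add_assoc]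

theorem degreeGenFrom_append (s : Slice B J) (L L' : List (Event B J)) (x : B ⊕ J) :
    degreeGenFrom s (L ++ L') x =
      degreeGenFrom s L x + degreeGenFrom (L.foldl Slice.step s) L' x := by
  induction L generalizing s with
  | nil => simp [degreeGenFrom]
  | cons e L ih => cases e <;> simp [degreeGenFrom, ih, add_assoc]

theorem diffGenFrom_leftCusps (s : Slice B J) (l : List ℕ) (f : ℕ → ℕ) (x : B ⊕ J) :
    diffGenFrom s (l.map fun a => Event.leftCusp (f a)) x = 0 := by
  induction l generalizing s with
  | nil => rfl
  | cons a l ih => simp [diffGenFrom, ih]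

theorem degreeGenFrom_leftCusps (s : Slice B J) (l : List ℕ) (f : ℕ → ℕ) (x : B ⊕ J) :
    degreeGenFrom s (l.map fun a => Event.leftCusp (f a)) x = 0 := by
  induction l generalizing s with
  | nil => rfl
  | cons a l ih => simp [degreeGenFrom, ih]

end Append

/-! ### Slices of rainbow closures -/

section Rainbow

variable {B : Type} {N : ℕ}

/-- The slice of a rainbow closure in which the levels `< m` have been closed, with half-disk
counts given by the matrix `M` (rows: top strands, columns: bottom strands). -/
structure IsRainbow (m : ℕ) (s : Slice B (Fin (N + 1))) (M : ℕ → ℕ → Alg B (Fin (N + 1))) :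
    Prop where
  maslov : ∀ p, s.maslov p = if p + m < N + 1 then 1 else 0
  zero : ∀ p q, ¬(p + m < N + 1 ∧ N + 1 ≤ q + m ∧ q + 2 * m < 2 * (N + 1)) → s.disks p q = 0
  eq : ∀ r c p q, m ≤ r → m ≤ c → c ≤ N → p + r = N → q + 2 * m = N + 1 + c →
    s.disks p q = M r c

namespace IsRainbow

variable {m : ℕ} {s : Slice B (Fin (N + 1))} {M : ℕ → ℕ → Alg B (Fin (N + 1))}

/-- A bottom side either goes straight or turns at the crossing: this is right multiplication by
$Z_i$. In the position, `2 * m` accounts for the strands of the closed levels, which lay above. -/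
theorem bottom (h : IsRainbow m s M) {i k : ℕ} (hi : i < N) (hm : m ≤ i)
    (hk : k + 2 * m = N + 1 + i) (b : B) :
    IsRainbow m (s.step (.crossing k b)) (colop i (chord (.inl b)) M) where
  maslov p := by
    simp only [Slice.step, h.maslov]
    split_ifs <;> first | rfl | omega
  zero p q hpq := by
    simp only [Slice.step]
    rcases lt_or_ge p q with hlt | hle
    · by_cases h1 : p = k
      · subst h1
        by_cases h2 : q = p + 1
        · subst h2
          rw [passCrossing_self, h.zero _ _ (by omega)]
        · rw [passCrossing_row _ _ (by omega), h.zero _ _ (by omega)]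
      · by_cases h2 : p = k + 1
        · subst h2
          rw [passCrossing_row_succ _ _ (by omega), h.zero _ _ (by omega), h.zero _ _ (by omega),
            mul_zero, add_zero]
        · by_cases h3 : q = k
          · subst h3
            rw [passCrossing_col _ _ (by omega), h.zero _ _ (by omega), h.zero _ _ (by omega),
              zero_mul, add_zero]
          · by_cases h4 : q = k + 1
            · subst h4
              rw [passCrossing_col_succ _ _ (by omega), h.zero _ _ (by omega)]
            · rw [passCrossing_of_ne _ _ hlt h1 h2 h3 h4, h.zero _ _ hpq]
    · exact passCrossing_of_le _ _ hle
  eq r c p q hr hc hc' hp hq := by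
    simp only [Slice.step, colop]
    split_ifs with h1 h2
    · obtain rfl : q = k := by omega
      rw [passCrossing_col _ _ (by omega), h.eq r (i + 1) p (q + 1) hr (by omega) (by omega) hp
        (by omega), h.eq r i p q hr (by omega) (by omega) hp (by omega)]
      exact add_comm _ _
    · obtain rfl : q = k + 1 := by omega
      rw [passCrossing_col_succ _ _ (by omega), h.eq r i p k hr (by omega) (by omega) hp (by omega)]
    · rw [passCrossing_of_ne _ _ (by omega) (by omega) (by omega) (by omega) (by omega),
        h.eq r c p q hr hc hc' hp hq]

/-- The mirror image: top sides are exchanged, which is left multiplication by $Z_i$. -/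
theorem top (h : IsRainbow m s M) {i k : ℕ} (hm : m ≤ i) (hk : k + 1 + i = N) (b : B) :
    IsRainbow m (s.step (.crossing k b)) (rowop i (chord (.inl b)) M) where
  maslov p := by
    simp only [Slice.step, h.maslov]
    split_ifs <;> first | rfl | omega
  zero p q hpq := by
    simp only [Slice.step]
    rcases lt_or_ge p q with hlt | hle
    · by_cases h1 : p = k
      · subst h1
        by_cases h2 : q = p + 1
        · subst h2
          rw [passCrossing_self, h.zero _ _ (by omega)]
        · rw [passCrossing_row _ _ (by omega), h.zero _ _ (by omega)]
      · by_cases h2 : p = k + 1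
        · subst h2
          rw [passCrossing_row_succ _ _ (by omega), h.zero _ _ (by omega), h.zero _ _ (by omega),
            mul_zero, add_zero]
        · by_cases h3 : q = k
          · subst h3
            rw [passCrossing_col _ _ (by omega), h.zero _ _ (by omega), h.zero _ _ (by omega),
              zero_mul, add_zero]
          · by_cases h4 : q = k + 1
            · subst h4
              rw [passCrossing_col_succ _ _ (by omega), h.zero _ _ (by omega)]
            · rw [passCrossing_of_ne _ _ hlt h1 h2 h3 h4, h.zero _ _ hpq]
    · exact passCrossing_of_le _ _ hle
  eq r c p q hr hc hc' hp hq := by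
    simp only [Slice.step, rowop]
    split_ifs with h1 h2
    · obtain rfl : p = k + 1 := by omega
      rw [passCrossing_row_succ _ _ (by omega), h.eq (i + 1) c k q (by omega) hc hc' (by omega) hq,
        h.eq i c (k + 1) q (by omega) hc hc' (by omega) hq]
      exact add_comm _ _
    · obtain rfl : p = k := by omega
      rw [passCrossing_row _ _ (by omega), h.eq i c _ q (by omega) hc hc' (by omega) hq]
    · rw [passCrossing_of_ne _ _ (by omega) (by omega) (by omega) (by omega) (by omega),
        h.eq r c p q hr hc hc' hp hq]

/-- No half-disk joins two top strands or two bottom strands, so the chord drops out of the gluing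
formula and a bare elimination step remains. -/
theorem cusp (h : IsRainbow m s M) {k : ℕ} (hk : k + m = N) {j : Fin (N + 1)}
    {t : ℕ → Alg B (Fin (N + 1))} (ht : t m = markedVal j) :
    IsRainbow (m + 1) (s.step (.rightCusp k j)) (estep t m M) where
  maslov p := by
    simp only [Slice.step, h.maslov]
    split_ifs <;> first | rfl | omega
  zero p q hpq := by
    rcases lt_or_ge p q with hlt | hle
    · by_cases h1 : q < k
      · rw [rightCusp_before _ _ hlt h1, h.zero _ _ (by omega)]
      · by_cases h2 : k ≤ p
        · rw [rightCusp_after _ _ hlt h2, h.zero _ _ (by omega)]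
        · rw [rightCusp_across _ _ (by omega) (by omega), h.zero p (q + 2) (by omega),
            h.zero k (q + 2) (by omega), h.zero (k + 1) (q + 2) (by omega)]
          simp
    · exact rightCusp_of_le _ _ hle
  eq r c p q hr hc hc' hp hq := by
    rw [rightCusp_across _ _ (by omega) (by omega), h.zero p k (by omega),
      h.zero (k + 1) (q + 2) (by omega), h.eq r c p (q + 2) (by omega) (by omega) hc' hp (by omega),
      h.eq r m p (k + 1) (by omega) (by omega) (by omega) hp (by omega),
      h.eq m c k (q + 2) (by omega) (by omega) (by omega) (by omega) (by omega), estep, ht]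
    simp

theorem bottom_disks (h : IsRainbow m s M) {i k : ℕ}
    (hk : k + 2 * m = N + 1 + i) (hm : m ≤ i) : s.disks k (k + 1) = 0 :=
  h.zero _ _ (by omega)

theorem cusp_disks (h : IsRainbow m s M) {k : ℕ} (hk : k + m = N) :
    s.disks k (k + 1) = M m m :=
  h.eq m m _ _ le_rfl le_rfl (by omega) hk (by omega)

theorem leftCusps : IsRainbow 0 ((CE.leftCusps B N).foldl Slice.step Slice.empty)
    (idMat (Alg B (Fin (N + 1)))) := by
  have e : CE.leftCusps B N = (List.range (N + 1)).map fun a => Event.leftCusp (0 + a) := by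
    simp [CE.leftCusps]
  refine ⟨fun p => ?_, fun p q hpq => ?_, fun r c p q _ _ hc hp hq => ?_⟩
  · rw [e, leftCusps_maslov]
    simp only [Slice.empty]
    split_ifs <;> first | rfl | omega
  · rw [e, leftCusps_disks]
    simp only [Slice.empty]
    split_ifs <;> first | rfl | omega
  · rw [e, leftCusps_disks]
    simp only [Slice.empty, idMat]
    split_ifs <;> first | rfl | omega

theorem braidWord {l : ℕ} {s : Slice B (Fin (N + 1))} {M : ℕ → ℕ → Alg B (Fin (N + 1))}
    (h : IsRainbow 0 s M) (w : Fin l → Fin N) (lab : Fin l → B) :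
    IsRainbow 0 ((CE.braidWord w lab).foldl Slice.step s)
      (colops M (List.ofFn fun k => ((w k : ℕ), chord (.inl (lab k))))) := by
  induction l generalizing s M with
  | zero => simpa [CE.braidWord, colops] using h
  | succ l ih =>
    simp only [CE.braidWord, List.ofFn_succ, List.foldl_cons, colops]
    exact ih (h.bottom (w 0).2 (Nat.zero_le _) (by simp) (lab 0)) _ _

variable [DecidableEq B]

/-- Two bottom strands never bound a half-disk. -/
theorem diffGenFrom_braidWord {l : ℕ} {s : Slice B (Fin (N + 1))}
    {M : ℕ → ℕ → Alg B (Fin (N + 1))} (h : IsRainbow 0 s M) (w : Fin l → Fin N)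
    (lab : Fin l → B) (x : B ⊕ Fin (N + 1)) : diffGenFrom s (CE.braidWord w lab) x = 0 := by
  induction l generalizing s M with
  | zero => simp [CE.braidWord, diffGenFrom]
  | succ l ih =>
    have h2 := h.bottom (w 0).2 (Nat.zero_le _) (k := N + 1 + w 0) (by simp) (lab 0)
    have := ih h2 (fun k => w k.succ) (fun k => lab k.succ)
    simp only [CE.braidWord, List.ofFn_succ] at this ⊢
    rw [bottomCrossing, diffGenFrom, this, h.bottom_disks (i := w 0) (by simp) (Nat.zero_le _)]
    simp

theorem degreeGenFrom_braidWord {l : ℕ} {s : Slice B (Fin (N + 1))}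
    {M : ℕ → ℕ → Alg B (Fin (N + 1))} (h : IsRainbow 0 s M) (w : Fin l → Fin N)
    (lab : Fin l → B) (x : B ⊕ Fin (N + 1)) : degreeGenFrom s (CE.braidWord w lab) x = 0 := by
  induction l generalizing s M with
  | zero => simp [CE.braidWord, degreeGenFrom]
  | succ l ih =>
    have h2 := h.bottom (w 0).2 (Nat.zero_le _) (k := N + 1 + w 0) (by simp) (lab 0)
    have := ih h2 (fun k => w k.succ) (fun k => lab k.succ)
    simp only [CE.braidWord, List.ofFn_succ] at this ⊢
    rw [bottomCrossing, degreeGenFrom, this, h.maslov, h.maslov,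
      if_neg (c := N + 1 + (w 0).val + 0 < N + 1) (by omega),
      if_neg (c := N + 1 + (w 0).val + 1 + 0 < N + 1) (by omega)]
    simp

end IsRainbow

/-- In a sorted list, raising the upper bound by one appends one element; this peels off the
outermost right cusp. -/
theorem filter_lt_succ {n : ℕ} (l : List (Fin n)) (hl : l.Pairwise (· < ·)) (a b : ℕ) (hab : a ≤ b)
    (hb : b < n) (hmem : ⟨b, hb⟩ ∈ l) :
    l.filter (fun j => a ≤ j.val ∧ j.val < b + 1) =
      l.filter (fun j => a ≤ j.val ∧ j.val < b) ++ [⟨b, hb⟩] := by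
  induction l with
  | nil => simp at hmem
  | cons x l ih =>
    rw [List.pairwise_cons] at hl
    rcases List.mem_cons.1 hmem with h | h
    · subst h
      have h1 : ∀ c, (∀ y ∈ l, ¬ (a ≤ y.val ∧ y.val < c)) →
          l.filter (fun j => a ≤ j.val ∧ j.val < c) = [] := by
        intro c hc
        rw [List.filter_eq_nil_iff]
        intro y hy
        simpa using hc y hy
      have h2 : ∀ y ∈ l, b < y.val := fun y hy => hl.1 y hy
      rw [List.filter_cons_of_pos (by simp [hab]), List.filter_cons_of_neg (by simp),
        h1 _ fun y hy => by have := h2 y hy; omega, h1 _ fun y hy => by have := h2 y hy; omega]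
      rfl
    · have hx : x.val < b := hl.1 _ h
      by_cases hxa : a ≤ x.val
      · rw [List.filter_cons_of_pos (by simp; omega), List.filter_cons_of_pos (by simp; omega),
          ih hl.2 h, List.cons_append]
      · rw [List.filter_cons_of_neg (by simp; omega), List.filter_cons_of_neg (by simp; omega),
          ih hl.2 h]

/-- The right cusps of the levels `a, …, b - 1`. -/
def cusps (B : Type) (N a b : ℕ) : List (Event B (Fin (N + 1))) :=
  rightCusps B N (fun j => a ≤ j.val ∧ j.val < b)

theorem cusps_self (a : ℕ) : cusps B N a a = [] := by
  simp [cusps, rightCusps]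

theorem cusps_succ {a b : ℕ} (hab : a ≤ b) (hb : b < N + 1) :
    cusps B N a (b + 1) = cusps B N a b ++ [.rightCusp (N - b) ⟨b, hb⟩] := by
  simp only [cusps, rightCusps]
  rw [filter_lt_succ _ (List.pairwise_lt_finRange _) a b hab hb (List.mem_finRange _)]
  simp

theorem rightCusps_eq_cusps {p : Fin (N + 1) → Prop} [DecidablePred p] {a b : ℕ}
    (h : ∀ j, p j ↔ a ≤ j.val ∧ j.val < b) : rightCusps B N p = cusps B N a b := by
  simp only [cusps, rightCusps, h]

/-- The marked points, with indices in `ℕ`. -/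
noncomputable def markedNat (B : Type) (N : ℕ) (k : ℕ) : Alg B (Fin (N + 1)) :=
  if h : k < N + 1 then markedVal ⟨k, h⟩ else 0

theorem markedNat_of_lt {k : ℕ} (h : k < N + 1) : markedNat B N k = markedVal ⟨k, h⟩ := dif_pos h

theorem markedNat_val (j : Fin (N + 1)) : markedNat B N j = markedVal j := dif_pos j.2

namespace IsRainbow

theorem cusps {a : ℕ} {s : Slice B (Fin (N + 1))} {M : ℕ → ℕ → Alg B (Fin (N + 1))}
    (h : IsRainbow a s M) (d : ℕ) (hd : a + d ≤ N + 1) :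
    IsRainbow (a + d) ((CE.cusps B N a (a + d)).foldl Slice.step s)
      (esteps (markedNat B N) a M d) := by
  induction d with
  | zero => simpa [cusps_self, esteps] using h
  | succ d ih =>
    rw [← add_assoc, cusps_succ (by omega) (by omega), List.foldl_append]
    exact (ih (by omega)).cusp (by omega) (markedNat_of_lt _)

variable [DecidableEq B]

/-- The chord of level `j` sees the diagonal entry that is left when the levels from `a` to `j - 1`
have been eliminated. -/
theorem diffGenFrom_cusps {a : ℕ} {s : Slice B (Fin (N + 1))} {M : ℕ → ℕ → Alg B (Fin (N + 1))}
    (h : IsRainbow a s M) (d : ℕ) (hd : a + d ≤ N + 1) (x : B ⊕ Fin (N + 1)) :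
    diffGenFrom s (CE.cusps B N a (a + d)) x = x.elim (fun _ => 0) fun j =>
      if a ≤ j.val ∧ j.val < a + d then
        (((marked j)⁻¹ : (Alg B (Fin (N + 1)))ˣ) : Alg B (Fin (N + 1))) +
          esteps (markedNat B N) a M (j - a) j j else 0 := by
  induction d with
  | zero =>
    rw [add_zero, cusps_self]
    rcases x with x | j
    · rfl
    · simp [diffGenFrom]
  | succ d ih =>
    rw [← add_assoc, cusps_succ (by omega) (by omega), diffGenFrom_append, ih (by omega)]
    rcases x with x | j
    · simp [diffGenFrom]
    · simp only [diffGenFrom, Sum.elim_inr, Sum.inr.injEq]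
      rw [(h.cusps d (by omega)).cusp_disks (by omega)]
      by_cases hj : j.val = a + d
      · have hj' : j = ⟨a + d, by omega⟩ := Fin.ext hj
        rw [if_neg (by omega), if_pos hj', if_pos (by omega), zero_add, add_zero, hj, Nat.add_sub_cancel_left, ← hj']
      · rw [if_neg (c := j = _) (fun h => hj (congrArg Fin.val h)), add_zero, add_zero]
        refine if_congr ?_ rfl rfl
        omega

theorem degreeGenFrom_cusps {a : ℕ} {s : Slice B (Fin (N + 1))} (d : ℕ) (hd : a + d ≤ N + 1)
    (x : B ⊕ Fin (N + 1)) : degreeGenFrom s (CE.cusps B N a (a + d)) x =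
      x.elim (fun _ => 0) fun j => if a ≤ j.val ∧ j.val < a + d then 1 else 0 := by
  induction d with
  | zero =>
    rw [add_zero, cusps_self]
    rcases x with x | j
    · rfl
    · simp [degreeGenFrom]
  | succ d ih =>
    rw [← add_assoc, cusps_succ (by omega) (by omega), degreeGenFrom_append, ih (by omega)]
    rcases x with x | j
    · simp [degreeGenFrom]
    · simp only [degreeGenFrom, Sum.elim_inr, Sum.inr.injEq]
      by_cases hj : j.val = a + d
      · have hj' : j = ⟨a + d, by omega⟩ := Fin.ext hj
        rw [if_neg (by omega), if_pos hj', if_pos (by omega), zero_add, add_zero]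
      · rw [if_neg (c := j = _) (fun h => hj (congrArg Fin.val h)), add_zero, add_zero]
        refine if_congr ?_ rfl rfl
        omega

end IsRainbow

end Rainbow
end CE


namespace CE

/-! ### Commutation rules of the matrix operations -/

section OpsLemmas

variable {A : Type*} [Ring A]

theorem esteps_add (t : ℕ → A) (a : ℕ) (M : ℕ → ℕ → A) (d e : ℕ) :
    esteps t a M (d + e) = esteps t (a + d) (esteps t a M d) e := by
  induction e with
  | zero => rfl
  | succ e ih => rw [← add_assoc, esteps, esteps, ih, add_assoc]

theorem colop_rowop (i : ℕ) (b : A) (j : ℕ) (c : A) (M : ℕ → ℕ → A) :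
    colop j c (rowop i b M) = rowop i b (colop j c M) := by
  funext r s
  simp only [colop, rowop]
  split_ifs <;> noncomm_ring

theorem colops_rowop (i : ℕ) (b : A) (M : ℕ → ℕ → A) (P : List (ℕ × A)) :
    colops (rowop i b M) P = rowop i b (colops M P) := by
  induction P generalizing M with
  | nil => rfl
  | cons p P ih => rw [colops, List.foldl_cons, colop_rowop]; exact ih _

/-- The pivot row of an elimination below `i` is neither of the two rows that are combined.
Geometrically, the crossing slides past the cusp. -/
theorem estep_rowop (t : ℕ → A) {i k : ℕ} (hk : k < i) (b : A) (M : ℕ → ℕ → A) :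
    estep t k (rowop i b M) = rowop i b (estep t k M) := by
  funext r s
  simp only [estep, rowop, if_neg hk.ne, if_neg (hk.trans (Nat.lt_succ_self i)).ne]
  split_ifs <;> noncomm_ring

theorem estep_colop (t : ℕ → A) {i k : ℕ} (hk : k < i) (b : A) (M : ℕ → ℕ → A) :
    estep t k (colop i b M) = colop i b (estep t k M) := by
  funext r s
  simp only [estep, colop, if_neg hk.ne, if_neg (hk.trans (Nat.lt_succ_self i)).ne]
  split_ifs <;> noncomm_ring

theorem esteps_rowop (t : ℕ → A) {i d : ℕ} (hd : d ≤ i) (b : A) (M : ℕ → ℕ → A) :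
    esteps t 0 (rowop i b M) d = rowop i b (esteps t 0 M d) := by
  induction d with
  | zero => rfl
  | succ d ih => rw [esteps, ih (by omega), estep_rowop _ (by omega), esteps]

theorem esteps_colop (t : ℕ → A) {i d : ℕ} (hd : d ≤ i) (b : A) (M : ℕ → ℕ → A) :
    esteps t 0 (colop i b M) d = colop i b (esteps t 0 M d) := by
  induction d with
  | zero => rfl
  | succ d ih => rw [esteps, ih (by omega), estep_colop _ (by omega), esteps]

section Hom

variable {A' : Type*} [Ring A'] (f : A →+* A')

theorem map_rowop (i : ℕ) (b : A) (M : ℕ → ℕ → A) (r c : ℕ) :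
    f (rowop i b M r c) = rowop i (f b) (fun r c => f (M r c)) r c := by
  simp only [rowop]
  split_ifs <;> simp

theorem map_colop (i : ℕ) (b : A) (M : ℕ → ℕ → A) (r c : ℕ) :
    f (colop i b M r c) = colop i (f b) (fun r c => f (M r c)) r c := by
  simp only [colop]
  split_ifs <;> simp

theorem map_esteps (t : ℕ → A) (a : ℕ) (M : ℕ → ℕ → A) (d r c : ℕ) :
    f (esteps t a M d r c) = esteps (fun k => f (t k)) a (fun r c => f (M r c)) d r c := by
  induction d generalizing r c with
  | zero => rfl
  | succ d ih => simp only [esteps, estep, map_add, map_mul, ih]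

theorem map_colops (M : ℕ → ℕ → A) (P : List (ℕ × A)) (r c : ℕ) :
    f (colops M P r c) = colops (fun r c => f (M r c)) (P.map fun p => (p.1, f p.2)) r c := by
  induction P generalizing M with
  | nil => rfl
  | cons p P ih =>
    simp only [colops, List.map_cons, List.foldl_cons] at ih ⊢
    rw [ih]
    rw [show (fun r c => f (colop p.1 p.2 M r c)) = colop p.1 (f p.2) fun r c => f (M r c) from
      funext fun _ => funext fun _ => map_colop f _ _ _ _ _]

theorem map_wordMat {N m : ℕ} (w : Fin m → Fin N) (b : Fin m → A) (r c : ℕ) :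
    f (wordMat w b r c) = wordMat w (fun k => f (b k)) r c := by
  rw [wordMat, map_colops, wordMat, List.map_ofFn]
  have : (fun r c => f (idMat A r c)) = idMat A' := by
    funext r c
    simp only [idMat]
    split_ifs <;> simp
  rw [this]
  rfl

end Hom

theorem wordMat_wordRight {N l : ℕ} (β : Fin l → Fin N) (i : Fin N) (b : Fin (l + 1) → A) :
    wordMat (wordRight β i) b =
      colop i (b (Fin.last l)) (wordMat β fun k => b k.castSucc) := by
  simp only [wordMat, List.ofFn_succ', List.concat_eq_append, colops, List.foldl_append,
    List.foldl_cons, List.foldl_nil, wordRight, Fin.snoc_last, Fin.snoc_castSucc]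

theorem colop_idMat (i : ℕ) (b : A) : colop i b (idMat A) = rowop i b (idMat A) := by
  funext r c
  simp only [colop, rowop, idMat]
  split_ifs <;> first | omega | simp

/-- The first letter acts on the identity matrix, where the row and the column operation agree; as a
row operation it commutes with all later letters. -/
theorem wordMat_wordLeft {N l : ℕ} (β : Fin l → Fin N) (i : Fin N) (b : Fin (l + 1) → A) :
    wordMat (wordLeft i β) b = rowop i (b 0) (wordMat β fun k => b k.succ) := by
  rw [wordMat, List.ofFn_succ, colops, List.foldl_cons]
  simp only [wordLeft, Fin.cons_zero, Fin.cons_succ]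
  rw [colop_idMat]
  exact colops_rowop _ _ _ _

end OpsLemmas

section PassCrossing

variable {B J : Type}

/-- Splits an identity of half-disk counts by the position relative to the crossing, for use with
the explicit counts near a pushed left cusp. -/
theorem passCrossing_eq {D F : ℕ → ℕ → Alg B J} {k : ℕ} {c : Alg B J}
    (h0 : ∀ p q, q ≤ p → 0 = F p q) (hs : D (k + 1) k = F k (k + 1))
    (hc : ∀ p < k, D p (k + 1) + D p k * c = F p k) (hc' : ∀ p < k, D p k = F p (k + 1))
    (hr : ∀ q > k + 1, D (k + 1) q = F k q)
    (hr' : ∀ q > k + 1, D k q + c * D (k + 1) q = F (k + 1) q)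
    (hn : ∀ p q, p < q → p ≠ k → p ≠ k + 1 → q ≠ k → q ≠ k + 1 → D p q = F p q) :
    passCrossing D k c = F := by
  funext p q
  rcases lt_or_ge p q with hlt | hle
  · by_cases h1 : p = k
    · subst h1
      by_cases h2 : q = p + 1
      · subst h2
        rw [passCrossing_self, hs]
      · rw [passCrossing_row _ _ (by omega), hr q (by omega)]
    · by_cases h2 : p = k + 1
      · subst h2
        rw [passCrossing_row_succ _ _ (by omega), hr' q (by omega)]
      · by_cases h3 : q = k
        · subst h3
          rw [passCrossing_col _ _ (by omega), hc p (by omega)]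
        · by_cases h4 : q = k + 1
          · subst h4
            rw [passCrossing_col_succ _ _ (by omega), hc' p (by omega)]
          · rw [passCrossing_of_ne _ _ hlt h1 h2 h3 h4, hn p q hlt h1 h2 h3 h4]
  · rw [passCrossing_of_le _ _ hle, h0 p q hle]

end PassCrossing

/-! ### Slices after a right cusp has been pushed through a strand -/

section Interlaced

variable {B : Type} {N : ℕ}

/-- The slice after pushing the cusp of level `i` through a strand of level `i + 1`: the bottom
strand of level `i` is above the top strand of level `i + 1`.  The position of the top strand of
level `i` is `k`.  The row `i` of `R` belongs to the top strand of level `i + 1`. -/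
structure IsInterlaced (i k : ℕ) (s : Slice B (Fin (N + 1)))
    (R : ℕ → ℕ → Alg B (Fin (N + 1))) : Prop where
  pos : k + 1 + i = N
  maslov : ∀ p, s.maslov p = if p < k + 1 ∨ p = k + 2 then 1 else 0
  before : ∀ p q, p < q → q ≤ k → s.disks p q = 0
  after : ∀ p q, k + 3 ≤ p → p < q → s.disks p q = 0
  far : ∀ p q, 2 * k + 4 ≤ q → s.disks p q = 0
  col_bot : ∀ p r, p < k → p + r = N → s.disks p (k + 1) = R r i
  col_top : ∀ p, p < k → s.disks p (k + 2) = 0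
  outer : ∀ p q r c, p < k → k + 3 ≤ q → p + r = N → q + 2 * i = N + 1 + c → c ≤ N →
    s.disks p q = R r c
  inner : s.disks k (k + 1) = R (i + 1) i
  row_zero : s.disks k (k + 2) = 0
  row : ∀ q c, k + 3 ≤ q → q + 2 * i = N + 1 + c → c ≤ N → s.disks k q = R (i + 1) c
  row_bot : ∀ q, k + 2 ≤ q → s.disks (k + 1) q = 0
  row_top : ∀ q c, k + 3 ≤ q → q + 2 * i = N + 1 + c → c ≤ N → s.disks (k + 2) q = R i c

/-- The crossing meets a top and a bottom strand. Every entry that its chord would multiply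
vanishes, so `R` is merely re-indexed. -/
theorem IsRainbow.interlaced {s : Slice B (Fin (N + 1))} {R : ℕ → ℕ → Alg B (Fin (N + 1))}
    {i k : ℕ} (h : IsRainbow i s R) (hk : k + 1 + i = N) (b : B) :
    IsInterlaced i k (s.step (.crossing (k + 1) b)) R where
  pos := hk
  maslov p := by
    simp only [Slice.step, h.maslov]
    split_ifs <;> first | rfl | omega
  before p q hpq hq := by
    simp only [Slice.step]
    rw [passCrossing_of_ne _ _ hpq (by omega) (by omega) (by omega) (by omega),
      h.zero _ _ (by omega)]
  after p q hp hpq := by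
    simp only [Slice.step]
    rw [passCrossing_of_ne _ _ hpq (by omega) (by omega) (by omega) (by omega),
      h.zero _ _ (by omega)]
  far p q hq := by
    simp only [Slice.step]
    rcases lt_or_ge p q with hlt | hle
    · by_cases h1 : p = k + 1
      · rw [h1, passCrossing_row _ _ (by omega), h.zero _ _ (by omega)]
      · by_cases h2 : p = k + 1 + 1
        · rw [h2, passCrossing_row_succ _ _ (by omega), h.zero _ _ (by omega),
            h.zero _ _ (by omega), mul_zero, add_zero]
        · rw [passCrossing_of_ne _ _ hlt h1 h2 (by omega) (by omega), h.zero _ _ (by omega)]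
    · exact passCrossing_of_le _ _ hle
  col_bot p r hp hr := by
    simp only [Slice.step]
    rw [passCrossing_col _ _ (by omega), h.zero p (k + 1) (by omega),
      h.eq r i p (k + 1 + 1) (by omega) le_rfl (by omega) hr (by omega), zero_mul, add_zero]
  col_top p hp := by
    simp only [Slice.step]
    rw [passCrossing_col_succ _ _ (by omega), h.zero p (k + 1) (by omega)]
  outer p q r c hp hq hr hc hc' := by
    simp only [Slice.step]
    rw [passCrossing_of_ne _ _ (by omega) (by omega) (by omega) (by omega) (by omega),
      h.eq r c p q (by omega) (by omega) hc' hr hc]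
  inner := by
    simp only [Slice.step]
    rw [passCrossing_col _ _ (by omega), h.zero k (k + 1) (by omega),
      h.eq (i + 1) i k (k + 1 + 1) (by omega) le_rfl (by omega) (by omega) (by omega), zero_mul,
      add_zero]
  row_zero := by
    simp only [Slice.step]
    rw [passCrossing_col_succ _ _ (by omega), h.zero k (k + 1) (by omega)]
  row q c hq hc hc' := by
    simp only [Slice.step]
    rw [passCrossing_of_ne _ _ (by omega) (by omega) (by omega) (by omega) (by omega),
      h.eq (i + 1) c k q (by omega) (by omega) hc' (by omega) hc]
  row_bot q hq := by
    simp only [Slice.step]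
    by_cases h1 : q = k + 1 + 1
    · rw [h1, passCrossing_self, h.zero _ _ (by omega)]
    · rw [passCrossing_row _ _ (by omega), h.zero _ _ (by omega)]
  row_top q c hq hc hc' := by
    simp only [Slice.step]
    rw [passCrossing_row_succ _ _ (by omega), h.zero (k + 1 + 1) q (by omega),
      h.eq i c (k + 1) q le_rfl (by omega) hc' (by omega) hc, mul_zero, add_zero]

/-- Closing the two levels of an interlaced slice. -/
def closeTwo {A : Type*} [Ring A] (i : ℕ) (t₁ t₂ : A) (R : ℕ → ℕ → A) : ℕ → ℕ → A := fun r c =>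
  R r c + R r i * t₂ * R (i + 1) c + (R r (i + 1) + R r i * t₂ * R (i + 1) (i + 1)) * t₁ * R i c

namespace IsInterlaced

variable {s : Slice B (Fin (N + 1))} {R : ℕ → ℕ → Alg B (Fin (N + 1))} {i k : ℕ}

/-- The first cusp pairs row `i + 1` with column `i`, the second one row `i` with column `i + 1`. -/
theorem close_top_bot (h : IsInterlaced i k s R) (j₁ j₂ : Fin (N + 1)) :
    IsRainbow (i + 2) ((s.step (.rightCusp k j₂)).step (.rightCusp k j₁))
      (closeTwo i (markedVal j₁) (markedVal j₂) R) := by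
  have hk := h.pos
  refine ⟨fun p => ?_, fun p q hpq => ?_, fun r c p q hr hc hc' hp hq => ?_⟩
  · simp only [Slice.step, h.maslov]
    split_ifs <;> first | rfl | omega
  · rcases lt_or_ge p q with hlt | hle
    · by_cases h1 : q < k
      · rw [rightCusp_before _ _ hlt h1, rightCusp_before _ _ hlt h1, h.before _ _ hlt h1.le]
      · by_cases h2 : k ≤ p
        · rw [rightCusp_after _ _ hlt h2, rightCusp_after _ _ (by omega) (by omega),
            h.after _ _ (by omega) (by omega)]
        · rw [rightCusp_across _ _ (by omega) (by omega),
            rightCusp_across (q := q + 2) _ _ (by omega) (by omega),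
            rightCusp_after (p := k) (q := q + 2) _ _ (by omega) (by omega),
            rightCusp_after (p := k + 1) (q := q + 2) _ _ (by omega) (by omega),
            h.far p _ (by omega), h.far k _ (by omega), h.far (k + 1) _ (by omega),
            h.far (k + 2) _ (by omega), h.far (k + 1 + 2) _ (by omega)]
          simp
    · exact rightCusp_of_le _ _ hle
  · rw [rightCusp_across _ _ (by omega) (by omega),
      rightCusp_across _ _ (by omega) (by omega),
      rightCusp_across _ _ (by omega) (by omega),
      rightCusp_across _ _ (by omega) (by omega),
      rightCusp_after _ _ (by omega) (by omega),
      rightCusp_after _ _ (by omega) (by omega),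
      h.outer p (q + 2 + 2) r c (by omega) (by omega) hp (by omega) hc',
      h.col_bot p r (by omega) hp, h.before p k (by omega) le_rfl,
      h.row (q + 2 + 2) c (by omega) (by omega) hc', h.row_bot _ (by omega),
      h.outer p (k + 1 + 2) r (i + 1) (by omega) (by omega) hp (by omega) (by omega),
      h.row (k + 1 + 2) (i + 1) (by omega) (by omega) (by omega), h.row_bot _ (by omega),
      h.col_top p (by omega), h.row_zero, h.row_bot _ (by omega),
      h.row_top (q + 2 + 2) c (by omega) (by omega) hc', h.after _ _ (by omega) (by omega)]
    simp [closeTwo]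

/-- Met in the other order, the two cusps produce the same gluings, bracketed differently. This is
the isotopy between `front₂` and `front₂'`. -/
theorem close_bot_top (h : IsInterlaced i k s R) (j₁ j₂ : Fin (N + 1)) :
    IsRainbow (i + 2) ((s.step (.rightCusp (k + 2) j₁)).step (.rightCusp k j₂))
      (closeTwo i (markedVal j₁) (markedVal j₂) R) := by
  have hk := h.pos
  refine ⟨fun p => ?_, fun p q hpq => ?_, fun r c p q hr hc hc' hp hq => ?_⟩
  · simp only [Slice.step, h.maslov]
    split_ifs <;> first | rfl | omega
  · rcases lt_or_ge p q with hlt | hle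
    · by_cases h1 : q < k
      · rw [rightCusp_before _ _ hlt h1, rightCusp_before _ _ hlt (by omega),
          h.before _ _ hlt h1.le]
      · by_cases h2 : k ≤ p
        · rw [rightCusp_after _ _ hlt h2, rightCusp_after _ _ (by omega) (by omega),
            h.after _ _ (by omega) (by omega)]
        · rw [rightCusp_across _ _ (by omega) (by omega),
            rightCusp_across (q := q + 2) _ _ (by omega) (by omega),
            rightCusp_across (p := k) (q := q + 2) _ _ (by omega) (by omega),
            rightCusp_across (p := k + 1) (q := q + 2) _ _ (by omega) (by omega),
            h.far p _ (by omega), h.far k _ (by omega), h.far (k + 1) _ (by omega),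
            h.far (k + 2) _ (by omega), h.far (k + 2 + 1) _ (by omega)]
          simp
    · exact rightCusp_of_le _ _ hle
  · rw [rightCusp_across _ _ (by omega) (by omega),
      rightCusp_across (q := q + 2) _ _ (by omega) (by omega),
      rightCusp_across (p := k) _ _ (by omega) (by omega),
      rightCusp_across (p := k + 1) _ _ (by omega) (by omega),
      rightCusp_before _ _ (by omega) (by omega),
      rightCusp_before _ _ (by omega) (by omega),
      h.outer p (q + 2 + 2) r c (by omega) (by omega) hp (by omega) hc',
      h.col_bot p r (by omega) hp, h.before p k (by omega) le_rfl,
      h.row (q + 2 + 2) c (by omega) (by omega) hc', h.row_bot _ (by omega),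
      h.outer p (k + 2 + 1) r (i + 1) (by omega) (by omega) hp (by omega) (by omega),
      h.row (k + 2 + 1) (i + 1) (by omega) (by omega) (by omega), h.row_bot _ (by omega),
      h.col_top p (by omega), h.row_zero, h.row_bot _ (by omega),
      h.row_top (q + 2 + 2) c (by omega) (by omega) hc', h.after _ _ (by omega) (by omega)]
    simp [closeTwo]
    noncomm_ring

theorem disks_bot (h : IsInterlaced i k s R) : s.disks (k + 2) (k + 3) = R i (i + 1) := by
  have := h.pos
  exact h.row_top _ _ le_rfl (by omega) (by omega)

end IsInterlaced

end Interlaced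
end CE


namespace CE

/-! ### Differentials and degrees of the fronts around the right-cusp moves -/

section Fronts

variable {B : Type} {N l : ℕ}

/-- The pivots of the elimination. -/
def pivot {A : Type*} [Ring A] (t : ℕ → A) (M : ℕ → ℕ → A) (j : ℕ) : A := esteps t 0 M j j j

theorem rightCusps_true : rightCusps B N (fun _ => True) = cusps B N 0 (0 + (N + 1)) :=
  rightCusps_eq_cusps fun j => by simp [Nat.le_of_lt_succ j.2]

theorem rightCusps_lt (i : Fin N) : rightCusps B N (fun j => j < i.castSucc) = cusps B N 0 (0 + i) :=
  rightCusps_eq_cusps fun j => by simp [Fin.lt_def]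

theorem rightCusps_ge (i : Fin N) :
    rightCusps B N (fun j => i.castSucc ≤ j) = cusps B N (0 + i) (0 + i + (N + 1 - i)) :=
  rightCusps_eq_cusps fun j => by
    have := j.2
    simp only [Fin.le_def, Fin.val_castSucc]
    omega

theorem rightCusps_gt (i : Fin N) :
    rightCusps B N (fun j => i.succ < j) = cusps B N (i + 2) (i + 2 + (N + 1 - (i + 2))) :=
  rightCusps_eq_cusps fun j => by
    have := j.2
    simp only [Fin.lt_def, Fin.val_succ]
    omega

section Dec
variable [DecidableEq B]

theorem diffGenFrom_leftCusps' (x : B ⊕ Fin (N + 1)) :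
    diffGenFrom Slice.empty (leftCusps B N) x = 0 := diffGenFrom_leftCusps _ _ id x

theorem degreeGenFrom_leftCusps' (x : B ⊕ Fin (N + 1)) :
    degreeGenFrom Slice.empty (leftCusps B N) x = 0 := degreeGenFrom_leftCusps _ _ id x

theorem IsRainbow.diffGenFrom_rightCusps {s : Slice B (Fin (N + 1))}
    {M : ℕ → ℕ → Alg B (Fin (N + 1))} (h : IsRainbow 0 s M) (x : B ⊕ Fin (N + 1)) :
    diffGenFrom s (rightCusps B N (fun _ => True)) x = x.elim (fun _ => 0) fun j =>
      (((marked j)⁻¹ : (Alg B (Fin (N + 1)))ˣ) : Alg B (Fin (N + 1))) +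
        pivot (markedNat B N) M j := by
  rw [rightCusps_true, h.diffGenFrom_cusps _ (by omega)]
  rcases x with x | j
  · rfl
  · simp [pivot, Nat.le_of_lt_succ j.2]

theorem degreeGenFrom_rightCusps (s : Slice B (Fin (N + 1))) (x : B ⊕ Fin (N + 1)) :
    degreeGenFrom s (rightCusps B N (fun _ => True)) x = x.elim (fun _ => 0) fun _ => 1 := by
  rw [rightCusps_true, IsRainbow.degreeGenFrom_cusps _ (by omega)]
  rcases x with x | j
  · rfl
  · simp [Nat.le_of_lt_succ j.2]

end Dec

/-- The differential of a Reeb chord of the rainbow closure of `w`. -/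
theorem diffGenFrom_rainbow {m : ℕ} (w : Fin m → Fin N) (x : Fin m ⊕ Fin (N + 1)) :
    diffGenFrom Slice.empty (rainbow w) x = x.elim (fun _ => 0) fun j =>
      (((marked j)⁻¹ : (Alg (Fin m) (Fin (N + 1)))ˣ) : Alg (Fin m) (Fin (N + 1))) +
        pivot (markedNat _ N) (wordMat w fun k => chord (.inl k)) j := by
  have h := IsRainbow.leftCusps (B := Fin m) (N := N)
  rw [rainbow, diffGenFrom_append, diffGenFrom_append, diffGenFrom_leftCusps',
    h.diffGenFrom_braidWord, List.foldl_append, (h.braidWord w id).diffGenFrom_rightCusps]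
  simp [wordMat]

theorem degreeGenFrom_rainbow {m : ℕ} (w : Fin m → Fin N) (x : Fin m ⊕ Fin (N + 1)) :
    degreeGenFrom Slice.empty (rainbow w) x = x.elim (fun _ => 0) fun _ => 1 := by
  have h := IsRainbow.leftCusps (B := Fin m) (N := N)
  rw [rainbow, degreeGenFrom_append, degreeGenFrom_append, degreeGenFrom_leftCusps',
    h.degreeGenFrom_braidWord, degreeGenFrom_rightCusps]
  simp

variable (β : Fin l → Fin N) (i : Fin N)

/-- The matrix of `β`, in a diagram with the labels `Cross₁`. -/
noncomputable def betaMat₁ : ℕ → ℕ → Alg (Cross₁ l) (Fin (N + 1)) :=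
  wordMat β fun k => chord (.inl (.beta k))

theorem isRainbow_front₃Left : IsRainbow i (Slice.after (front₃Left β i))
    (rowop i (chord (.inl .top)) (esteps (markedNat _ N) 0 (betaMat₁ β) i)) := by
  rw [Slice.after, front₃Left, List.foldl_append, List.foldl_append, List.foldl_append,
    rightCusps_lt]
  have h := (((IsRainbow.leftCusps (B := Cross₁ l) (N := N)).braidWord β Cross₁.beta).cusps i
    (by omega))
  rw [Nat.zero_add] at h ⊢
  exact h.top (i := i) le_rfl (by omega) Cross₁.top

theorem diffGenFrom_front₃' (x : Cross₁ l ⊕ Fin (N + 1)) :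
    diffGenFrom Slice.empty (front₃' β i) x = x.elim (fun _ => 0) fun j =>
      (((marked j)⁻¹ : (Alg (Cross₁ l) (Fin (N + 1)))ˣ) : Alg (Cross₁ l) (Fin (N + 1))) +
        pivot (markedNat _ N) (rowop i (chord (.inl .top)) (betaMat₁ β)) j := by
  have h := IsRainbow.leftCusps (B := Cross₁ l) (N := N)
  have h1 := h.top (i := i) (k := N - 1 - i) (Nat.zero_le _) (by omega) Cross₁.top
  have h2 := h1.braidWord β Cross₁.beta
  rw [colops_rowop] at h2
  rw [front₃', diffGenFrom_append, diffGenFrom_append, diffGenFrom_append, diffGenFrom_leftCusps',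
    List.foldl_append, List.foldl_append]
  simp only [List.foldl_cons, List.foldl_nil, topCrossing]
  rw [h1.diffGenFrom_braidWord, List.foldl_append, List.foldl_cons, List.foldl_nil,
    h2.diffGenFrom_rightCusps, diffGenFrom, diffGenFrom,
    h.zero _ _ (by omega)]
  simp [betaMat₁, wordMat]

theorem degreeGenFrom_front₃' (x : Cross₁ l ⊕ Fin (N + 1)) :
    degreeGenFrom Slice.empty (front₃' β i) x = x.elim (fun _ => 0) fun _ => 1 := by
  have h := IsRainbow.leftCusps (B := Cross₁ l) (N := N)
  have h1 := h.top (i := i) (k := N - 1 - i) (Nat.zero_le _) (by omega) Cross₁.top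
  rw [front₃', degreeGenFrom_append, degreeGenFrom_append, degreeGenFrom_append,
    degreeGenFrom_leftCusps', degreeGenFrom_rightCusps, List.foldl_append]
  simp only [List.foldl_cons, List.foldl_nil, topCrossing]
  rw [h1.degreeGenFrom_braidWord, degreeGenFrom, degreeGenFrom, h.maslov, h.maslov,
    if_pos (c := _ < _) (by omega), if_pos (c := _ < _) (by omega)]
  simp

/-- The pivots are those of `front₃'`: below level `i` the row operation does not touch them, and
from level `i` on it has been moved through the earlier eliminations. -/
theorem diffGenFrom_front₃ (x : Cross₁ l ⊕ Fin (N + 1)) :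
    diffGenFrom Slice.empty (front₃ β i) x = x.elim (fun _ => 0) fun j =>
      (((marked j)⁻¹ : (Alg (Cross₁ l) (Fin (N + 1)))ˣ) : Alg (Cross₁ l) (Fin (N + 1))) +
        pivot (markedNat _ N) (rowop i (chord (.inl .top)) (betaMat₁ β)) j := by
  have h := IsRainbow.leftCusps (B := Cross₁ l) (N := N)
  have h1 := h.braidWord β Cross₁.beta
  have h2 := h1.cusps i (by omega)
  have h3 := isRainbow_front₃Left β i
  rw [← Nat.zero_add i.val] at h3
  have h4 := h3.diffGenFrom_cusps (N + 1 - i) (by omega) x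
  rw [front₃, diffGenFrom_append, rightCusps_ge]
  rw [Slice.after] at h4
  rw [h4, front₃Left, diffGenFrom_append, diffGenFrom_append, diffGenFrom_append,
    diffGenFrom_leftCusps', h.diffGenFrom_braidWord, rightCusps_lt, List.foldl_append,
    h1.diffGenFrom_cusps _ (by omega), List.foldl_append, List.foldl_append, topCrossing,
    diffGenFrom, diffGenFrom, h2.zero _ _ (by omega)]
  rcases x with x | j
  · simp
  · have := j.2
    simp only [Sum.elim_inr, reduceCtorEq, if_false, add_zero, zero_add, pivot, Nat.zero_le,
      true_and, Nat.sub_zero]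
    by_cases hj : j.val < i
    · rw [if_pos hj, if_neg (by omega), add_zero, esteps_rowop _ hj.le, rowop, if_neg (by omega),
        if_neg (by omega)]
      rfl
    · have e : j.val = i + (j - i) := by omega
      rw [if_neg hj, if_pos (by omega), zero_add]
      conv_rhs => rw [e, esteps_add, esteps_rowop _ le_rfl, ← e, Nat.zero_add]

theorem degreeGenFrom_front₃ (x : Cross₁ l ⊕ Fin (N + 1)) :
    degreeGenFrom Slice.empty (front₃ β i) x = x.elim (fun _ => 0) fun _ => 1 := by
  have h := IsRainbow.leftCusps (B := Cross₁ l) (N := N)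
  have h1 := h.braidWord β Cross₁.beta
  have h2 := h1.cusps i (by omega)
  rw [front₃, degreeGenFrom_append, rightCusps_ge, IsRainbow.degreeGenFrom_cusps _ (by omega),
    front₃Left, degreeGenFrom_append, degreeGenFrom_append, degreeGenFrom_append,
    degreeGenFrom_leftCusps', h.degreeGenFrom_braidWord, rightCusps_lt,
    IsRainbow.degreeGenFrom_cusps _ (by omega), List.foldl_append, List.foldl_append, topCrossing,
    degreeGenFrom, degreeGenFrom, h2.maslov, h2.maslov,
    if_pos (c := _ < _) (by omega), if_pos (c := _ < _) (by omega)]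
  rcases x with x | j
  · simp
  · have := j.2
    simp only [Sum.elim_inr, reduceCtorEq, if_false, add_zero, zero_add]
    split_ifs <;> omega

/-- The matrix of `β`, in a diagram with the labels `Cross`. -/
noncomputable def betaMat : ℕ → ℕ → Alg (Cross l) (Fin (N + 1)) :=
  wordMat β fun k => chord (.inl (.beta k))

/-- The half-disk counts between the strands of the levels `≥ i`, in `front₂`, after the crossing
of top strands. -/
noncomputable def interlacedMat : ℕ → ℕ → Alg (Cross l) (Fin (N + 1)) :=
  rowop i (chord (.inl .top))
    (esteps (markedNat _ N) 0 (colop i (chord (.inl .bot)) (betaMat β)) i)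

/-- The counts of half-disks at the right cusps of `front₂`. -/
noncomputable def interlacedPivot (j : ℕ) : Alg (Cross l) (Fin (N + 1)) :=
  if j < i then pivot (markedNat _ N) (colop i (chord (.inl .bot)) (betaMat β)) j
  else if j = i then interlacedMat β i i (i + 1)
  else if j = i + 1 then interlacedMat β i (i + 1) i
  else esteps (markedNat _ N) (i + 2)
    (closeTwo i (markedVal i.castSucc) (markedVal i.succ) (interlacedMat β i)) (j - (i + 2)) j j

/-- The differential of the Reeb chords of `front₂`. -/
noncomputable def interlacedDiff :
    Cross l ⊕ Fin (N + 1) → Alg (Cross l) (Fin (N + 1))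
  | .inl .mid => interlacedMat β i i i
  | .inl _ => 0
  | .inr j =>
    (((marked j)⁻¹ : (Alg (Cross l) (Fin (N + 1)))ˣ) : Alg (Cross l) (Fin (N + 1))) +
      interlacedPivot β i j

/-- The degrees of the Reeb chords of `front₂`. -/
def interlacedDegree : Cross l ⊕ Fin (N + 1) → ℤ
  | .inl .mid => 1
  | .inl _ => 0
  | .inr _ => 1

/-- The crossing `mid` sees the entry `(i, i)` of the matrix after the top crossing, and the two
displaced cusps see the entries `(i + 1, i)` and `(i, i + 1)`. -/
theorem diffGenFrom_front₂ (x : Cross l ⊕ Fin (N + 1)) :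
    diffGenFrom Slice.empty (front₂ β i) x = interlacedDiff β i x := by
  obtain ⟨k, hk⟩ : ∃ k, k + 1 + i.val = N := ⟨N - 1 - i, by omega⟩
  have e1 : N - 1 - i = k := by omega
  have e2 : N - i = k + 1 := by omega
  have h := IsRainbow.leftCusps (B := Cross l) (N := N)
  have h1 := h.braidWord β Cross.beta
  have h2 := h1.bottom (i := i) i.2 (Nat.zero_le _) (k := N + 1 + i) (by omega) Cross.bot
  have h3 := h2.cusps i (by omega)
  have h4 := h3
  rw [Nat.zero_add] at h4
  have h5 := h4.top (i := i) le_rfl hk Cross.top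
  have h6 := h5.interlaced hk Cross.mid
  have h7 := h6.close_top_bot i.castSucc i.succ
  rw [Nat.zero_add] at h3
  rw [front₂, diffGenFrom_append, diffGenFrom_append, diffGenFrom_append, diffGenFrom_append,
    diffGenFrom_append, diffGenFrom_leftCusps', h.diffGenFrom_braidWord, rightCusps_lt,
    rightCusps_gt]
  simp only [List.foldl_append, List.foldl_cons, List.foldl_nil, topCrossing, bottomCrossing, e1,
    e2, Nat.zero_add]
  rw [h7.diffGenFrom_cusps _ (by omega)]
  have h8 := h2.diffGenFrom_cusps i (by omega) x
  rw [Nat.zero_add] at h8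
  rw [h8]
  simp only [diffGenFrom]
  rw [h1.zero (N + 1 + i) _ (by omega), h4.zero k _ (by omega),
    h5.eq i i (k + 1) (k + 1 + 1) le_rfl le_rfl (by omega) (by omega) (by omega), h6.inner,
    rightCusp_after _ _ (by omega) le_rfl, h6.disks_bot]
  rcases x with x | j
  · rcases x with x | _ | _ | _ <;> simp [interlacedDiff, interlacedMat, betaMat, wordMat]
  · have := j.2
    simp only [Sum.elim_inr, reduceCtorEq, if_false, add_zero, zero_add, interlacedDiff,
      Sum.inr.injEq, interlacedPivot, Nat.zero_le, true_and, Nat.sub_zero]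
    have hj1 : j = i.succ ↔ j.val = i + 1 := Fin.ext_iff
    have hj2 : j = i.castSucc ↔ j.val = i := Fin.ext_iff
    simp only [hj1, hj2]
    rcases lt_trichotomy j.val i with hj | hj | hj
    · simp only [if_pos hj, if_neg hj.ne, if_neg (show ¬ j.val = i + 1 by omega),
        if_neg (show ¬ (i + 2 ≤ j.val ∧ j.val < i + 2 + (N + 1 - (i + 2))) by omega), add_zero]
      rfl
    · obtain rfl : j = i.castSucc := hj2.2 hj
      simp only [Fin.val_castSucc, lt_irrefl, if_false, if_true,
        if_neg (show ¬ i.val = i + 1 by omega), if_neg (show ¬ (i.val + 2 ≤ i ∧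
          i < i.val + 2 + (N + 1 - (i + 2))) by omega), add_zero, zero_add]
      rfl
    · by_cases hj' : j.val = i + 1
      · obtain rfl : j = i.succ := hj1.2 hj'
        simp only [Fin.val_succ, if_neg (show ¬ i.val + 1 < i by omega), if_true,
          if_neg (show ¬ i.val + 1 = i by omega), if_neg (show ¬ (i.val + 2 ≤ i + 1 ∧
            i + 1 < i.val + 2 + (N + 1 - (i + 2))) by omega), add_zero, zero_add]
        rfl
      · simp only [if_neg hj.not_gt, if_neg hj.ne', if_neg hj',
          if_pos (show i + 2 ≤ j.val ∧ j.val < i + 2 + (N + 1 - (i + 2)) by omega), zero_add]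
        rfl

theorem degreeGenFrom_front₂ (x : Cross l ⊕ Fin (N + 1)) :
    degreeGenFrom Slice.empty (front₂ β i) x = interlacedDegree x := by
  obtain ⟨k, hk⟩ : ∃ k, k + 1 + i.val = N := ⟨N - 1 - i, by omega⟩
  have e1 : N - 1 - i = k := by omega
  have e2 : N - i = k + 1 := by omega
  have h := IsRainbow.leftCusps (B := Cross l) (N := N)
  have h1 := h.braidWord β Cross.beta
  have h2 := h1.bottom (i := i) i.2 (Nat.zero_le _) (k := N + 1 + i) (by omega) Cross.bot
  have h4 := h2.cusps i (by omega)
  rw [Nat.zero_add] at h4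
  have h5 := h4.top (i := i) le_rfl hk Cross.top
  rw [front₂, degreeGenFrom_append, degreeGenFrom_append, degreeGenFrom_append,
    degreeGenFrom_append, degreeGenFrom_append, degreeGenFrom_leftCusps',
    h.degreeGenFrom_braidWord, rightCusps_lt, rightCusps_gt,
    IsRainbow.degreeGenFrom_cusps _ (by omega), IsRainbow.degreeGenFrom_cusps _ (by omega)]
  simp only [List.foldl_append, List.foldl_cons, List.foldl_nil, topCrossing, bottomCrossing, e1,
    e2, Nat.zero_add, degreeGenFrom, h1.maslov, h4.maslov, h5.maslov]
  rcases x with x | j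
  · rcases x with x | _ | _ | _ <;> simp [interlacedDegree] <;> grind
  · have := j.2
    have hj1 : j = i.succ ↔ j.val = i + 1 := Fin.ext_iff
    have hj2 : j = i.castSucc ↔ j.val = i := Fin.ext_iff
    simp only [Sum.elim_inr, reduceCtorEq, if_false, add_zero, zero_add, interlacedDegree,
      Sum.inr.injEq, hj1, hj2]
    split_ifs <;> omega

theorem diffGenFrom_front₂' (x : Cross l ⊕ Fin (N + 1)) :
    diffGenFrom Slice.empty (front₂' β i) x = interlacedDiff β i x := by
  obtain ⟨k, hk⟩ : ∃ k, k + 1 + i.val = N := ⟨N - 1 - i, by omega⟩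
  have e1 : N - 1 - i = k := by omega
  have e2 : N - i = k + 1 := by omega
  have h := IsRainbow.leftCusps (B := Cross l) (N := N)
  have h1 := h.braidWord β Cross.beta
  have h3 := h1.cusps i (by omega)
  rw [Nat.zero_add] at h3
  have h4 := h3.top (i := i) le_rfl hk Cross.top
  have h5 := h4.bottom (i := i) i.2 le_rfl (k := k + 2) (by omega) Cross.bot
  -- The bottom crossing, met here after the small cusps and the top crossing, is slid back in front
  -- of them; the matrix becomes `interlacedMat`.
  rw [colop_rowop, ← esteps_colop _ le_rfl] at h5
  have h6 := h5.interlaced hk Cross.mid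
  have h7 := h6.close_bot_top i.castSucc i.succ
  rw [front₂', diffGenFrom_append, diffGenFrom_append, diffGenFrom_append,
    diffGenFrom_append, diffGenFrom_leftCusps', h.diffGenFrom_braidWord, rightCusps_lt,
    rightCusps_gt]
  simp only [List.foldl_append, List.foldl_cons, List.foldl_nil, topCrossing, e1,
    e2, Nat.zero_add, Nat.add_assoc k 1 1, Nat.reduceAdd]
  rw [h7.diffGenFrom_cusps _ (by omega)]
  have h8 := h1.diffGenFrom_cusps i (by omega) x
  rw [Nat.zero_add] at h8
  rw [h8]
  simp only [diffGenFrom]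
  rw [h3.zero k _ (by omega), h4.zero (k + 2) _ (by omega),
    h5.eq i i (k + 1) (k + 1 + 1) le_rfl le_rfl (by omega) (by omega) (by omega),
    rightCusp_before _ _ (by omega) (by omega), h6.inner, h6.disks_bot]
  rcases x with x | j
  · rcases x with x | _ | _ | _ <;> simp [interlacedDiff, interlacedMat, betaMat, wordMat]
  · have := j.2
    simp only [Sum.elim_inr, reduceCtorEq, if_false, add_zero, zero_add, interlacedDiff,
      Sum.inr.injEq, interlacedPivot, Nat.zero_le, true_and, Nat.sub_zero]
    have hj1 : j = i.succ ↔ j.val = i + 1 := Fin.ext_iff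
    have hj2 : j = i.castSucc ↔ j.val = i := Fin.ext_iff
    simp only [hj1, hj2]
    rcases lt_trichotomy j.val i with hj | hj | hj
    · simp only [if_pos hj, if_neg hj.ne, if_neg (show ¬ j.val = i + 1 by omega),
        if_neg (show ¬ (i + 2 ≤ j.val ∧ j.val < i + 2 + (N + 1 - (i + 2))) by omega), add_zero,
        pivot]
      -- A column operation at `i` does not change the pivots below `i`, so these cusps may come
      -- before the crossing.
      rw [esteps_colop _ hj.le, colop, if_neg (by omega), if_neg (by omega)]
      rfl
    · obtain rfl : j = i.castSucc := hj2.2 hj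
      simp only [Fin.val_castSucc, lt_irrefl, if_false, if_true,
        if_neg (show ¬ i.val = i + 1 by omega), if_neg (show ¬ (i.val + 2 ≤ i ∧
          i < i.val + 2 + (N + 1 - (i + 2))) by omega), add_zero, zero_add]
      rfl
    · by_cases hj' : j.val = i + 1
      · obtain rfl : j = i.succ := hj1.2 hj'
        simp only [Fin.val_succ, if_neg (show ¬ i.val + 1 < i by omega), if_true,
          if_neg (show ¬ i.val + 1 = i by omega), if_neg (show ¬ (i.val + 2 ≤ i + 1 ∧
            i + 1 < i.val + 2 + (N + 1 - (i + 2))) by omega), add_zero, zero_add]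
        rfl
      · simp only [if_neg hj.not_gt, if_neg hj.ne', if_neg hj',
          if_pos (show i + 2 ≤ j.val ∧ j.val < i + 2 + (N + 1 - (i + 2)) by omega), zero_add]
        rfl

theorem degreeGenFrom_front₂' (x : Cross l ⊕ Fin (N + 1)) :
    degreeGenFrom Slice.empty (front₂' β i) x = interlacedDegree x := by
  obtain ⟨k, hk⟩ : ∃ k, k + 1 + i.val = N := ⟨N - 1 - i, by omega⟩
  have e1 : N - 1 - i = k := by omega
  have e2 : N - i = k + 1 := by omega
  have h := IsRainbow.leftCusps (B := Cross l) (N := N)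
  have h1 := h.braidWord β Cross.beta
  have h3 := h1.cusps i (by omega)
  rw [Nat.zero_add] at h3
  have h4 := h3.top (i := i) le_rfl hk Cross.top
  have h5 := h4.bottom (i := i) i.2 le_rfl (k := k + 2) (by omega) Cross.bot
  rw [front₂', degreeGenFrom_append, degreeGenFrom_append, degreeGenFrom_append,
    degreeGenFrom_append, degreeGenFrom_leftCusps',
    h.degreeGenFrom_braidWord, rightCusps_lt, rightCusps_gt,
    IsRainbow.degreeGenFrom_cusps _ (by omega), IsRainbow.degreeGenFrom_cusps _ (by omega)]
  simp only [List.foldl_append, topCrossing, e1,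
    e2, Nat.zero_add, Nat.add_assoc k 1 1, Nat.reduceAdd, degreeGenFrom, h3.maslov, h4.maslov,
    h5.maslov]
  rcases x with x | j
  · rcases x with x | _ | _ | _ <;> simp [interlacedDegree] <;> grind
  · have := j.2
    have hj1 : j = i.succ ↔ j.val = i + 1 := Fin.ext_iff
    have hj2 : j = i.castSucc ↔ j.val = i := Fin.ext_iff
    simp only [Sum.elim_inr, reduceCtorEq, if_false, add_zero, zero_add, interlacedDegree,
      Sum.inr.injEq, hj1, hj2]
    split_ifs <;> omega

end Fronts
end CE


namespace CE

/-! ### Half-disk counts near a left cusp pushed through a strand -/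

section Zigzag

variable {B : Type} {N : ℕ}

/-- The half-disk counts of a rainbow with the crossing matrix `Z_i(z)`. -/
noncomputable def crossedDisks (i k : ℕ) (z : Alg B (Fin (N + 1))) (p q : ℕ) : Alg B (Fin (N + 1)) :=
  if p = k + 1 ∧ q = k + 2 + 2 * i then z
  else if p = k ∧ q = k + 2 + 2 * i ∨ p = k + 1 ∧ q = k + 3 + 2 * i ∨
    p < q ∧ p ≠ k ∧ p ≠ k + 1 ∧ p + q + 1 = 2 * (k + 2 + i) then 1 else 0

/-- After the three crossings near the cusp the slice is an ordinary rainbow again, whose only trace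
of them is the factor $Z_i(z)$. -/
theorem isRainbow_crossedDisks {i k : ℕ} (hk : k + 1 + i = N) (z : Alg B (Fin (N + 1)))
    {s : Slice B (Fin (N + 1))} (hm : ∀ p, s.maslov p = if p < N + 1 then 1 else 0)
    (hd : s.disks = crossedDisks i k z) :
    IsRainbow 0 s (rowop i z (idMat (Alg B (Fin (N + 1))))) := by
  refine ⟨fun p => hm p, fun p q hpq => ?_, fun r c p q _ _ hc hp hq => ?_⟩
  · rw [hd, crossedDisks, if_neg (by omega), if_neg (by omega)]
  · rw [hd]
    simp only [crossedDisks, rowop, idMat]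
    split_ifs <;> first | omega | simp

/-- The half-disk counts after pushing the left cusp of level `i` through a strand of level
`i + 1`, before the crossing at the cusp. -/
noncomputable def zigzag₀ (k : ℕ) (p q : ℕ) : Alg B (Fin (N + 1)) :=
  if p = k + 2 ∧ q = k + 3 ∨ p = k ∧ q = k + 1 ∨ p < k ∧ p + q + 1 = 2 * (k + 2) then 1 else 0

/-- The half-disk counts after this crossing, with chord `c`. -/
noncomputable def zigzag₁ (k : ℕ) (c : Alg B (Fin (N + 1))) (p q : ℕ) : Alg B (Fin (N + 1)) :=
  if p = k ∧ q = k + 1 ∨ p = k + 2 ∧ q = k + 3 then c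
  else if p = k ∧ q = k + 2 ∨ p = k + 1 ∧ q = k + 3 ∨ p < k ∧ p + q + 1 = 2 * (k + 2) then 1
  else 0

theorem passCrossing_zigzag₀ (k : ℕ) (c : Alg B (Fin (N + 1))) :
    passCrossing (zigzag₀ k) (k + 1) c = zigzag₁ k c := by
  apply passCrossing_eq <;> intros <;> simp only [zigzag₀, zigzag₁, true_and, and_true] <;>
    split_ifs <;> first | omega | simp

/-- The half-disk counts after the next crossing, of bottom strands, with chord `b`; between the
two crossings and the levels `> i` there are `i` more levels. -/
noncomputable def zigzagBot (i k : ℕ) (c b : Alg B (Fin (N + 1))) (p q : ℕ) :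
    Alg B (Fin (N + 1)) :=
  if p = k ∧ q = k + 1 then c else if p = k ∧ q = k + 2 + 2 * i then b
  else if p < q ∧ p + q + 1 = 2 * (k + 2 + i) then 1 else 0

/-- The same, with a crossing of top strands, with chord `b`. -/
noncomputable def zigzagTop (i k : ℕ) (c b : Alg B (Fin (N + 1))) (p q : ℕ) :
    Alg B (Fin (N + 1)) :=
  if p = k + 2 + 2 * i ∧ q = k + 3 + 2 * i then c else if p = k + 1 ∧ q = k + 3 + 2 * i then b
  else if p < q ∧ p + q + 1 = 2 * (k + 2 + i) then 1 else 0

theorem passCrossing_zigzag₁_bot (k : ℕ) (c b : Alg B (Fin (N + 1))) :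
    passCrossing (zigzag₁ k c) (k + 2) b = zigzagBot 0 k c b := by
  apply passCrossing_eq <;> intros <;> simp only [zigzag₁, zigzagBot, true_and, and_true] <;>
    split_ifs <;> first | omega | simp

theorem passCrossing_zigzag₁_top (k : ℕ) (c b : Alg B (Fin (N + 1))) :
    passCrossing (zigzag₁ k c) k b = zigzagTop 0 k c b := by
  apply passCrossing_eq <;> intros <;> simp only [zigzag₁, zigzagTop, true_and, and_true] <;>
    split_ifs <;> first | omega | simp

theorem leftCusps_zigzagBot (i k : ℕ) (c b : Alg B (Fin (N + 1))) (s : Slice B (Fin (N + 1)))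
    (hs : s.disks = zigzagBot 0 k c b) :
    (((List.range i).map fun a => Event.leftCusp (k + 2 + a)).foldl Slice.step s).disks =
      zigzagBot i k c b := by
  funext p q
  rw [leftCusps_disks, hs]
  by_cases hp : k + 2 ≤ p ∧ p < k + 2 + 2 * i
  · rw [if_pos hp]
    simp only [zigzagBot]
    split_ifs <;> first | omega | rfl
  · by_cases hq : k + 2 ≤ q ∧ q < k + 2 + 2 * i
    · rw [if_neg hp, if_pos hq]
      simp only [zigzagBot]
      split_ifs <;> first | omega | rfl
    · rw [if_neg hp, if_neg hq]
      by_cases h1 : p < k + 2 <;> by_cases h2 : q < k + 2 <;>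
        simp only [h1, h2, if_true, if_false, zigzagBot] <;> split_ifs <;> first | omega | rfl

theorem leftCusps_zigzagTop (i k : ℕ) (c b : Alg B (Fin (N + 1))) (s : Slice B (Fin (N + 1)))
    (hs : s.disks = zigzagTop 0 k c b) :
    (((List.range i).map fun a => Event.leftCusp (k + 2 + a)).foldl Slice.step s).disks =
      zigzagTop i k c b := by
  funext p q
  rw [leftCusps_disks, hs]
  by_cases hp : k + 2 ≤ p ∧ p < k + 2 + 2 * i
  · rw [if_pos hp]
    simp only [zigzagTop]
    split_ifs <;> first | omega | rfl
  · by_cases hq : k + 2 ≤ q ∧ q < k + 2 + 2 * i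
    · rw [if_neg hp, if_pos hq]
      simp only [zigzagTop]
      split_ifs <;> first | omega | rfl
    · rw [if_neg hp, if_neg hq]
      by_cases h1 : p < k + 2 <;> by_cases h2 : q < k + 2 <;>
        simp only [h1, h2, if_true, if_false, zigzagTop] <;> split_ifs <;> first | omega | rfl

/-- A half-disk turns at the top or at the bottom crossing, so the two chords add up. -/
theorem passCrossing_zigzagBot (i k : ℕ) (c b b' : Alg B (Fin (N + 1))) :
    passCrossing (zigzagBot i k c b) k b' = crossedDisks i k (b' + b) := by
  apply passCrossing_eq <;> intros <;> simp only [zigzagBot, crossedDisks, true_and, and_true] <;>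
    split_ifs <;> first | omega | simp [add_comm]

theorem passCrossing_zigzagTop (i k : ℕ) (c b b' : Alg B (Fin (N + 1))) :
    passCrossing (zigzagTop i k c b) (k + 2 + 2 * i) b' = crossedDisks i k (b + b') := by
  apply passCrossing_eq <;> intros <;> simp only [zigzagTop, crossedDisks, true_and, and_true] <;>
    split_ifs <;> first | omega | simp

end Zigzag
end CE


namespace CE

/-! ### Differentials and degrees of the zigzag fronts -/

section Zigzag

variable {B : Type} {N : ℕ}

variable {l : ℕ}

theorem outerCusps_disks (k p q : ℕ) :
    (((List.range (k + 1)).map Event.leftCusp).foldl Slice.step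
      (Slice.empty : Slice B (Fin (N + 1)))).disks p q =
      if p < q ∧ p + q + 1 = 2 * (k + 1) then 1 else 0 := by
  have := leftCusps_disks 0 (k + 1) (Slice.empty : Slice B (Fin (N + 1))) p q
  simp only [Nat.zero_add] at this
  refine this.trans ?_
  simp only [Slice.empty]
  split_ifs <;> first | omega | rfl

theorem outerCusps_maslov (k p : ℕ) :
    (((List.range (k + 1)).map Event.leftCusp).foldl Slice.step
      (Slice.empty : Slice B (Fin (N + 1)))).maslov p = if p < k + 1 then 1 else 0 := by
  have := leftCusps_maslov 0 (k + 1) (Slice.empty : Slice B (Fin (N + 1))) p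
  simp only [Nat.zero_add] at this
  refine this.trans ?_
  simp only [Slice.empty]
  split_ifs <;> omega

theorem zigzag_low (k : ℕ) :
    ((((List.range (k + 1)).map Event.leftCusp).foldl Slice.step
      (Slice.empty : Slice B (Fin (N + 1)))).step (.leftCusp (k + 2))) =
      ⟨fun p => if p < k + 1 ∨ p = k + 2 then 1 else 0, zigzag₀ k⟩ := by
  simp only [Slice.step, outerCusps_disks, outerCusps_maslov, Slice.mk.injEq]
  constructor
  · funext p
    split_ifs <;> omega
  · funext p q
    simp only [zigzag₀]
    split_ifs <;> first | omega | rfl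

/-- Whether the cusp is inserted above or below the innermost pair, two pairs end up side by side.
Hence `front₄` and `front₄'` start with the same slice. -/
theorem zigzag_high (k : ℕ) :
    ((((List.range (k + 1)).map Event.leftCusp).foldl Slice.step
      (Slice.empty : Slice B (Fin (N + 1)))).step (.leftCusp k)) =
      ⟨fun p => if p < k + 1 ∨ p = k + 2 then 1 else 0, zigzag₀ k⟩ := by
  simp only [Slice.step, outerCusps_disks, outerCusps_maslov, Slice.mk.injEq]
  constructor
  · funext p
    split_ifs <;> omega
  · funext p q
    simp only [zigzag₀]
    split_ifs <;> first | omega | rfl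

variable (β : Fin l → Fin N) (i : Fin N)

/-- The differential of the Reeb chords of `front₄`. -/
noncomputable def zigzagDiff : Cross l ⊕ Fin (N + 1) → Alg (Cross l) (Fin (N + 1))
  | .inl .top => chord (.inl .mid)
  | .inl .bot => chord (.inl .mid)
  | .inl _ => 0
  | .inr j =>
    (((marked j)⁻¹ : (Alg (Cross l) (Fin (N + 1)))ˣ) : Alg (Cross l) (Fin (N + 1))) +
      pivot (markedNat _ N)
        (rowop i (chord (.inl .top) + chord (.inl .bot)) (betaMat β)) j

/-- The degrees of the Reeb chords of `front₄`. -/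
def zigzagDegree : Cross l ⊕ Fin (N + 1) → ℤ
  | .inl .mid => -1
  | .inl _ => 0
  | .inr _ => 1

/-- The end of the diagrams `front₄` and `front₄'`. -/
theorem IsRainbow.braid_closure {s : Slice (Cross l) (Fin (N + 1))}
    {z : Alg (Cross l) (Fin (N + 1))}
    (h : IsRainbow 0 s (rowop i z (idMat (Alg (Cross l) (Fin (N + 1))))))
    (x : Cross l ⊕ Fin (N + 1)) :
    diffGenFrom ((CE.braidWord β Cross.beta).foldl Slice.step s)
        (rightCusps _ N (fun _ => True)) x = x.elim (fun _ => 0) fun j =>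
      (((marked j)⁻¹ : (Alg (Cross l) (Fin (N + 1)))ˣ) : Alg (Cross l) (Fin (N + 1))) +
        pivot (markedNat _ N) (rowop i z (betaMat β)) j := by
  have h2 := h.braidWord β Cross.beta
  rw [h2.diffGenFrom_rightCusps, colops_rowop]
  rfl

/-- The strands about to cross at `bot`, and those at `top`, bound a half-disk with a corner at
`mid`, so both chords have boundary `mid`. Only their sum enters the matrix, and the sum is a cycle.
-/
theorem diffGenFrom_front₄ (x : Cross l ⊕ Fin (N + 1)) :
    diffGenFrom Slice.empty (front₄ β i) x = zigzagDiff β i x ∧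
      degreeGenFrom Slice.empty (front₄ β i) x = zigzagDegree x := by
  obtain ⟨k, hk⟩ : ∃ k, k + 1 + i.val = N := ⟨N - 1 - i, by omega⟩
  have e1 : N - 1 - i = k := by omega
  have e2 : N - i = k + 1 := by omega
  let s₀ : Slice (Cross l) (Fin (N + 1)) :=
    ⟨fun p => if p < k + 1 ∨ p = k + 2 then 1 else 0, zigzag₀ k⟩
  let s₁ : Slice (Cross l) (Fin (N + 1)) :=
    ⟨fun p => if p < k + 2 then 1 else 0, zigzag₁ k (chord (.inl .mid))⟩
  let s₂ : Slice (Cross l) (Fin (N + 1)) :=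
    ⟨fun p => if p < k + 2 then 1 else 0,
      zigzagBot 0 k (chord (.inl .mid)) (chord (.inl .bot))⟩
  have h0 : ((((List.range (k + 1)).map Event.leftCusp).foldl Slice.step
      (Slice.empty : Slice (Cross l) (Fin (N + 1)))).step (.leftCusp (k + 2))) = s₀ := zigzag_low k
  have h1 : s₀.step (.crossing (k + 1) Cross.mid) = s₁ := by
    simp only [s₀, Slice.step, passCrossing_zigzag₀, s₁, Slice.mk.injEq, and_true]
    funext p
    grind
  have h2 : s₁.step (.crossing (k + 2) Cross.bot) = s₂ := by
    simp only [Slice.step, s₁, passCrossing_zigzag₁_bot, s₂, Slice.mk.injEq, and_true]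
    funext p
    split_ifs <;> omega
  have h3 := leftCusps_zigzagBot i k _ _ s₂ rfl
  have h3' := leftCusps_maslov (k + 2) i s₂
  generalize hs₃ : ((List.range i).map fun a => Event.leftCusp (k + 2 + a)).foldl Slice.step s₂
    = s₃ at h3 h3'
  have h4 : IsRainbow 0 (s₃.step (.crossing k Cross.top)) _ :=
    isRainbow_crossedDisks hk (chord (.inl .top) + chord (.inl .bot))
      (fun p => by
        simp only [Slice.step, h3', s₂]
        split_ifs <;> omega)
      (by simp only [Slice.step, h3, passCrossing_zigzagBot])
  have h5 := h4.braid_closure β i x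
  have h6 := degreeGenFrom_rightCusps
    ((CE.braidWord β Cross.beta).foldl Slice.step (s₃.step (.crossing k Cross.top))) x
  have h7 : ∀ s : Slice (Cross l) (Fin (N + 1)),
      diffGenFrom s ((List.range (k + 1)).map Event.leftCusp) x = 0 :=
    fun s => diffGenFrom_leftCusps s _ id x
  have h8 : ∀ s : Slice (Cross l) (Fin (N + 1)),
      degreeGenFrom s ((List.range (k + 1)).map Event.leftCusp) x = 0 :=
    fun s => degreeGenFrom_leftCusps s _ id x
  have d0 : s₀.disks (k + 1) (k + 2) = 0 := by
    simp only [s₀, zigzag₀]; rw [if_neg (by omega)]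
  have d1 : s₁.disks (k + 2) (k + 3) = chord (.inl .mid) := by
    exact if_pos (by omega)
  have d2 : s₃.disks k (k + 1) = chord (.inl .mid) := by
    rw [h3]; exact if_pos (by omega)
  have m0 : s₀.maslov (k + 1) - s₀.maslov (k + 2) = -1 := by simp [s₀]
  have m1 : s₁.maslov (k + 2) - s₁.maslov (k + 3) = 0 := by simp [s₁]
  have m2 : s₃.maslov k - s₃.maslov (k + 1) = 0 := by
    rw [h3', h3']
    simp only [s₂]
    split_ifs <;> omega
  simp only [front₄, e1, e2, Nat.add_assoc k 1 1, Nat.reduceAdd, topCrossing]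
  simp only [diffGenFrom_append, degreeGenFrom_append, diffGenFrom, degreeGenFrom,
    List.foldl_append, List.foldl_cons, List.foldl_nil, h0, h1, h2, hs₃, diffGenFrom_leftCusps,
    degreeGenFrom_leftCusps, h6, h7, h8, d0, d1, d2, m0, m1, m2, h4.degreeGenFrom_braidWord,
    h4.diffGenFrom_braidWord, h5]
  rcases x with (x | _ | _ | _) | j <;> simp [zigzagDiff, zigzagDegree]

theorem diffGenFrom_front₄' (x : Cross l ⊕ Fin (N + 1)) :
    diffGenFrom Slice.empty (front₄' β i) x = zigzagDiff β i x ∧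
      degreeGenFrom Slice.empty (front₄' β i) x = zigzagDegree x := by
  obtain ⟨k, hk⟩ : ∃ k, k + 1 + i.val = N := ⟨N - 1 - i, by omega⟩
  have e1 : N - 1 - i = k := by omega
  have e2 : N - i = k + 1 := by omega
  have e3 : N + 1 + i = k + 2 + 2 * i := by omega
  let s₀ : Slice (Cross l) (Fin (N + 1)) :=
    ⟨fun p => if p < k + 1 ∨ p = k + 2 then 1 else 0, zigzag₀ k⟩
  let s₁ : Slice (Cross l) (Fin (N + 1)) :=
    ⟨fun p => if p < k + 2 then 1 else 0, zigzag₁ k (chord (.inl .mid))⟩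
  let s₂ : Slice (Cross l) (Fin (N + 1)) :=
    ⟨fun p => if p < k + 2 then 1 else 0,
      zigzagTop 0 k (chord (.inl .mid)) (chord (.inl .top))⟩
  have h0 : ((((List.range (k + 1)).map Event.leftCusp).foldl Slice.step
      (Slice.empty : Slice (Cross l) (Fin (N + 1)))).step (.leftCusp k)) = s₀ := zigzag_high k
  have h1 : s₀.step (.crossing (k + 1) Cross.mid) = s₁ := by
    simp only [s₀, Slice.step, passCrossing_zigzag₀, s₁, Slice.mk.injEq, and_true]
    funext p
    grind
  have h2 : s₁.step (.crossing k Cross.top) = s₂ := by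
    simp only [Slice.step, s₁, passCrossing_zigzag₁_top, s₂, Slice.mk.injEq, and_true]
    funext p
    split_ifs <;> omega
  have h3 := leftCusps_zigzagTop i k _ _ s₂ rfl
  have h3' := leftCusps_maslov (k + 2) i s₂
  generalize hs₃ : ((List.range i).map fun a => Event.leftCusp (k + 2 + a)).foldl Slice.step s₂
    = s₃ at h3 h3'
  have h4 : IsRainbow 0 (s₃.step (.crossing (k + 2 + 2 * i) Cross.bot)) _ :=
    isRainbow_crossedDisks hk (chord (.inl .top) + chord (.inl .bot))
      (fun p => by
        simp only [Slice.step, h3', s₂]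
        split_ifs <;> omega)
      (by simp only [Slice.step, h3, passCrossing_zigzagTop])
  have h5 := h4.braid_closure β i x
  have h6 := degreeGenFrom_rightCusps ((CE.braidWord β Cross.beta).foldl Slice.step
    (s₃.step (.crossing (k + 2 + 2 * i) Cross.bot))) x
  have h7 : ∀ s : Slice (Cross l) (Fin (N + 1)),
      diffGenFrom s ((List.range (k + 1)).map Event.leftCusp) x = 0 :=
    fun s => diffGenFrom_leftCusps s _ id x
  have h8 : ∀ s : Slice (Cross l) (Fin (N + 1)),
      degreeGenFrom s ((List.range (k + 1)).map Event.leftCusp) x = 0 :=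
    fun s => degreeGenFrom_leftCusps s _ id x
  have d0 : s₀.disks (k + 1) (k + 2) = 0 := by
    simp only [s₀, zigzag₀]; rw [if_neg (by omega)]
  have d1 : s₁.disks k (k + 1) = chord (.inl .mid) := by
    exact if_pos (by omega)
  have d2 : s₃.disks (k + 2 + 2 * i) (k + 2 + 2 * i + 1) = chord (.inl .mid) := by
    rw [h3]; exact if_pos (by omega)
  have m0 : s₀.maslov (k + 1) - s₀.maslov (k + 2) = -1 := by simp [s₀]
  have m1 : s₁.maslov k - s₁.maslov (k + 1) = 0 := by simp [s₁]
  have m2 : s₃.maslov (k + 2 + 2 * i) - s₃.maslov (k + 2 + 2 * i + 1) = 0 := by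
    rw [h3', h3']
    simp only [s₂]
    split_ifs <;> omega
  simp only [front₄', e1, e2, e3, Nat.add_assoc k 1 1, Nat.reduceAdd, topCrossing, bottomCrossing]
  simp only [diffGenFrom_append, degreeGenFrom_append, diffGenFrom, degreeGenFrom,
    List.foldl_append, List.foldl_cons, List.foldl_nil, h0, h1, h2, hs₃, diffGenFrom_leftCusps,
    degreeGenFrom_leftCusps, h6, h7, h8, d0, d1, d2, m0, m1, m2, h4.degreeGenFrom_braidWord,
    h4.diffGenFrom_braidWord, h5]
  rcases x with (x | _ | _ | _) | j <;> simp [zigzagDiff, zigzagDegree]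

end Zigzag
end CE


namespace CE

/-! ### Membership of matrix entries in subrings -/

section Subrings

variable {A : Type*} [Ring A] {S : Subring A}

/-- With its companions, this lets a property of all matrix entries be checked on generators as soon
as the elements that have it form a subring: being a cycle, being killed by a derivation, and so on.
-/
theorem rowop_mem {i : ℕ} {b : A} {M : ℕ → ℕ → A} (hb : b ∈ S) (hM : ∀ r c, M r c ∈ S) (r c : ℕ) :
    rowop i b M r c ∈ S := by
  simp only [rowop]
  split_ifs
  · exact S.add_mem (S.mul_mem hb (hM _ _)) (hM _ _)
  · exact hM _ _
  · exact hM _ _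

theorem colop_mem {i : ℕ} {b : A} {M : ℕ → ℕ → A} (hb : b ∈ S) (hM : ∀ r c, M r c ∈ S) (r c : ℕ) :
    colop i b M r c ∈ S := by
  simp only [colop]
  split_ifs
  · exact S.add_mem (S.mul_mem (hM _ _) hb) (hM _ _)
  · exact hM _ _
  · exact hM _ _

theorem esteps_mem {t : ℕ → A} {a : ℕ} {M : ℕ → ℕ → A} (ht : ∀ k, t k ∈ S)
    (hM : ∀ r c, M r c ∈ S) (d r c : ℕ) : esteps t a M d r c ∈ S := by
  induction d generalizing r c with
  | zero => exact hM r c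
  | succ d ih => exact S.add_mem (ih _ _) (S.mul_mem (S.mul_mem (ih _ _) (ht _)) (ih _ _))

theorem closeTwo_mem {i : ℕ} {t₁ t₂ : A} {R : ℕ → ℕ → A} (h1 : t₁ ∈ S) (h2 : t₂ ∈ S)
    (hR : ∀ r c, R r c ∈ S) (r c : ℕ) : closeTwo i t₁ t₂ R r c ∈ S :=
  S.add_mem (S.add_mem (hR _ _) (S.mul_mem (S.mul_mem (hR _ _) h2) (hR _ _)))
    (S.mul_mem (S.mul_mem (S.add_mem (hR _ _) (S.mul_mem (S.mul_mem (hR _ _) h2) (hR _ _))) h1)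
      (hR _ _))

theorem wordMat_mem {N m : ℕ} (w : Fin m → Fin N) {b : Fin m → A} (hb : ∀ k, b k ∈ S) (r c : ℕ) :
    wordMat w b r c ∈ S := by
  have h : ∀ (P : List (ℕ × A)) (M : ℕ → ℕ → A), (∀ p ∈ P, p.2 ∈ S) → (∀ r c, M r c ∈ S) →
      ∀ r c, colops M P r c ∈ S := by
    intro P
    induction P with
    | nil => exact fun M _ hM => hM
    | cons p P ih =>
      exact fun M hP hM => ih _ (fun q hq => hP q (List.mem_cons_of_mem _ hq))
        (colop_mem (hP p List.mem_cons_self) hM)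
  refine h _ _ ?_ ?_ r c
  · simpa [List.mem_ofFn] using hb
  · intro r c
    simp only [idMat]
    split_ifs
    · exact S.one_mem
    · exact S.zero_mem

/-- For indices at least `a`, eliminations from level `a` on read neither rows and columns below `a`
nor values of `t` outside the range. -/
theorem esteps_congr {t t' : ℕ → A} {a : ℕ} {M M' : ℕ → ℕ → A} {d : ℕ}
    (ht : ∀ k, a ≤ k → k < a + d → t k = t' k) (hM : ∀ r c, a ≤ r → a ≤ c → M r c = M' r c)
    {r c : ℕ} (hr : a ≤ r) (hc : a ≤ c) : esteps t a M d r c = esteps t' a M' d r c := by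
  induction d generalizing r c with
  | zero => exact hM r c hr hc
  | succ d ih =>
    have ih' := fun {r c : ℕ} => ih (r := r) (c := c) fun k h1 h2 => ht k h1 (by omega)
    simp only [esteps, estep]
    rw [ih' hr hc, ih' hr (by omega), ih' (by omega) hc, ht (a + d) (by omega) (by omega)]

end Subrings

section CharTwo

variable {B J : Type}

theorem neg_eq_self' (x : Alg B J) : -x = x := by
  rw [neg_eq_iff_add_eq_zero, add_self_eq_zero']

theorem add_add_cancel_left' (x y : Alg B J) : x + (x + y) = y := by
  rw [← add_assoc, add_self_eq_zero', zero_add]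

theorem markedNat_mem {N : ℕ} {S : Subring (Alg B (Fin (N + 1)))} (h : ∀ j, markedVal j ∈ S)
    (k : ℕ) : markedNat B N k ∈ S := by
  rw [markedNat]
  split_ifs
  · exact h _
  · exact S.zero_mem

variable [DecidableEq B] [DecidableEq J]

/-- The cycles of degree `0`. -/
noncomputable def cyclesZero (L : List (Event B J)) : Subring (Alg B J) where
  carrier := {x | diff L x = 0 ∧ IsHomogeneous L 0 x}
  zero_mem' := ⟨diff_zero L, isHomogeneous_zero 0⟩
  one_mem' := ⟨diff_one L, isHomogeneous_one⟩
  add_mem' hx hy := ⟨by rw [diff_add, hx.1, hy.1, add_zero], hx.2.add hy.2⟩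
  mul_mem' hx hy := ⟨by rw [diff_mul, hx.1, hy.1, mul_zero, zero_mul, add_zero],
    by simpa using hx.2.mul hy.2⟩
  neg_mem' {x} hx := by rwa [neg_eq_self']

theorem markedVal_mem_cyclesZero (L : List (Event B J)) (j : J) : markedVal j ∈ cyclesZero L :=
  ⟨diff_markedVal L j, isHomogeneous_markedVal j⟩

theorem chord_mem_cyclesZero {L : List (Event B J)} {c : B ⊕ J}
    (h : diffGenFrom Slice.empty L c = 0) (h' : degreeGenFrom Slice.empty L c = 0) :
    chord c ∈ cyclesZero L :=
  ⟨by rw [diff_chord, h], h' ▸ isHomogeneous_chord c⟩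

theorem IsHomogeneous.cast {L : List (Event B J)} {d e : ℤ} {x : Alg B J}
    (h : IsHomogeneous L d x) (hd : d = e) : IsHomogeneous L e x := hd ▸ h

end CharTwo

/-! ### The left-cusp moves -/

section Destabilizations

variable {N l : ℕ} (β : Fin l → Fin N) (i : Fin N)

theorem map_markedNat {B B' : Type} (f : B ⊕ Fin (N + 1) → Alg B' (Fin (N + 1))) (k : ℕ) :
    lift f (fun j => marked j) (markedNat B N k) = markedNat B' N k := by
  simp only [markedNat]
  split_ifs
  · simp
  · simp

/-- Killing `bot` requires killing its boundary `mid`; the sum of `top` and `bot` in the matrix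
becomes `top`, as in `front₃'`. -/
theorem isDGAMorphism_destab₃ : IsDGAMorphism (front₄ β i) (front₃' β i) (destab₃ l N) := by
  refine ⟨fun x => diff_comm_of_chord (σ := id) ?_ x,
    fun d x hx => IsHomogeneous.lift (σ := id) ?_ hx⟩
  · intro c
    rw [(diffGenFrom_front₄ β i c).1]
    rcases c with (k | _ | _ | _) | j <;>
      simp only [zigzagDiff, map_zero, diff_zero, lift_chord, diff_chord, diffGenFrom_front₃',
        Sum.elim_inl, Sum.elim_inr, map_add, lift_marked_inv, id]
    congr 1
    rw [pivot, ← AlgHom.coe_toRingHom, map_esteps]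
    simp only [AlgHom.coe_toRingHom, map_markedNat, pivot]
    congr 1
    funext r c
    rw [← AlgHom.coe_toRingHom, map_rowop]
    simp only [betaMat, map_wordMat, betaMat₁]
    simp
  · intro c
    rw [(diffGenFrom_front₄ β i c).2]
    have h := fun c => isHomogeneous_chord (L := front₃' β i) c
    simp only [degreeGenFrom_front₃'] at h
    rcases c with (k | _ | _ | _) | j
    exacts [h _, isHomogeneous_zero _, h _, isHomogeneous_zero _, h _]

theorem isDGAMorphism_destab₄ :
    IsDGAMorphism (front₄' β i) (rainbow (wordLeft i β)) (destab₄ l N) := by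
  refine ⟨fun x => diff_comm_of_chord (σ := id) ?_ x,
    fun d x hx => IsHomogeneous.lift (σ := id) ?_ hx⟩
  · intro c
    rw [(diffGenFrom_front₄' β i c).1]
    rcases c with (k | _ | _ | _) | j <;>
      simp only [zigzagDiff, map_zero, diff_zero, lift_chord, diff_chord, diffGenFrom_rainbow,
        Sum.elim_inl, Sum.elim_inr, map_add, lift_marked_inv, id]
    congr 1
    rw [pivot, ← AlgHom.coe_toRingHom, map_esteps]
    simp only [AlgHom.coe_toRingHom, map_markedNat, pivot]
    congr 1
    rw [wordMat_wordLeft]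
    funext r c
    rw [← AlgHom.coe_toRingHom, map_rowop]
    simp only [betaMat, map_wordMat]
    simp
  · intro c
    rw [(diffGenFrom_front₄' β i c).2]
    have h := fun c => isHomogeneous_chord (L := rainbow (wordLeft i β)) c
    simp only [degreeGenFrom_rainbow] at h
    rcases c with (k | _ | _ | _) | j
    exacts [h _, h _, isHomogeneous_zero _, isHomogeneous_zero _, h _]

/-- The section of `destab₃`. -/
noncomputable def stab₃ (l N : ℕ) :
    Alg (Cross₁ l) (Fin (N + 1)) →ₐ[ZMod 2] Alg (Cross l) (Fin (N + 1)) :=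
  lift
    (fun
      | .inl (.beta k) => chord (.inl (.beta k))
      | .inl .top => chord (.inl .top) + chord (.inl .bot)
      | .inr j => chord (.inr j))
    marked

/-- The sum of `top` and `bot` is a cycle, and it is exactly the combination that enters the
differentials of the cusp chords. -/
theorem isStabilization_stab₃ :
    IsStabilization (front₃' β i) (front₄ β i) (destab₃ l N) (stab₃ l N) := by
  refine ⟨⟨fun x => diff_comm_of_chord (σ := id) ?_ x,
    fun d x hx => IsHomogeneous.lift (σ := id) ?_ hx⟩, fun x => ?_⟩
  · intro c
    rw [diffGenFrom_front₃']
    rcases c with (k | _) | j <;>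
      simp only [map_zero, diff_add, diff_chord, (diffGenFrom_front₄ β i _).1,
        Sum.elim_inl, Sum.elim_inr, map_add, lift_marked_inv, id, zigzagDiff, add_self_eq_zero']
    congr 1
    rw [pivot, ← AlgHom.coe_toRingHom, map_esteps]
    simp only [AlgHom.coe_toRingHom, map_markedNat, pivot]
    congr 1
    funext r c
    rw [← AlgHom.coe_toRingHom, map_rowop]
    simp only [betaMat, map_wordMat, betaMat₁]
    simp
  · intro c
    rw [degreeGenFrom_front₃']
    have h := fun c => isHomogeneous_chord (L := front₄ β i) c
    simp only [(diffGenFrom_front₄ β i _).2] at h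
    rcases c with (k | _) | j
    exacts [h _, (h (.inl .top)).add (h (.inl .bot)), h _]
  · have : (destab₃ l N).comp (stab₃ l N) = AlgHom.id _ _ := by
      apply Alg.algHom_ext
      · rintro ((k | _) | j) <;> simp [destab₃, stab₃]
      · intro j; simp [destab₃, stab₃]
    exact DFunLike.congr_fun this x

/-- Elements killed by a twisted derivation. -/
noncomputable def twistedDerKer {B J : Type} (σ : Alg B J →ₐ[ZMod 2] Alg B J)
    (f : B ⊕ J → Alg B J) : Subring (Alg B J) where
  carrier := {x | twistedDer σ f x = 0}
  zero_mem' := twistedDer_zero σ f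
  one_mem' := twistedDer_one σ f
  add_mem' {x y} hx hy := by
    simp only [Set.mem_ofPred_eq] at hx hy ⊢
    rw [twistedDer_add, hx, hy, add_zero]
  mul_mem' {x y} hx hy := by
    simp only [Set.mem_ofPred_eq] at hx hy ⊢
    rw [twistedDer_mul, hx, hy, mul_zero, zero_mul, add_zero]
  neg_mem' {x} hx := by rwa [neg_eq_self']

/-- A section of a chain map which is an inverse up to homotopy. -/
theorem exists_homotopy₃ : ∃ h : Alg (Cross l) (Fin (N + 1)) → Alg (Cross l) (Fin (N + 1)),
    ∀ x, diff (front₄ β i) (h x) + h (diff (front₄ β i) x) =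
      x + stab₃ l N (destab₃ l N x) := by
  -- The boundary of `bot` is `mid`; contracting this pair means sending `mid` back to `bot`.
  let f : Cross l ⊕ Fin (N + 1) → Alg (Cross l) (Fin (N + 1)) := fun
    | .inl .mid => chord (.inl .bot)
    | _ => 0
  let σ := (stab₃ l N).comp (destab₃ l N)
  refine ⟨twistedDer σ f, homotopy_of_chord σ f (fun x => ?_) (fun j => ?_) (fun c => ?_)⟩
  · exact (congrArg _ ((isDGAMorphism_destab₃ β i).1 x)).trans ((isStabilization_stab₃ β i).1.1 _)
  · simp [σ, stab₃, destab₃]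
  · rw [diff_chord, (diffGenFrom_front₄ β i c).1]
    rcases c with (k | _ | _ | _) | j
    · simp [f, zigzagDiff, σ, stab₃, destab₃, add_self_eq_zero']
    · simp [f, zigzagDiff, σ, stab₃, destab₃]
    · simp [f, zigzagDiff, σ, stab₃, destab₃, add_add_cancel_left']
    · simp [f, zigzagDiff, σ, stab₃, destab₃, (diffGenFrom_front₄ β i _).1]
    -- The differential of a cusp chord does not involve `mid`, the only generator on which the
    -- derivation is nonzero.
    · have h : (((marked j)⁻¹ : (Alg (Cross l) (Fin (N + 1)))ˣ) : Alg (Cross l) (Fin (N + 1))) +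
          pivot (markedNat _ N) (rowop i (chord (.inl .top) + chord (.inl .bot)) (betaMat β)) j ∈
          twistedDerKer σ f := by
        have ht : ∀ j, markedVal j ∈ twistedDerKer σ f := fun j => twistedDer_markedVal σ f j
        refine Subring.add_mem _ (twistedDer_marked_inv σ f j) (esteps_mem (markedNat_mem ht)
          (rowop_mem ?_ (wordMat_mem _ fun k => ?_)) _ _ _)
        · exact Subring.add_mem _ (twistedDer_chord σ f _) (twistedDer_chord σ f _)
        · exact twistedDer_chord σ f _
      have h' : twistedDer σ f (zigzagDiff β i (.inr j)) = 0 := h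
      rw [h']
      simp [f, σ, stab₃, destab₃, add_self_eq_zero']

end Destabilizations
end CE


namespace CE

theorem isDGAMorphism_of_chord {B B' J : Type} [DecidableEq B] [DecidableEq B'] [DecidableEq J]
    {L : List (Event B J)} {L' : List (Event B' J)} {φ : Alg B J →ₐ[ZMod 2] Alg B' J} (σ : J → J)
    (ht : ∀ j, φ (markedVal j) = markedVal (σ j))
    (h : ∀ c, φ (diffGenFrom Slice.empty L c) = diff L' (φ (chord c)))
    (hd : ∀ c, IsHomogeneous L' (degreeGenFrom Slice.empty L c) (φ (chord c))) :
    IsDGAMorphism L L' φ := by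
  have e : φ = lift (fun c => φ (chord c)) (fun j => marked (σ j)) :=
    Alg.algHom_ext (fun c => by rw [lift_chord])
      fun j => by rw [lift_markedVal, ht]; rfl
  rw [e] at h ⊢
  exact ⟨diff_comm_of_chord fun c => by simpa using h c,
    fun d x hx => IsHomogeneous.lift (fun c => by simpa using hd c) hx⟩

theorem map_marked_inv {B B' J : Type} {φ : Alg B J →ₐ[ZMod 2] Alg B' J} {j k : J}
    (h : φ (markedVal j) = markedVal k) :
    φ (((marked j)⁻¹ : (Alg B J)ˣ) : Alg B J) = (((marked k)⁻¹ : (Alg B' J)ˣ) : Alg B' J) := by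
  have h1 : φ (((marked j)⁻¹ : (Alg B J)ˣ) : Alg B J) * markedVal k = 1 := by
    rw [← h, ← map_mul, marked_inv_mul, map_one]
  rw [← mul_one (φ _), ← marked_mul_inv k, ← mul_assoc, h1, one_mul]

/-! ### Homomorphic images of the interlaced differential -/

section Interlaced

variable {N l : ℕ} (β : Fin l → Fin N) (i : Fin N)

theorem esteps_add_two {A : Type*} [Ring A] (t : ℕ → A) (M : ℕ → ℕ → A) (i d : ℕ) :
    esteps t 0 M (i + 2 + d) =
      esteps t (i + 2) (estep t (i + 1) (estep t i (esteps t 0 M i))) d := by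
  rw [esteps_add]
  simp only [Nat.zero_add, esteps]

/-- Only marked points of levels below `i` occur, so this also applies to a homomorphism that
exchanges the marked points of levels `i` and `i + 1`. -/
theorem map_interlacedMat {A : Type*} [Ring A] (f : Alg (Cross l) (Fin (N + 1)) →+* A)
    {t : ℕ → A} (ht : ∀ k < i.val, f (markedNat _ N k) = t k) (r c : ℕ) :
    f (interlacedMat β i r c) = rowop i (f (chord (.inl .top)))
      (esteps t 0 (colop i (f (chord (.inl .bot)))
        (wordMat β fun k => f (chord (.inl (.beta k))))) i) r c := by
  rw [interlacedMat, map_rowop]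
  congr 1
  funext r c
  rw [map_esteps]
  refine esteps_congr (fun k _ hk => ht k (by omega)) (fun r c _ _ => ?_) (Nat.zero_le _)
    (Nat.zero_le _)
  rw [map_colop]
  congr 1
  funext r c
  rw [betaMat, map_wordMat]

theorem map_pivot_of_lt {A : Type*} [Ring A] (f : Alg (Cross l) (Fin (N + 1)) →+* A)
    {t : ℕ → A} (ht : ∀ k < i.val, f (markedNat _ N k) = t k) {j : ℕ} (hj : j < i) :
    f (pivot (markedNat _ N) (colop i (chord (.inl .bot)) (betaMat β)) j) =
      pivot t (colop i (f (chord (.inl .bot))) (wordMat β fun k => f (chord (.inl (.beta k))))) j := by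
  rw [pivot, map_esteps, pivot]
  refine esteps_congr (fun k _ hk => ht k (by omega)) (fun r c _ _ => ?_) (Nat.zero_le _)
    (Nat.zero_le _)
  rw [map_colop]
  congr 1
  funext r c
  rw [betaMat, map_wordMat]

theorem map_closeTwo {A A' : Type*} [Ring A] [Ring A'] (f : A →+* A') (i : ℕ) (t₁ t₂ : A)
    (R : ℕ → ℕ → A) (r c : ℕ) :
    f (closeTwo i t₁ t₂ R r c) = closeTwo i (f t₁) (f t₂) (fun r c => f (R r c)) r c := by
  simp only [closeTwo, map_add, map_mul]

-- The differentials of the cusp chords of `front₂` involve neither `mid` nor cusp chords, so their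
-- properties can be checked on the remaining generators.
variable {β i} in
theorem interlacedDiff_mem {S : Subring (Alg (Cross l) (Fin (N + 1)))}
    (hc : ∀ c : Cross l, c ≠ .mid → chord (.inl c) ∈ S) (ht : ∀ j, markedVal j ∈ S)
    (hti : ∀ j, (((marked j)⁻¹ : (Alg (Cross l) (Fin (N + 1)))ˣ) : Alg _ _) ∈ S)
    (j : Fin (N + 1)) : interlacedDiff β i (.inr j) ∈ S := by
  have hM : ∀ r c, colop i (chord (.inl .bot)) (betaMat β) r c ∈ S :=
    colop_mem (hc _ (by simp)) (wordMat_mem _ fun k => hc _ (by simp))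
  have hR : ∀ r c, interlacedMat β i r c ∈ S :=
    rowop_mem (hc _ (by simp)) (esteps_mem (markedNat_mem ht) hM _)
  refine S.add_mem (hti j) ?_
  rw [interlacedPivot]
  split_ifs
  · exact esteps_mem (markedNat_mem ht) hM _ _ _
  · exact hR _ _
  · exact hR _ _
  · exact esteps_mem (markedNat_mem ht) (closeTwo_mem (ht _) (ht _) hR) _ _ _

/-- The element to which `destab₂` sends the bottom crossing. -/
noncomputable def botImage : Alg (Cross₁ l) (Fin (N + 1)) :=
  markedVal i.castSucc *
    rowop i (chord (.inl .top)) (esteps (markedNat _ N) 0 (betaMat₁ β) i) i (i + 1)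

/-- The term with the cusp chord vanishes because no half-disk joins two bottom strands. -/
theorem destab₂_bot : destab₂ β i (chord (.inl .bot)) = botImage β i := by
  obtain ⟨k, hk⟩ : ∃ k, k + 1 + i.val = N := ⟨N - 1 - i, by omega⟩
  have h := isRainbow_front₃Left β i
  rw [destab₂, lift_chord]
  dsimp only
  rw [h.eq i (i + 1), h.zero, mul_zero, add_zero, botImage]
  all_goals omega

theorem destab₂_mid : destab₂ β i (chord (.inl .mid)) =
    chord (.inr i.castSucc) * botImage β i := by
  rw [← destab₂_bot]
  simp [destab₂]

theorem markedNat_castSucc (B : Type) : markedNat B N i = markedVal i.castSucc := by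
  rw [← markedNat_val]; rfl

theorem markedNat_succ (B : Type) : markedNat B N (i + 1) = markedVal i.succ := by
  rw [← markedNat_val]; rfl

end Interlaced
end CE


namespace CE

/-! ### The second destabilization -/

section Destab₂

variable {N l : ℕ} (β : Fin l → Fin N) (i : Fin N)

theorem botImage_mem_cyclesZero : botImage β i ∈ cyclesZero (front₃ β i) := by
  have hc : ∀ c : Cross₁ l, chord (.inl c) ∈ cyclesZero (front₃ β i) := fun c =>
    chord_mem_cyclesZero (by rw [diffGenFrom_front₃]; rfl) (by rw [degreeGenFrom_front₃]; rfl)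
  have ht : ∀ j, markedVal j ∈ cyclesZero (front₃ β i) := markedVal_mem_cyclesZero _
  exact Subring.mul_mem _ (ht _) (rowop_mem (hc _) (esteps_mem (markedNat_mem ht)
    (wordMat_mem _ fun k => hc _) _) _ _)

theorem destab₂_interlacedMat (r c : ℕ) : (destab₂ β i).toRingHom (interlacedMat β i r c) =
    colop i (botImage β i) (rowop i (chord (.inl .top))
      (esteps (markedNat _ N) 0 (betaMat₁ β) i)) r c := by
  rw [map_interlacedMat β i _ (t := markedNat _ N), esteps_colop _ le_rfl, colop_rowop]
  · have h1 := destab₂_bot β i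
    simp only [AlgHom.toRingHom_eq_coe, AlgHom.coe_toRingHom, h1]
    simp only [destab₂, lift_chord, betaMat₁]
  · intro k _
    exact map_markedNat _ k

/-- Let $Q$ be the matrix of `front₃` before level `i` is closed and $v=t_iQ_{i,i+1}$. Then
$\partial(a_iv)=Q_{i,i+1}+Q_{ii}v$, which is the image of the boundary of `mid`. For the larger
levels, the column operation by $v$ followed by `closeTwo` amounts to two ordinary elimination
steps. -/
theorem isDGAMorphism_destab₂ : IsDGAMorphism (front₂' β i) (front₃ β i) (destab₂ β i) := by
  have hv := botImage_mem_cyclesZero β i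
  have hR := destab₂_interlacedMat β i
  have hbot := destab₂_bot β i
  have hmid := destab₂_mid β i
  have hbeta : ∀ k, destab₂ β i (chord (.inl (.beta k))) = chord (.inl (.beta k)) := fun k =>
    lift_chord _ _ _
  have htop : destab₂ β i (chord (.inl .top)) = chord (.inl .top) := lift_chord _ _ _
  have hcusp : ∀ j, destab₂ β i (chord (.inr j)) = chord (.inr j) := fun j => lift_chord _ _ _
  have ht : ∀ j, destab₂ β i (markedVal j) = markedVal j := fun j => lift_markedVal _ _ _
  have e1 : ∀ b, rowop i b (esteps (markedNat _ N) 0 (betaMat₁ β) i) =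
      esteps (markedNat _ N) 0 (rowop i b (betaMat₁ β)) i := fun b => (esteps_rowop _ le_rfl _ _).symm
  refine isDGAMorphism_of_chord id ht (fun c => ?_) fun c => ?_
  · rw [diffGenFrom_front₂']
    rcases c with (k | _ | _ | _) | j
    · simp [interlacedDiff, hbeta, diff_chord, diffGenFrom_front₃]
    · rw [hbot, hv.1]; simp [interlacedDiff]
    · simp [interlacedDiff, htop, diff_chord, diffGenFrom_front₃]
    · rw [hmid, diff_mul, hv.1, mul_zero, zero_add, diff_chord, diffGenFrom_front₃]
      change destab₂ β i (interlacedMat β i i i) = _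
      have h := hR i i
      simp only [AlgHom.toRingHom_eq_coe, AlgHom.coe_toRingHom] at h
      rw [h, colop, if_pos rfl]
      simp only [Sum.elim_inr, add_mul, pivot, Fin.val_castSucc, ← e1]
      refine (add_comm _ _).trans (congrArg₂ _ ?_ rfl)
      rw [botImage, ← mul_assoc, marked_inv_mul, one_mul]
    · rw [hcusp, diff_chord, diffGenFrom_front₃, interlacedDiff, map_add, Sum.elim_inr]
      congr 1
      · exact map_marked_inv (ht j)
      rw [interlacedPivot]
      split_ifs with h1 h2 h3
      · have := map_pivot_of_lt β i (destab₂ β i).toRingHom (t := markedNat _ N)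
          (fun k _ => map_markedNat _ k) h1
        simp only [AlgHom.toRingHom_eq_coe, AlgHom.coe_toRingHom] at this
        rw [this, pivot, pivot, esteps_colop _ h1.le, esteps_rowop _ h1.le, colop, rowop,
          if_neg (by omega), if_neg (by omega), if_neg (by omega), if_neg (by omega)]
        simp only [hbeta, betaMat₁]
      · have h := hR i (i + 1)
        simp only [AlgHom.toRingHom_eq_coe, AlgHom.coe_toRingHom] at h
        rw [h, colop, if_neg (by omega), if_pos rfl, e1, pivot, h2]
      · have h := hR (i + 1) i
        simp only [AlgHom.toRingHom_eq_coe, AlgHom.coe_toRingHom] at h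
        -- Column `i` times `v`, added to column `i + 1`, is the elimination step at level `i`.
        rw [h, colop, if_pos rfl, e1, pivot, h3, esteps, estep, ← e1, Nat.zero_add, botImage,
          markedNat_castSucc]
        simp only [mul_assoc]
        exact add_comm _ _
      · obtain ⟨d, hd⟩ : ∃ d, j.val = i + 2 + d := ⟨j - (i + 2), by omega⟩
        rw [← AlgHom.coe_toRingHom, map_esteps, pivot, hd, esteps_add_two, Nat.add_sub_cancel_left]
        refine esteps_congr (fun k _ _ => map_markedNat _ k) (fun r c hr hc => ?_) (by omega)
          (by omega)
        rw [map_closeTwo]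
        simp only [← AlgHom.toRingHom_eq_coe, hR]
        rw [← e1]
        simp only [AlgHom.toRingHom_eq_coe, AlgHom.coe_toRingHom, closeTwo, estep,
          markedNat_castSucc, markedNat_succ]
        generalize hQ : rowop i (chord (Sum.inl Cross₁.top)) _ = Q
        have hb : botImage β i = markedVal i.castSucc * Q i (i + 1) := by rw [← hQ]; rfl
        simp only [colop, if_neg (show c ≠ i by omega), if_neg (show c ≠ i + 1 by omega), if_pos,
          if_neg (show i.val + 1 ≠ i by omega), hb, ht]
        noncomm_ring
  · rw [degreeGenFrom_front₂']
    have h := fun c => isHomogeneous_chord (L := front₃ β i) c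
    simp only [degreeGenFrom_front₃] at h
    rcases c with (k | _ | _ | _) | j
    · rw [hbeta]; exact h (.inl (.beta k))
    · rw [hbot]; exact hv.2
    · rw [htop]; exact h (.inl .top)
    · rw [hmid]; exact (h (.inr i.castSucc)).mul hv.2
    · rw [hcusp]; exact h (.inr j)

end Destab₂
end CE


namespace CE

/-! ### The first destabilization -/

section Destab₁

variable {N l : ℕ} (β : Fin l → Fin N) (i : Fin N)

/-- The matrix of the closure of `β s_i`, after the levels `< i` have been eliminated. -/
noncomputable def rightMat : ℕ → ℕ → Alg (Fin (l + 1)) (Fin (N + 1)) :=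
  esteps (markedNat _ N) 0 (wordMat (wordRight β i) fun k => chord (.inl k)) i

/-- The element to which `destab₁` sends the top crossing. -/
noncomputable def topImage : Alg (Fin (l + 1)) (Fin (N + 1)) :=
  rightMat β i (i + 1) i * markedVal i.castSucc

/-- The term with the cusp chord vanishes because no half-disk joins two top strands. -/
theorem destab₁_top : destab₁ β i (chord (.inl .top)) = topImage β i := by
  obtain ⟨k, hk⟩ : ∃ k, k + 1 + i.val = N := ⟨N - 1 - i, by omega⟩
  have h := ((IsRainbow.leftCusps (B := Fin (l + 1)) (N := N)).braidWord (wordRight β i) id).cusps i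
    (by omega)
  rw [Nat.zero_add] at h
  have hD : disks₁ β i = (((cusps (Fin (l + 1)) N 0 i).foldl Slice.step
      ((braidWord (wordRight β i) id).foldl Slice.step
        ((leftCusps (Fin (l + 1)) N).foldl Slice.step Slice.empty)))).disks := by
    rw [disks₁, Slice.after, List.foldl_append, List.foldl_append, rightCusps_lt, Nat.zero_add]
  rw [destab₁, lift_chord]
  dsimp only
  rw [hD, h.eq (i + 1) i _ _ (by omega) le_rfl (by omega) (by omega) (by omega),
    h.zero _ (N - i) (by omega), zero_mul, add_zero, topImage, rightMat]
  rfl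

theorem destab₁_mid : destab₁ β i (chord (.inl .mid)) =
    topImage β i * chord (.inr i.castSucc) := by
  rw [← destab₁_top]
  simp [destab₁]

theorem destab₁_beta (k : Fin l) :
    destab₁ β i (chord (.inl (.beta k))) = chord (.inl k.castSucc) := lift_chord _ _ _

theorem destab₁_bot : destab₁ β i (chord (.inl .bot)) = chord (.inl (Fin.last l)) :=
  lift_chord _ _ _

theorem destab₁_cusp (j : Fin (N + 1)) :
    destab₁ β i (chord (.inr j)) = chord (.inr (Equiv.swap i.castSucc i.succ j)) := lift_chord _ _ _

theorem destab₁_markedVal (j : Fin (N + 1)) :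
    destab₁ β i (markedVal j) = markedVal (Equiv.swap i.castSucc i.succ j) := lift_markedVal _ _ _

theorem swap_eq_self {j : Fin (N + 1)} (h : j.val < i ∨ i + 1 < j.val) :
    Equiv.swap i.castSucc i.succ j = j := by
  apply Equiv.swap_apply_of_ne_of_ne <;> rw [Ne, Fin.ext_iff]
  · rw [Fin.val_castSucc]; omega
  · rw [Fin.val_succ]; omega

theorem map_markedNat_swap {B B' : Type} {φ : Alg B (Fin (N + 1)) →ₐ[ZMod 2] Alg B' (Fin (N + 1))}
    (h : ∀ j, φ (markedVal j) = markedVal (Equiv.swap i.castSucc i.succ j)) {k : ℕ}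
    (hk : k < i ∨ i + 1 < k) : φ (markedNat B N k) = markedNat B' N k := by
  simp only [markedNat]
  split_ifs with hkN
  · rw [h, swap_eq_self _ hk]
  · exact map_zero _

theorem rightMat_eq : rightMat β i = esteps (markedNat _ N) 0 (colop i (chord (.inl (Fin.last l)))
    (wordMat β fun k => chord (.inl k.castSucc))) i := by
  rw [rightMat, wordMat_wordRight]

theorem destab₁_interlacedMat (r c : ℕ) : (destab₁ β i).toRingHom (interlacedMat β i r c) =
    rowop i (topImage β i) (rightMat β i) r c := by
  rw [map_interlacedMat β i _ (t := markedNat _ N), rightMat_eq]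
  · have h1 := destab₁_top β i
    simp only [AlgHom.toRingHom_eq_coe, AlgHom.coe_toRingHom, h1, destab₁_bot, destab₁_beta]
  · intro k hk
    exact map_markedNat_swap i (destab₁_markedVal β i) (.inl hk)

theorem topImage_mem_cyclesZero : topImage β i ∈ cyclesZero (rainbow (wordRight β i)) := by
  have hc : ∀ c, chord (.inl c) ∈ cyclesZero (rainbow (wordRight β i)) := fun c =>
    chord_mem_cyclesZero (by rw [diffGenFrom_rainbow]; rfl) (by rw [degreeGenFrom_rainbow]; rfl)
  have ht : ∀ j, markedVal j ∈ cyclesZero (rainbow (wordRight β i)) := markedVal_mem_cyclesZero _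
  exact Subring.mul_mem _ (esteps_mem (markedNat_mem ht) (wordMat_mem _ hc) _ _ _) (ht _)

/-- The mirror image of `isDGAMorphism_destab₂`, with $u=Q_{i+1,i}t_i$. The row operation by $u$
puts the eliminated row `i + 1` in place `i`, which is why levels `i` and `i + 1` are exchanged. -/
theorem isDGAMorphism_destab₁ :
    IsDGAMorphism (front₂ β i) (rainbow (wordRight β i)) (destab₁ β i) := by
  have hu := topImage_mem_cyclesZero β i
  have hR := destab₁_interlacedMat β i
  simp only [AlgHom.toRingHom_eq_coe, AlgHom.coe_toRingHom] at hR
  have ht := destab₁_markedVal β i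
  have hm : topImage β i = rightMat β i (i + 1) i * markedVal i.castSucc := rfl
  refine isDGAMorphism_of_chord (Equiv.swap i.castSucc i.succ) ht (fun c => ?_) fun c => ?_
  · rw [diffGenFrom_front₂]
    rcases c with (k | _ | _ | _) | j
    · simp [interlacedDiff, destab₁_beta, diff_chord, diffGenFrom_rainbow]
    · simp [interlacedDiff, destab₁_bot, diff_chord, diffGenFrom_rainbow]
    · rw [destab₁_top, hu.1]; simp [interlacedDiff]
    · rw [destab₁_mid, diff_mul, hu.1, zero_mul, add_zero, diff_chord, diffGenFrom_rainbow]
      change destab₁ β i (interlacedMat β i i i) = _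
      rw [hR, rowop, if_pos rfl, Sum.elim_inr, mul_add]
      refine (add_comm _ _).trans (congrArg₂ _ ?_ rfl)
      rw [hm, mul_assoc, marked_mul_inv, mul_one]
    · rw [destab₁_cusp, diff_chord, diffGenFrom_rainbow, interlacedDiff, map_add, Sum.elim_inr]
      congr 1
      · exact map_marked_inv (ht j)
      rw [interlacedPivot]
      split_ifs with h1 h2 h3
      · have := map_pivot_of_lt β i (destab₁ β i).toRingHom (t := markedNat _ N)
          (fun k hk => map_markedNat_swap i ht (.inl hk)) h1
        simp only [AlgHom.toRingHom_eq_coe, AlgHom.coe_toRingHom] at this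
        rw [this, swap_eq_self _ (.inl h1), wordMat_wordRight]
        simp only [destab₁_bot, destab₁_beta]
      · obtain rfl : j = i.castSucc := Fin.ext h2
        rw [Equiv.swap_apply_left, hR, rowop, if_pos rfl, pivot, Fin.val_succ, esteps, estep,
          ← rightMat, Nat.zero_add, hm, markedNat_castSucc]
        exact add_comm _ _
      · obtain rfl : j = i.succ := Fin.ext h3
        rw [Equiv.swap_apply_right, hR, rowop, if_neg (by omega), if_pos rfl]
        rfl
      · obtain ⟨d, hd⟩ : ∃ d, j.val = i + 2 + d := ⟨j - (i + 2), by omega⟩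
        rw [swap_eq_self _ (by omega), ← AlgHom.coe_toRingHom, map_esteps, pivot, hd,
          esteps_add_two, Nat.add_sub_cancel_left]
        refine esteps_congr (fun k hk _ => map_markedNat_swap i ht (.inr (by omega)))
          (fun r c hr hc => ?_) (by omega) (by omega)
        rw [map_closeTwo]
        simp only [AlgHom.coe_toRingHom, hR]
        rw [← rightMat, ht, ht, Equiv.swap_apply_left, Equiv.swap_apply_right, hm]
        simp only [closeTwo, estep, markedNat_succ, markedNat_castSucc]
        generalize rightMat β i = Q
        simp only [rowop, if_neg (show r ≠ i by omega), if_neg (show r ≠ i + 1 by omega),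
          if_pos, if_neg (show i.val + 1 ≠ i by omega)]
        noncomm_ring
  · rw [degreeGenFrom_front₂]
    have h := fun c => isHomogeneous_chord (L := rainbow (wordRight β i)) c
    simp only [degreeGenFrom_rainbow] at h
    rcases c with (k | _ | _ | _) | j
    · rw [destab₁_beta]; exact h (.inl _)
    · rw [destab₁_bot]; exact h (.inl _)
    · rw [destab₁_top]; exact hu.2
    · rw [destab₁_mid]; exact hu.2.mul (h (.inr i.castSucc))
    · rw [destab₁_cusp]; exact h (.inr _)

end Destab₁
end CE


namespace CE

/-! ### Subrings on which a twisted derivation is controlled -/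

section TwistedSubrings

variable {B B' J : Type} (σ : Alg B J →ₐ[ZMod 2] Alg B J) (f : B ⊕ J → Alg B J)

/-- Elements on which two twisted derivations, and their twists, agree. -/
noncomputable def twistedDerEq (σ' : Alg B J →ₐ[ZMod 2] Alg B J) (f' : B ⊕ J → Alg B J) :
    Subring (Alg B J) where
  carrier := {x | σ x = σ' x ∧ twistedDer σ f x = twistedDer σ' f' x}
  zero_mem' := by simp
  one_mem' := by simp
  add_mem' {x y} hx hy := ⟨by rw [map_add, map_add, hx.1, hy.1],
    by rw [twistedDer_add, twistedDer_add, hx.2, hy.2]⟩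
  mul_mem' {x y} hx hy := ⟨by rw [map_mul, map_mul, hx.1, hy.1],
    by rw [twistedDer_mul, twistedDer_mul, hx.2, hy.2, hx.1]⟩
  neg_mem' {x} hx := by rwa [neg_eq_self']

/-- Elements whose image under a twisted derivation is killed by a homomorphism. -/
noncomputable def twistedDerMapKer (φ : Alg B J →ₐ[ZMod 2] Alg B' J) : Subring (Alg B J) where
  carrier := {x | φ (twistedDer σ f x) = 0}
  zero_mem' := by simp
  one_mem' := by simp
  add_mem' {x y} hx hy := by
    change φ (twistedDer σ f (x + y)) = 0
    rw [twistedDer_add, map_add, show φ (twistedDer σ f x) = 0 from hx,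
      show φ (twistedDer σ f y) = 0 from hy, add_zero]
  mul_mem' {x y} hx hy := by
    change φ (twistedDer σ f (x * y)) = 0
    rw [twistedDer_mul, map_add, map_mul, map_mul, show φ (twistedDer σ f x) = 0 from hx,
      show φ (twistedDer σ f y) = 0 from hy, mul_zero, zero_mul, add_zero]
  neg_mem' {x} hx := by rwa [neg_eq_self']

variable [DecidableEq B] [DecidableEq J]

/-- Cycles `x` of degree `0` such that `σ x` is one as well, and which differ from `σ x` by the
boundary of their image under the twisted derivation. -/
noncomputable def homotopyRing (L : List (Event B J)) : Subring (Alg B J) where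
  carrier := {x | x ∈ cyclesZero L ∧ σ x ∈ cyclesZero L ∧
    diff L (twistedDer σ f x) = x + σ x ∧ IsHomogeneous L 1 (twistedDer σ f x)}
  zero_mem' := ⟨Subring.zero_mem _, by simp, by simp,
    by simpa using isHomogeneous_zero 1⟩
  one_mem' := ⟨Subring.one_mem _, by simp,
    by simp [add_self_eq_zero'], by simpa using isHomogeneous_zero 1⟩
  add_mem' {x y} hx hy := by
    refine ⟨Subring.add_mem _ hx.1 hy.1, ?_, ?_, ?_⟩
    · rw [map_add]; exact Subring.add_mem _ hx.2.1 hy.2.1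
    · rw [twistedDer_add, diff_add, hx.2.2.1, hy.2.2.1, map_add]; abel
    · rw [twistedDer_add]; exact hx.2.2.2.add hy.2.2.2
  mul_mem' {x y} hx hy := by
    refine ⟨Subring.mul_mem _ hx.1 hy.1, ?_, ?_, ?_⟩
    · rw [map_mul]; exact Subring.mul_mem _ hx.2.1 hy.2.1
    -- By the twisted Leibniz rule the boundary is $(x+\sigma x)y+\sigma x(y+\sigma y)=xy+\sigma
    -- x\,\sigma y$.
    · rw [twistedDer_mul, diff_add, diff_mul, diff_mul, hx.2.2.1, hy.2.2.1, hx.2.1.1, hy.1.1,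
        mul_zero, zero_add, zero_mul, add_zero, map_mul, add_mul, mul_add]
      rw [show ∀ a b c : Alg B J, a + b + (b + c) = a + (b + b) + c from fun a b c => by abel,
        add_self_eq_zero', add_zero]
    · rw [twistedDer_mul]
      exact (hx.2.2.2.mul hy.1.2).add ((hx.2.1.2.mul hy.2.2.2).cast (by norm_num))
  neg_mem' {x} hx := by rwa [neg_eq_self']

theorem mem_homotopyRing_of_fixed {L : List (Event B J)} {x : Alg B J} (hx : x ∈ cyclesZero L)
    (hσ : σ x = x) (hf : twistedDer σ f x = 0) : x ∈ homotopyRing σ f L :=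
  ⟨hx, by rwa [hσ], by rw [hf, hσ, diff_zero, add_self_eq_zero'], by
    rw [hf]; exact isHomogeneous_zero 1⟩

end TwistedSubrings

/-! ### A section of the first destabilization -/

section Stab₁

variable {N l : ℕ} (β : Fin l → Fin N) (i : Fin N)

/-- The matrix of `front₂`, after the levels `< i` have been eliminated. -/
noncomputable def interlacedRightMat : ℕ → ℕ → Alg (Cross l) (Fin (N + 1)) :=
  esteps (markedNat _ N) 0 (colop i (chord (.inl .bot)) (betaMat β)) i

/-- The image of the top crossing in a section of `destab₁`. -/
noncomputable def topReplacement : Alg (Cross l) (Fin (N + 1)) :=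
  interlacedRightMat β i (i + 1) i * markedVal i.succ

/-- The chord whose boundary is the difference of the top crossing and its replacement. -/
noncomputable def topHomotopy : Alg (Cross l) (Fin (N + 1)) :=
  (chord (.inl .mid) + chord (.inl .top) * chord (.inr i.succ)) * markedVal i.succ

/-- The homomorphism that replaces the top crossing. -/
noncomputable def replaceTop : Alg (Cross l) (Fin (N + 1)) →ₐ[ZMod 2] Alg (Cross l) (Fin (N + 1)) :=
  lift (fun
    | .inl .top => topReplacement β i
    | c => chord c) (fun j => marked j)

/-- The values on chords of the twisted derivation belonging to `replaceTop`. -/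
noncomputable def topHomotopyGen : Cross l ⊕ Fin (N + 1) → Alg (Cross l) (Fin (N + 1))
  | .inl .top => topHomotopy i
  | _ => 0

/-- A section of `destab₁`. -/
noncomputable def stab₁ : Alg (Fin (l + 1)) (Fin (N + 1)) →ₐ[ZMod 2] Alg (Cross l) (Fin (N + 1)) :=
  lift (Sum.elim
      (Fin.lastCases (motive := fun _ => Alg (Cross l) (Fin (N + 1)))
        (chord (.inl .bot)) fun k => chord (.inl (.beta k)))
      fun j => chord (.inr (Equiv.swap i.castSucc i.succ j)) +
        twistedDer (replaceTop β i) (topHomotopyGen i)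
          (interlacedDiff β i (.inr (Equiv.swap i.castSucc i.succ j))))
    (fun j => marked (Equiv.swap i.castSucc i.succ j))

theorem stab₁_castSucc (k : Fin l) :
    stab₁ β i (chord (.inl k.castSucc)) = chord (.inl (.beta k)) := by simp [stab₁]

theorem stab₁_last : stab₁ β i (chord (.inl (Fin.last l))) = chord (.inl .bot) := by simp [stab₁]

theorem stab₁_cusp (j : Fin (N + 1)) : stab₁ β i (chord (.inr j)) =
    chord (.inr (Equiv.swap i.castSucc i.succ j)) +
      twistedDer (replaceTop β i) (topHomotopyGen i)
        (interlacedDiff β i (.inr (Equiv.swap i.castSucc i.succ j))) := by simp [stab₁]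

theorem stab₁_markedVal (j : Fin (N + 1)) :
    stab₁ β i (markedVal j) = markedVal (Equiv.swap i.castSucc i.succ j) := lift_markedVal _ _ _

/-- The matrix in `topImage` involves, besides marked points below level `i`, only crossing chords,
on which `stab₁` is the evident relabelling. The last factor moves from level `i` to level `i + 1`.
-/
theorem stab₁_topImage : stab₁ β i (topImage β i) = topReplacement β i := by
  rw [topImage, map_mul, stab₁_markedVal, Equiv.swap_apply_left, topReplacement]
  congr 1
  rw [rightMat_eq, ← AlgHom.coe_toRingHom, map_esteps, interlacedRightMat]
  refine esteps_congr (fun k _ hk => map_markedNat_swap i (stab₁_markedVal β i) (.inl (by omega)))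
    (fun r c _ _ => ?_) (Nat.zero_le _) (Nat.zero_le _)
  rw [map_colop, AlgHom.coe_toRingHom, stab₁_last]
  congr 1
  funext r c
  rw [← AlgHom.coe_toRingHom, map_wordMat]
  simp only [AlgHom.coe_toRingHom, stab₁_castSucc, betaMat]

theorem chord_mem_cyclesZero_front₂ {c : Cross l} (hc : c ≠ .mid) :
    chord (.inl c) ∈ cyclesZero (front₂ β i) :=
  chord_mem_cyclesZero
    (by rw [diffGenFrom_front₂]; cases c <;> first | rfl | exact absurd rfl hc)
    (by rw [degreeGenFrom_front₂]; cases c <;> first | rfl | exact absurd rfl hc)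

theorem topReplacement_mem_cyclesZero : topReplacement β i ∈ cyclesZero (front₂ β i) := by
  have ht : ∀ j, markedVal j ∈ cyclesZero (front₂ β i) := markedVal_mem_cyclesZero _
  exact Subring.mul_mem _ (esteps_mem (markedNat_mem ht)
    (colop_mem (chord_mem_cyclesZero_front₂ _ _ (by simp))
      (wordMat_mem _ fun k => chord_mem_cyclesZero_front₂ _ _ (by simp))) _ _ _) (ht _)

theorem interlacedDiff_top : interlacedDiff β i (.inl .top) = 0 := rfl

theorem interlacedDiff_mid : interlacedDiff β i (.inl .mid) =
    chord (.inl .top) * interlacedRightMat β i i i + interlacedRightMat β i (i + 1) i := by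
  rw [interlacedDiff, interlacedMat, rowop, if_pos rfl]
  rfl

theorem interlacedDiff_succ : interlacedDiff β i (.inr i.succ) =
    (((marked i.succ)⁻¹ : (Alg (Cross l) (Fin (N + 1)))ˣ) : Alg _ _) +
      interlacedRightMat β i i i := by
  rw [interlacedDiff, interlacedPivot, Fin.val_succ, if_neg (by omega), if_neg (by omega),
    if_pos rfl, interlacedMat, rowop, if_neg (by omega), if_pos rfl]
  rfl

/-- The product of `top` with the entry `(i, i)` arises once from `mid` and once from the cusp
chord, and cancels; the marked point clears its own inverse. -/
theorem diff_topHomotopy : diff (front₂ β i) (topHomotopy i) =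
    chord (.inl .top) + topReplacement β i := by
  rw [topHomotopy, diff_mul, diff_markedVal, mul_zero, zero_add, diff_add, diff_mul,
    diff_chord, diff_chord, diff_chord, diffGenFrom_front₂, diffGenFrom_front₂,
    diffGenFrom_front₂, interlacedDiff_mid, interlacedDiff_succ, interlacedDiff_top, zero_mul,
    add_zero, mul_add, topReplacement]
  rw [show ∀ a b c : Alg (Cross l) (Fin (N + 1)), a + b + (c + a) = c + b + (a + a) from
    fun a b c => by abel, add_self_eq_zero', add_zero, add_mul, mul_assoc, marked_inv_mul, mul_one]

theorem replaceTop_of_ne {c : Cross l ⊕ Fin (N + 1)} (hc : c ≠ .inl .top) :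
    replaceTop β i (chord c) = chord c := by
  rw [replaceTop, lift_chord]
  rcases c with (_ | _ | _ | _) | _ <;> first | rfl | exact absurd rfl hc

theorem topHomotopyGen_of_ne {c : Cross l ⊕ Fin (N + 1)} (hc : c ≠ .inl .top) :
    topHomotopyGen i c = 0 := by
  rcases c with (_ | _ | _ | _) | _ <;> first | rfl | exact absurd rfl hc

theorem replaceTop_top : replaceTop β i (chord (.inl .top)) = topReplacement β i :=
  lift_chord _ _ _

theorem replaceTop_markedVal (j : Fin (N + 1)) :
    replaceTop β i (markedVal j) = markedVal j := lift_markedVal _ _ _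

theorem isHomogeneous_topHomotopy : IsHomogeneous (front₂ β i) 1 (topHomotopy i) := by
  have h := fun c => isHomogeneous_chord (L := front₂ β i) c
  simp only [degreeGenFrom_front₂] at h
  exact ((h (.inl .mid)).add ((h (.inl .top)).mul (h (.inr i.succ)))).mul
    (isHomogeneous_markedVal _)

theorem cyclesZero_marked_inv (j : Fin (N + 1)) :
    (((marked j)⁻¹ : (Alg (Cross l) (Fin (N + 1)))ˣ) : Alg _ _) ∈ cyclesZero (front₂ β i) :=
  ⟨diff_marked_inv _ j, isHomogeneous_marked_inv j⟩

/-- All generators that occur are degree zero cycles. `replaceTop` fixes them, except `top`, which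
it changes by the boundary of `topHomotopy`. -/
theorem interlacedDiff_mem_homotopyRing (j : Fin (N + 1)) : interlacedDiff β i (.inr j) ∈
    homotopyRing (replaceTop β i) (topHomotopyGen i) (front₂ β i) := by
  refine interlacedDiff_mem (fun c hc => ?_) (fun j => ?_) (fun j => ?_) j
  · by_cases hc' : c = .top
    · subst hc'
      refine ⟨chord_mem_cyclesZero_front₂ _ _ hc, ?_, ?_, ?_⟩
      · rw [replaceTop_top]; exact topReplacement_mem_cyclesZero β i
      · rw [twistedDer_chord, replaceTop_top]; exact diff_topHomotopy β i
      · rw [twistedDer_chord]; exact isHomogeneous_topHomotopy β i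
    · exact mem_homotopyRing_of_fixed _ _ (chord_mem_cyclesZero_front₂ _ _ hc)
        (replaceTop_of_ne _ _ (by simpa)) (by rw [twistedDer_chord, topHomotopyGen_of_ne _ (by simpa)])
  · exact mem_homotopyRing_of_fixed _ _ (markedVal_mem_cyclesZero _ _) (replaceTop_markedVal _ _ _)
      (twistedDer_markedVal _ _ _)
  · exact mem_homotopyRing_of_fixed _ _ (cyclesZero_marked_inv _ _ _)
      (map_marked_inv (replaceTop_markedVal _ _ _)) (twistedDer_marked_inv _ _ _)

/-- Away from `mid` and the cusp chords the composite is `replaceTop`. This is what allows `stab₁`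
to be defined on cusp chords through `replaceTop`, without circularity. -/
theorem stab₁_destab₁_interlacedDiff (j : Fin (N + 1)) :
    stab₁ β i (destab₁ β i (interlacedDiff β i (.inr j))) =
      replaceTop β i (interlacedDiff β i (.inr j)) := by
  have h : interlacedDiff β i (.inr j) ∈ (AlgHom.equalizer ((stab₁ β i).comp (destab₁ β i))
      (replaceTop β i)).toSubring := by
    have hm : ∀ j, stab₁ β i (destab₁ β i (markedVal j)) = markedVal j := fun j => by
      rw [destab₁_markedVal, stab₁_markedVal, Equiv.swap_apply_self]
    refine interlacedDiff_mem (fun c hc => ?_) (fun j => ?_) (fun j => ?_) j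
    · change stab₁ β i (destab₁ β i _) = replaceTop β i _
      rcases c with k | _ | _ | _
      · rw [destab₁_beta, stab₁_castSucc, replaceTop_of_ne _ _ (by simp)]
      · rw [destab₁_bot, stab₁_last, replaceTop_of_ne _ _ (by simp)]
      · rw [destab₁_top, stab₁_topImage, replaceTop_top]
      · exact absurd rfl hc
    · change stab₁ β i (destab₁ β i _) = replaceTop β i _
      rw [hm, replaceTop_markedVal]
    · change ((stab₁ β i).comp (destab₁ β i)) _ = replaceTop β i _
      rw [map_marked_inv (hm j), map_marked_inv (replaceTop_markedVal β i j)]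
  exact h

/-- Both `mid` and the product of `top` with the cusp chord of level `i + 1` go to `topImage` times
the cusp chord of level `i`. -/
theorem destab₁_topHomotopy : destab₁ β i (topHomotopy i) = 0 := by
  rw [topHomotopy, map_mul, map_add, map_mul, destab₁_mid, destab₁_top, destab₁_cusp,
    Equiv.swap_apply_right, add_self_eq_zero', zero_mul]

theorem destab₁_stab₁ (x : Alg (Fin (l + 1)) (Fin (N + 1))) :
    destab₁ β i (stab₁ β i x) = x := by
  have h : (destab₁ β i).comp (stab₁ β i) = AlgHom.id _ _ := by
    refine Alg.algHom_ext (fun c => ?_) fun j => ?_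
    · change destab₁ β i (stab₁ β i _) = _
      rcases c with k | j
      · cases k using Fin.lastCases with
        | last => rw [stab₁_last, destab₁_bot]; rfl
        | cast k => rw [stab₁_castSucc, destab₁_beta]; rfl
      · have h : interlacedDiff β i (.inr (Equiv.swap i.castSucc i.succ j)) ∈
            twistedDerMapKer (replaceTop β i) (topHomotopyGen i) (destab₁ β i) := by
          refine interlacedDiff_mem (fun c hc => ?_) (fun j => ?_) (fun j => ?_) _
          · change destab₁ β i (twistedDer _ _ _) = 0
            rw [twistedDer_chord]
            by_cases hc' : c = .top
            · subst hc'
              exact destab₁_topHomotopy β i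
            · rw [topHomotopyGen_of_ne _ (by simpa), map_zero]
          · change destab₁ β i (twistedDer _ _ _) = 0
            rw [twistedDer_markedVal, map_zero]
          · change destab₁ β i (twistedDer _ _ _) = 0
            rw [twistedDer_marked_inv, map_zero]
        rw [stab₁_cusp, map_add, show destab₁ β i (twistedDer _ _ _) = 0 from h, destab₁_cusp,
          Equiv.swap_apply_self, add_zero]
        rfl
    · change destab₁ β i (stab₁ β i _) = _
      rw [stab₁_markedVal, destab₁_markedVal, Equiv.swap_apply_self]
      rfl
  exact DFunLike.congr_fun h x

/-- A bare cusp chord would have a differential containing `top`, where the one with its replacement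
is needed; the twisted derivative of the differential bounds the difference. Destabilizing kills
this correction. -/
theorem isStabilization_stab₁ :
    IsStabilization (rainbow (wordRight β i)) (front₂ β i) (destab₁ β i) (stab₁ β i) := by
  refine ⟨isDGAMorphism_of_chord (Equiv.swap i.castSucc i.succ) (stab₁_markedVal β i)
    (fun c => ?_) fun c => ?_, destab₁_stab₁ β i⟩
  · rcases c with k | j
    · rw [diffGenFrom_rainbow, Sum.elim_inl, map_zero]
      cases k using Fin.lastCases with
      | last => rw [stab₁_last, diff_chord, diffGenFrom_front₂]; rfl
      | cast k => rw [stab₁_castSucc, diff_chord, diffGenFrom_front₂]; rfl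
    · have h := interlacedDiff_mem_homotopyRing β i (Equiv.swap i.castSucc i.succ j)
      have h' := (isDGAMorphism_destab₁ β i).1 (chord (.inr (Equiv.swap i.castSucc i.succ j)))
      rw [destab₁_cusp, Equiv.swap_apply_self, diff_chord, diff_chord, diffGenFrom_front₂] at h'
      rw [← h', stab₁_destab₁_interlacedDiff, stab₁_cusp, diff_add, h.2.2.1, diff_chord,
        diffGenFrom_front₂, add_add_cancel_left']
  · have h := fun c => isHomogeneous_chord (L := front₂ β i) c
    simp only [degreeGenFrom_front₂] at h
    rw [degreeGenFrom_rainbow]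
    rcases c with k | j
    · cases k using Fin.lastCases with
      | last => rw [stab₁_last]; exact h (.inl .bot)
      | cast k => rw [stab₁_castSucc]; exact h (.inl (.beta k))
    · rw [stab₁_cusp]
      exact (h (.inr _)).add (interlacedDiff_mem_homotopyRing β i _).2.2.2

/-- The section of `destab₁` is an inverse up to homotopy. -/
theorem exists_homotopy₁ : ∃ h : Alg (Cross l) (Fin (N + 1)) → Alg (Cross l) (Fin (N + 1)),
    ∀ x, diff (front₂ β i) (h x) + h (diff (front₂ β i) x) =
      x + stab₁ β i (destab₁ β i x) := by
  -- The value on `mid` is chosen so that, in the homotopy identity, the term `topHomotopy` times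
  -- the entry `(i, i)` from the boundary of the cusp chord cancels the one from the boundary of
  -- `mid`.
  let f : Cross l ⊕ Fin (N + 1) → Alg (Cross l) (Fin (N + 1)) := fun
    | .inl .top => topHomotopy i
    | .inl .mid => topHomotopy i * chord (.inr i.succ)
    | _ => 0
  let σ := (stab₁ β i).comp (destab₁ β i)
  have hσ : ∀ x, σ x = stab₁ β i (destab₁ β i x) := fun x => rfl
  have hm : ∀ j, σ (markedVal j) = markedVal j := fun j => by
    rw [hσ, destab₁_markedVal, stab₁_markedVal, Equiv.swap_apply_self]
  have htop : σ (chord (.inl .top)) = topReplacement β i := by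
    rw [hσ, destab₁_top, stab₁_topImage]
  have hcusp : ∀ j, σ (chord (.inr j)) = chord (.inr j) +
      twistedDer (replaceTop β i) (topHomotopyGen i) (interlacedDiff β i (.inr j)) := fun j => by
    rw [hσ, destab₁_cusp, stab₁_cusp, Equiv.swap_apply_self]
  have hbeta : ∀ k, σ (chord (.inl (.beta k))) = chord (.inl (.beta k)) := fun k => by
    rw [hσ, destab₁_beta, stab₁_castSucc]
  have hbot : σ (chord (.inl .bot)) = chord (.inl .bot) := by
    rw [hσ, destab₁_bot, stab₁_last]
  refine ⟨twistedDer σ f, homotopy_of_chord σ f (fun x => ?_) hm (fun c => ?_)⟩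
  · exact (congrArg _ ((isDGAMorphism_destab₁ β i).1 x)).trans ((isStabilization_stab₁ β i).1.1 _)
  · rw [diff_chord, diffGenFrom_front₂]
    -- Stated for arbitrary pairs because it is needed both for `σ` and for `replaceTop`.
    have hM : ∀ σ f, σ (chord (.inl .bot)) = chord (.inl .bot) → f (.inl .bot) = 0 → 
        (∀ k, f (.inl (.beta k)) = 0) → ∀ r c, interlacedRightMat β i r c ∈ twistedDerKer σ f := by
      intro σ f _ hb hk
      refine esteps_mem (markedNat_mem fun j => twistedDer_markedVal σ f j) (colop_mem ?_
        (wordMat_mem _ fun k => ?_)) _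
      · exact (twistedDer_chord σ f _).trans hb
      · exact (twistedDer_chord σ f _).trans (hk k)
    rcases c with (k | _ | _ | _) | j
    · simp [f, interlacedDiff, hbeta, add_self_eq_zero']
    · simp [f, interlacedDiff, hbot, add_self_eq_zero']
    · rw [htop, interlacedDiff_top, twistedDer_zero, add_zero]
      exact diff_topHomotopy β i
    · have h1 : twistedDer σ f (interlacedRightMat β i (i + 1) i) = 0 := hM σ f hbot rfl (fun _ => rfl) _ _
      have h2 : twistedDer σ f (interlacedRightMat β i i i) = 0 := hM σ f hbot rfl (fun _ => rfl) _ _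
      have h3 : twistedDer (replaceTop β i) (topHomotopyGen i) (interlacedRightMat β i i i) = 0 :=
        hM _ _ (replaceTop_of_ne _ _ (by simp)) rfl (fun _ => rfl) _ _
      rw [interlacedDiff_mid, twistedDer_add, twistedDer_mul, h1, h2, twistedDer_chord]
      have h4 : σ (chord (.inl .mid)) = topReplacement β i * chord (.inr i.succ) := by
        rw [hσ, destab₁_mid, map_mul, stab₁_topImage, stab₁_cusp, Equiv.swap_apply_left,
          interlacedDiff_succ, twistedDer_add, h3, twistedDer_marked_inv, add_zero, add_zero]
      rw [h4]
      change diff (front₂ β i) (topHomotopy i * chord (.inr i.succ)) +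
        (topHomotopy i * _ + _ + _) = _
      rw [diff_mul, diff_topHomotopy, diff_chord, diffGenFrom_front₂, interlacedDiff_succ, mul_zero,
        add_zero, add_zero, mul_add, add_mul]
      have h5 : topHomotopy i * (((marked i.succ)⁻¹ : (Alg (Cross l) (Fin (N + 1)))ˣ) :
          Alg (Cross l) (Fin (N + 1))) =
          chord (.inl .mid) + chord (.inl .top) * chord (.inr i.succ) := by
        rw [topHomotopy, mul_assoc, marked_mul_inv, mul_one]
      rw [h5]
      rw [show ∀ a b c d : Alg (Cross l) (Fin (N + 1)), a + b + c + (b + d) + c =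
        a + d + (b + b) + (c + c) from fun a b c d => by abel, add_self_eq_zero', add_self_eq_zero',
        add_zero, add_zero]
    -- The two twisted derivations agree on the differential of a cusp chord, and the second gives
    -- by definition the correction term in `stab₁`.
    · have h : interlacedDiff β i (.inr j) ∈
          twistedDerEq σ f (replaceTop β i) (topHomotopyGen i) := by
        refine interlacedDiff_mem (fun c hc => ?_) (fun j => ?_) (fun j => ?_) _
        · refine ⟨?_, ?_⟩
          · rcases c with k | _ | _ | _
            · rw [hbeta, replaceTop_of_ne _ _ (by simp)]
            · rw [hbot, replaceTop_of_ne _ _ (by simp)]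
            · rw [htop, replaceTop_top]
            · exact absurd rfl hc
          · rw [twistedDer_chord, twistedDer_chord]
            rcases c with k | _ | _ | _ <;> first | rfl | exact absurd rfl hc
        · exact ⟨by rw [hm, replaceTop_markedVal], by simp⟩
        · exact ⟨by rw [map_marked_inv (hm j), map_marked_inv (replaceTop_markedVal β i j)], by simp⟩
      rw [h.2, hcusp, add_add_cancel_left', show f (.inr j) = 0 from rfl, diff_zero, zero_add]

end Stab₁
end CE


namespace CE

/-! ### Comparison with the matrices of the statement -/

section DiskMatrix

variable {A : Type*} [Ring A] {N : ℕ}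

theorem mul_Z (i : Fin N) (b : A) (M : Matrix (Fin (N + 1)) (Fin (N + 1)) A) (M' : ℕ → ℕ → A)
    (h : ∀ r c : Fin (N + 1), M r c = M' r c) (r c : Fin (N + 1)) :
    (M * Z i b) r c = colop i b M' r c := by
  have hne : i.castSucc ≠ i.succ := i.castSucc_lt_succ.ne
  rw [Matrix.mul_apply, colop]
  by_cases h1 : c = i.castSucc
  · rw [if_pos (by rw [h1]; rfl), Fintype.sum_eq_add i.castSucc i.succ hne]
    · simp [Z, h1, hne.symm, h]
    · rintro k ⟨hk1, hk2⟩
      simp [Z, h1, hk1, hk2, hne]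
  · rw [if_neg (fun h : (c : ℕ) = i => h1 (Fin.ext h))]
    by_cases h2 : c = i.succ
    · rw [if_pos (by rw [h2]; rfl), Fintype.sum_eq_single i.castSucc]
      · simp [Z, h2, hne.symm, h]
      · intro k hk
        by_cases hk2 : k = i.succ <;> simp [Z, h2, hk, hk2, hne.symm]
    · rw [if_neg (fun h : (c : ℕ) = i + 1 => h2 (Fin.ext h)), Fintype.sum_eq_single c]
      · simp [Z, h1, h2, h]
      · intro k hk
        simp [Z, h1, h2, hk]

theorem prod_Z (P : List (Fin N × A)) (r c : Fin (N + 1)) :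
    (P.map fun p => Z p.1 p.2).prod r c =
      colops (idMat A) (P.map fun p => ((p.1 : ℕ), p.2)) r c := by
  induction P using List.reverseRecOn generalizing r c with
  | nil => simp [colops, idMat, Matrix.one_apply, Fin.ext_iff]
  | append_singleton P p ih =>
    rw [List.map_append, List.prod_append, List.map_append, colops, List.foldl_append]
    simp only [List.map_cons, List.map_nil, List.prod_singleton, List.foldl_cons, List.foldl_nil]
    exact mul_Z _ _ _ _ ih r c

theorem prod_Z_eq_wordMat {m : ℕ} (w : Fin m → Fin N) (b : Fin m → A) (r c : Fin (N + 1)) :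
    (List.ofFn fun k => Z (w k) (b k)).prod r c = wordMat w b r c := by
  have := prod_Z (List.ofFn fun k => (w k, b k)) r c
  simpa only [List.map_ofFn, Function.comp_def, wordMat] using this

theorem elim_eq_esteps {M : Matrix (Fin (N + 1)) (Fin (N + 1)) A} {t : Fin (N + 1) → A}
    {M' : ℕ → ℕ → A} {t' : ℕ → A} (hM : ∀ r c : Fin (N + 1), M r c = M' r c)
    (ht : ∀ k : Fin (N + 1), t k = t' k) (k : ℕ) (hk : k ≤ N + 1) (r c : Fin (N + 1)) :
    elim M t k r c = esteps t' 0 M' k r c := by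
  induction k generalizing r c with
  | zero => exact hM r c
  | succ k ih =>
    have h := ih (by omega)
    rw [elim, Matrix.of_apply, dif_pos (by omega), h, h, h, ht, esteps, estep, Nat.zero_add]

theorem newChordImage_eq {l : ℕ} (β : Fin l → Fin N) (i : Fin N) :
    newChordImage β i = markedVal i.castSucc * esteps (markedNat _ N) 0
      (wordMat (wordLeft i β) fun k => chord (.inl k)) i i (i + 1) := by
  rw [newChordImage, elim_eq_esteps (M := diskMatrix (wordLeft i β))
    (M' := wordMat (wordLeft i β) fun k => chord (.inl k)) (fun r c => prod_Z_eq_wordMat _ _ r c)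
    (fun k => (markedNat_val k).symm) _ (by omega)]
  rfl

end DiskMatrix

/-! ### The rotation map and its uniqueness up to boundaries -/

section Rotation

variable {N l : ℕ} (β : Fin l → Fin N) (i : Fin N)

/-- The identification of the dga of `front₃'` with that of the closure of `s_i β`. -/
noncomputable def slideTop (l N : ℕ) :
    Alg (Cross₁ l) (Fin (N + 1)) →ₐ[ZMod 2] Alg (Fin (l + 1)) (Fin (N + 1)) :=
  (destab₄ l N).comp (stab₃ l N)

theorem slideTop_beta (k : Fin l) :
    slideTop l N (chord (.inl (.beta k))) = chord (.inl k.succ) := by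
  simp [slideTop, stab₃, destab₄]

theorem slideTop_top : slideTop l N (chord (.inl .top)) = chord (.inl 0) := by
  simp [slideTop, stab₃, destab₄]

theorem slideTop_cusp (j : Fin (N + 1)) : slideTop l N (chord (.inr j)) = chord (.inr j) := by
  simp [slideTop, stab₃, destab₄]

theorem slideTop_markedVal (j : Fin (N + 1)) : slideTop l N (markedVal j) = markedVal j := by
  simp [slideTop, stab₃, destab₄]

/-- The top crossing becomes the first letter of the word, and its row operation commutes with the
eliminations below `i`. -/
theorem slideTop_botImage : slideTop l N (botImage β i) = newChordImage β i := by
  rw [newChordImage_eq, botImage, map_mul, slideTop_markedVal, wordMat_wordLeft,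
    esteps_rowop _ le_rfl, ← AlgHom.coe_toRingHom, map_rowop, AlgHom.coe_toRingHom, slideTop_top]
  congr 2
  funext r c
  rw [← AlgHom.coe_toRingHom, map_esteps]
  refine esteps_congr (fun k _ _ => ?_) (fun r c _ _ => ?_) (Nat.zero_le _) (Nat.zero_le _)
  · simp only [markedNat]
    split_ifs
    · exact slideTop_markedVal _
    · exact map_zero _
  · rw [betaMat₁, map_wordMat]
    simp only [AlgHom.coe_toRingHom, slideTop_beta]

/-- A map induced by the rotation. -/
noncomputable def rotation :
    Alg (Fin (l + 1)) (Fin (N + 1)) →ₐ[ZMod 2] Alg (Fin (l + 1)) (Fin (N + 1)) :=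
  (destab₄ l N).comp ((stab₃ l N).comp ((destab₂ β i).comp (stab₁ β i)))

theorem isRotationMap_rotation : IsRotationMap β i (rotation β i) :=
  ⟨_, _, isStabilization_stab₁ β i, isStabilization_stab₃ β i, rfl⟩

theorem rotation_castSucc (k : Fin l) :
    rotation β i (chord (.inl k.castSucc)) = chord (.inl k.succ) := by
  change slideTop l N (destab₂ β i (stab₁ β i _)) = _
  rw [stab₁_castSucc, ← slideTop_beta]
  congr 1
  exact lift_chord _ _ _

theorem rotation_last :
    rotation β i (chord (.inl (Fin.last l))) = newChordImage β i := by
  change slideTop l N (destab₂ β i (stab₁ β i _)) = _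
  rw [stab₁_last, destab₂_bot, slideTop_botImage]

section Morphisms

variable {B B' B'' J : Type} [DecidableEq B] [DecidableEq B'] [DecidableEq B''] [DecidableEq J]
  {L : List (Event B J)} {L' : List (Event B' J)} {L'' : List (Event B'' J)}

theorem IsDGAMorphism.comp {ψ : Alg B' J →ₐ[ZMod 2] Alg B'' J} {φ : Alg B J →ₐ[ZMod 2] Alg B' J}
    (hψ : IsDGAMorphism L' L'' ψ) (hφ : IsDGAMorphism L L' φ) : IsDGAMorphism L L'' (ψ.comp φ) :=
  ⟨fun x => by rw [AlgHom.comp_apply, hφ.1, hψ.1]; rfl, fun d x hx => hψ.2 d _ (hφ.2 d x hx)⟩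

/-- A section of a homotopy equivalence is determined on cycles, up to boundaries. -/
theorem IsStabilization.exists_eq_add_diff {π : Alg B' J →ₐ[ZMod 2] Alg B J}
    {φ ψ : Alg B J →ₐ[ZMod 2] Alg B' J} (hφ : IsStabilization L L' π φ)
    (hh : ∃ h : Alg B' J → Alg B' J, ∀ x, diff L' (h x) + h (diff L' x) = x + ψ (π x))
    {x : Alg B J} (hx : diff L x = 0) : ∃ y, φ x = ψ x + diff L' y := by
  obtain ⟨h, hh⟩ := hh
  -- The homotopy is a mere function, so `h 0` need not vanish; the identity at `0` shows that it is
  -- its own boundary.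
  have h0 := hh 0
  -- Since `φ` is a section, `ψ (π (φ x))` is `ψ x`.
  have h1 := hh (φ x)
  rw [← hφ.1.1, hx, map_zero, hφ.2] at h1
  rw [diff_zero, map_zero, map_zero, add_zero] at h0
  refine ⟨h (φ x) + h 0, ?_⟩
  have h2 : h 0 = diff L' (h 0) := by
    have := add_add_cancel_left' (diff L' (h 0)) (h 0)
    rwa [h0, add_zero, eq_comm] at this
  rw [diff_add, ← h2, h1, add_comm (φ x), add_add_cancel_left']

theorem comp_mem_Aug {R : Type*} [CommRing R] {φ : Alg B J →ₐ[ZMod 2] Alg B' J}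
    (hφ : IsDGAMorphism L L' φ) {ε : Alg B' J →+* R} (hε : ε ∈ Aug L' R) :
    ε.comp φ.toRingHom ∈ Aug L R :=
  ⟨fun x => (congrArg ε (hφ.1 x)).trans (hε.1 _), fun d x hd hx => hε.2 d _ hd (hφ.2 d x hx)⟩

theorem IsDGAMorphism.congr_left {L₁ : List (Event B J)} {φ : Alg B J →ₐ[ZMod 2] Alg B' J}
    (hφ : IsDGAMorphism L L' φ)
    (h : ∀ c, diffGenFrom Slice.empty L c = diffGenFrom Slice.empty L₁ c)
    (h' : ∀ c, degreeGenFrom Slice.empty L c = degreeGenFrom Slice.empty L₁ c) :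
    IsDGAMorphism L₁ L' φ :=
  ⟨fun x => by rw [← diff_congr h, hφ.1], fun d x hx => hφ.2 d x ((isHomogeneous_congr h' d x).2 hx)⟩

theorem aug_map_eq {R : Type*} [CommRing R] {ε : Alg B J →+* R} (hε : ε ∈ Aug L R)
    {x y z : Alg B J} (h : x = y + diff L z) : ε x = ε y := by
  rw [h, map_add, hε.1, add_zero]

end Morphisms

theorem isDGAMorphism_destab₂' : IsDGAMorphism (front₂ β i) (front₃ β i) (destab₂ β i) :=
  (isDGAMorphism_destab₂ β i).congr_left
    (fun c => by rw [diffGenFrom_front₂, diffGenFrom_front₂'])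
    (fun c => by rw [degreeGenFrom_front₂, degreeGenFrom_front₂'])

theorem diff_front₃ : diff (front₃ β i) = diff (front₃' β i) :=
  diff_congr fun c => by rw [diffGenFrom_front₃, diffGenFrom_front₃']

theorem isHomogeneous_front₃ (d : ℤ) (x : Alg (Cross₁ l) (Fin (N + 1))) :
    IsHomogeneous (front₃ β i) d x ↔ IsHomogeneous (front₃' β i) d x :=
  isHomogeneous_congr (fun c => by rw [degreeGenFrom_front₃, degreeGenFrom_front₃']) d x

theorem isDGAMorphism_destab₂'' : IsDGAMorphism (front₂ β i) (front₃' β i) (destab₂ β i) :=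
  ⟨fun x => by rw [(isDGAMorphism_destab₂' β i).1, diff_front₃],
    fun d x hx => (isHomogeneous_front₃ β i d _).1 ((isDGAMorphism_destab₂' β i).2 d x hx)⟩

theorem isDGAMorphism_destab₄' :
    IsDGAMorphism (front₄ β i) (rainbow (wordLeft i β)) (destab₄ l N) :=
  (isDGAMorphism_destab₄ β i).congr_left
    (fun c => by rw [(diffGenFrom_front₄ β i c).1, (diffGenFrom_front₄' β i c).1])
    (fun c => by rw [(diffGenFrom_front₄ β i c).2, (diffGenFrom_front₄' β i c).2])

variable {β i} in
theorem IsRotationMap.isDGAMorphism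
    {Φ : Alg (Fin (l + 1)) (Fin (N + 1)) →ₐ[ZMod 2] Alg (Fin (l + 1)) (Fin (N + 1))}
    (h : IsRotationMap β i Φ) :
    IsDGAMorphism (rainbow (wordRight β i)) (rainbow (wordLeft i β)) Φ := by
  obtain ⟨Φ₁, Φ₃, h1, h3, rfl⟩ := h
  exact (isDGAMorphism_destab₄' β i).comp (h3.1.comp ((isDGAMorphism_destab₂'' β i).comp h1.1))

-- Only the two creating moves involve a choice. Each choice differs from the explicit section by a
-- boundary on cycles, and the remaining maps carry boundaries to boundaries.
variable {β i} in
theorem IsRotationMap.exists_eq_add_diff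
    {Φ : Alg (Fin (l + 1)) (Fin (N + 1)) →ₐ[ZMod 2] Alg (Fin (l + 1)) (Fin (N + 1))}
    (h : IsRotationMap β i Φ) {x : Alg (Fin (l + 1)) (Fin (N + 1))}
    (hx : diff (rainbow (wordRight β i)) x = 0) :
    ∃ y, Φ x = rotation β i x + diff (rainbow (wordLeft i β)) y := by
  obtain ⟨Φ₁, Φ₃, h1, h3, rfl⟩ := h
  obtain ⟨y₁, hy₁⟩ := h1.exists_eq_add_diff (exists_homotopy₁ β i) hx
  have hx' : diff (front₃' β i) (destab₂ β i (stab₁ β i x)) = 0 := by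
    rw [← (isDGAMorphism_destab₂'' β i).1, ← (isStabilization_stab₁ β i).1.1, hx, map_zero, map_zero]
  obtain ⟨y₃, hy₃⟩ := h3.exists_eq_add_diff (exists_homotopy₃ β i) hx'
  refine ⟨destab₄ l N (y₃ + Φ₃ (destab₂ β i y₁)), ?_⟩
  simp only [AlgHom.comp_apply, rotation, hy₁, map_add, (isDGAMorphism_destab₂'' β i).1, hy₃,
    h3.1.1, (isDGAMorphism_destab₄' β i).1, diff_add]
  abel

end Rotation
end CE


namespace CE

/-! ### Bijections of augmentation varieties -/

section Augmentations

variable {N l : ℕ} (β : Fin l → Fin N) (i : Fin N) (R : Type*) [CommRing R]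

theorem isDGAMorphism_slideTop :
    IsDGAMorphism (front₃' β i) (rainbow (wordLeft i β)) (slideTop l N) :=
  (isDGAMorphism_destab₄' β i).comp (isStabilization_stab₃ β i).1

/-- The inverse of `slideTop`. -/
noncomputable def slideBack (l N : ℕ) :
    Alg (Fin (l + 1)) (Fin (N + 1)) →ₐ[ZMod 2] Alg (Cross₁ l) (Fin (N + 1)) :=
  lift (Sum.elim
    (Fin.cases (motive := fun _ => Alg (Cross₁ l) (Fin (N + 1)))
      (chord (.inl .top)) fun k => chord (.inl (.beta k)))
    fun j => chord (.inr j)) marked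

theorem slideTop_slideBack (x : Alg (Fin (l + 1)) (Fin (N + 1))) :
    slideTop l N (slideBack l N x) = x := by
  have h : (slideTop l N).comp (slideBack l N) = AlgHom.id _ _ := by
    refine Alg.algHom_ext (fun c => ?_) fun j => ?_
    · rcases c with k | j
      · cases k using Fin.cases <;> simp [slideBack, slideTop_top, slideTop_beta]
      · simp [slideBack, slideTop_cusp]
    · simp [slideBack, slideTop_markedVal]
  exact DFunLike.congr_fun h x

theorem slideBack_slideTop (x : Alg (Cross₁ l) (Fin (N + 1))) :
    slideBack l N (slideTop l N x) = x := by
  have h : (slideBack l N).comp (slideTop l N) = AlgHom.id _ _ := by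
    refine Alg.algHom_ext (fun c => ?_) fun j => ?_
    · rcases c with (k | _) | j <;>
        simp [slideBack, slideTop_top, slideTop_beta, slideTop_cusp]
    · simp [slideBack, slideTop_markedVal]
  exact DFunLike.congr_fun h x

/-- The inverse of a bijective chain map is a chain map; only degrees need to be checked on
generators. -/
theorem isDGAMorphism_slideBack :
    IsDGAMorphism (rainbow (wordLeft i β)) (front₃' β i) (slideBack l N) := by
  have h := isDGAMorphism_slideTop β i
  refine ⟨fun x => ?_, fun d x hx => IsHomogeneous.lift (σ := id) (fun c => ?_) hx⟩
  · rw [← slideBack_slideTop (diff (front₃' β i) _), h.1, slideTop_slideBack]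
  · rw [degreeGenFrom_rainbow]
    have h := fun c => isHomogeneous_chord (L := front₃' β i) c
    simp only [degreeGenFrom_front₃'] at h
    rcases c with k | j
    · cases k using Fin.cases
      · exact h (.inl .top)
      · exact h (.inl (.beta _))
    · exact h (.inr _)

theorem bijOn_slideTop : Set.BijOn (fun ε => ε.comp (slideTop l N).toRingHom)
    (Aug (rainbow (wordLeft i β)) R) (Aug (front₃' β i) R) := by
  refine Set.InvOn.bijOn (f' := fun ε => ε.comp (slideBack l N).toRingHom) ⟨fun ε _ => ?_, fun ε _ => ?_⟩
    (fun ε hε => comp_mem_Aug (isDGAMorphism_slideTop β i) hε)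
    (fun ε hε => comp_mem_Aug (isDGAMorphism_slideBack β i) hε)
  · exact RingHom.ext fun x => congrArg ε (slideTop_slideBack x)
  · exact RingHom.ext fun x => congrArg ε (slideBack_slideTop x)

/-- The inclusion of generators; it is not a dga morphism. -/
noncomputable def inclusion (l N : ℕ) :
    Alg (Cross₁ l) (Fin (N + 1)) →ₐ[ZMod 2] Alg (Cross l) (Fin (N + 1)) :=
  lift
    (fun
      | .inl (.beta k) => chord (.inl (.beta k))
      | .inl .top => chord (.inl .top)
      | .inr j => chord (.inr j))
    marked

theorem destab₂_inclusion (x : Alg (Cross₁ l) (Fin (N + 1))) :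
    destab₂ β i (inclusion l N x) = x := by
  have h : (destab₂ β i).comp (inclusion l N) = AlgHom.id _ _ := by
    refine Alg.algHom_ext (fun c => ?_) fun j => ?_
    · rcases c with (k | _) | j <;> simp [inclusion, destab₂]
    · simp [inclusion, destab₂]
  exact DFunLike.congr_fun h x

theorem IsHomogeneous.inclusion {d : ℤ} {x : Alg (Cross₁ l) (Fin (N + 1))}
    (hx : IsHomogeneous (front₃ β i) d x) :
    IsHomogeneous (front₂ β i) d (inclusion l N x) := by
  refine IsHomogeneous.lift (σ := id) (fun c => ?_) hx
  rw [degreeGenFrom_front₃]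
  have h := fun c => isHomogeneous_chord (L := front₂ β i) c
  simp only [degreeGenFrom_front₂] at h
  rcases c with (k | _) | j
  · exact h (.inl (.beta k))
  · exact h (.inl .top)
  · exact h (.inr j)

variable {R}

theorem map_self_add {B J : Type} (ε : Alg B J →+* R) (x : Alg B J) : ε x + ε x = 0 := by
  rw [← map_add, add_self_eq_zero', map_zero]

theorem aug_map_eq_zero_of_degree {B J : Type} [DecidableEq B] [DecidableEq J]
    {L : List (Event B J)} {ε : Alg B J →+* R} (hε : ε ∈ Aug L R) {c : B ⊕ J}
    (h : degreeGenFrom Slice.empty L c = 1) : ε (chord c) = 0 :=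
  hε.2 1 _ one_ne_zero (h ▸ isHomogeneous_chord c)

-- An augmentation kills the boundaries of `mid` and of $a_i$, that is, $Q_{ii}b+Q_{i,i+1}$ and
-- $t_i^{-1}+Q_{ii}$, where $b$ is the chord `bot`. These two equations force the value of $b$.
variable {β i} in
theorem aug_map_inclusion_botImage {ε : Alg (Cross l) (Fin (N + 1)) →+* R}
    (hε : ε ∈ Aug (front₂ β i) R) : ε (inclusion l N (botImage β i)) = ε (chord (.inl .bot)) := by
  set Q : ℕ → ℕ → Alg (Cross l) (Fin (N + 1)) := rowop i (chord (.inl .top))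
    (esteps (markedNat _ N) 0 (betaMat β) i) with hQ
  have hM : interlacedMat β i = colop i (chord (.inl .bot)) Q := by
    rw [interlacedMat, esteps_colop _ le_rfl, ← colop_rowop]
  have h1 : inclusion l N (botImage β i) = markedVal i.castSucc * Q i (i + 1) := by
    rw [botImage, map_mul]
    congr 1
    · exact lift_markedVal _ _ _
    · rw [← AlgHom.coe_toRingHom, map_rowop]
      have e1 : ∀ k, inclusion l N (chord (.inl (.beta k))) = chord (.inl (.beta k)) :=
        fun k => lift_chord _ _ _
      have e2 : inclusion l N (chord (.inl .top)) = chord (.inl .top) := lift_chord _ _ _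
      rw [AlgHom.coe_toRingHom, e2, hQ]
      congr 1
      funext r c
      rw [← AlgHom.coe_toRingHom, map_esteps]
      refine esteps_congr (fun k _ _ => map_markedNat _ k) (fun r c _ _ => ?_)
        (Nat.zero_le _) (Nat.zero_le _)
      rw [betaMat₁, map_wordMat]
      simp only [AlgHom.coe_toRingHom, e1, betaMat]
  have h2 := hε.1 (chord (.inl .mid))
  have h3 := hε.1 (chord (.inr i.castSucc))
  rw [diff_chord, diffGenFrom_front₂, interlacedDiff, hM, colop, if_pos rfl, map_add, map_mul] at h2
  rw [diff_chord, diffGenFrom_front₂, interlacedDiff, interlacedPivot, Fin.val_castSucc,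
    if_neg (by omega), if_pos rfl, hM, colop, if_neg (by omega), if_pos rfl, map_add] at h3
  rw [h1, map_mul]
  have h4 : ε (markedVal i.castSucc) *
      ε (((marked i.castSucc)⁻¹ : (Alg (Cross l) (Fin (N + 1)))ˣ) : Alg (Cross l) (Fin (N + 1))) =
        1 := by
    rw [← map_mul, marked_mul_inv, map_one]
  have h5 := map_self_add ε (Q i i)
  have h6 := map_self_add ε (Q i (i + 1))
  linear_combination ε (chord (.inl .bot)) * h4 - ε (markedVal i.castSucc) * h2 -
    ε (chord (.inl .bot)) * ε (markedVal i.castSucc) * h3 +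
    ε (chord (.inl .bot)) * ε (markedVal i.castSucc) * h5 + ε (markedVal i.castSucc) * h6

-- Although `inclusion` is no dga morphism, augmentations cannot tell: `bot` has the forced value,
-- and `mid` and its image both go to zero for degree reasons.
variable {β i} in
theorem aug_map_inclusion_destab₂ {ε : Alg (Cross l) (Fin (N + 1)) →+* R}
    (hε : ε ∈ Aug (front₂ β i) R) (x : Alg (Cross l) (Fin (N + 1))) :
    ε (inclusion l N (destab₂ β i x)) = ε x := by
  have h : ε.comp ((inclusion l N).comp (destab₂ β i)).toRingHom = ε := by
    refine Alg.ringHom_ext (fun c => ?_) fun j => ?_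
    · change ε (inclusion l N (destab₂ β i _)) = _
      have h0 : ∀ j, inclusion l N (chord (.inr j)) = chord (.inr j) := fun j => lift_chord _ _ _
      rcases c with (k | _ | _ | _) | j
      · simp [inclusion, destab₂]
      · rw [destab₂_bot, aug_map_inclusion_botImage hε]
      · simp [inclusion, destab₂]
      · rw [destab₂_mid, map_mul, map_mul, h0,
          aug_map_eq_zero_of_degree hε (by rw [degreeGenFrom_front₂]; rfl),
          aug_map_eq_zero_of_degree hε (by rw [degreeGenFrom_front₂]; rfl), zero_mul]
      · simp [inclusion, destab₂]
    · change ε (inclusion l N (destab₂ β i _)) = _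
      simp [inclusion, destab₂]
  exact RingHom.congr_fun h x

variable (R)

theorem bijOn_destab₂ : Set.BijOn (fun ε => ε.comp (destab₂ β i).toRingHom)
    (Aug (front₃' β i) R) (Aug (front₂ β i) R) := by
  refine Set.InvOn.bijOn (f' := fun ε => ε.comp (inclusion l N).toRingHom)
    ⟨fun ε _ => ?_, fun ε hε => ?_⟩
    (fun ε hε => comp_mem_Aug (isDGAMorphism_destab₂'' β i) hε) (fun ε hε => ⟨fun x => ?_, ?_⟩)
  · exact RingHom.ext fun x => congrArg ε (destab₂_inclusion β i x)
  · exact RingHom.ext fun x => aug_map_inclusion_destab₂ hε x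
  · change ε (inclusion l N _) = 0
    -- The inclusion respects the differential only after `ε`, so the boundary is first rewritten as
    -- the destabilized boundary of an included element.
    rw [← destab₂_inclusion β i x, ← (isDGAMorphism_destab₂'' β i).1, aug_map_inclusion_destab₂ hε,
      hε.1]
  · exact fun d x hd hx =>
      hε.2 d _ hd (IsHomogeneous.inclusion β i ((isHomogeneous_front₃ β i d x).2 hx))

/-- Section and destabilization are homotopy inverse, so augmentations see no difference on cycles.
The generators that are not known to be cycles have degree one and are sent to zero. -/
theorem bijOn_stab₁ : Set.BijOn (fun ε => ε.comp (stab₁ β i).toRingHom)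
    (Aug (front₂ β i) R) (Aug (rainbow (wordRight β i)) R) := by
  have hs := isStabilization_stab₁ β i
  have hπ := isDGAMorphism_destab₁ β i
  refine Set.InvOn.bijOn (f' := fun ε => ε.comp (destab₁ β i).toRingHom)
    ⟨fun ε hε => ?_, fun ε _ => ?_⟩
    (fun ε hε => comp_mem_Aug hs.1 hε) (fun ε hε => comp_mem_Aug hπ hε)
  · have h' : ∀ x, diff (front₂ β i) x = 0 → ε (stab₁ β i (destab₁ β i x)) = ε x := by
      intro x hx
      obtain ⟨h, hh⟩ := exists_homotopy₁ β i
      have h1 := congrArg ε (hh x)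
      have h0 := congrArg ε (hh 0)
      simp only [hx, diff_zero, map_add, hε.1, map_zero, zero_add] at h0 h1
      rw [h0] at h1
      have := map_self_add ε x
      linear_combination -h1 - this
    have h'' : ∀ c, degreeGenFrom Slice.empty (front₂ β i) c = 1 →
        ε (stab₁ β i (destab₁ β i (chord c))) = ε (chord c) := fun c hc => by
      rw [aug_map_eq_zero_of_degree hε hc]
      exact hε.2 1 _ one_ne_zero (hs.1.2 1 _ (hπ.2 1 _ (hc ▸ isHomogeneous_chord c)))
    refine Alg.ringHom_ext (fun c => ?_) fun j => h' _ (diff_markedVal _ _)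
    rcases c with c | j
    · by_cases hc : c = .mid
      · subst hc
        exact h'' _ (by rw [degreeGenFrom_front₂]; rfl)
      · exact h' _ (chord_mem_cyclesZero_front₂ β i hc).1
    · exact h'' _ (by rw [degreeGenFrom_front₂]; rfl)
  · exact RingHom.ext fun x => congrArg ε (hs.2 x)

-- Crossings and marked points are cycles, where induced maps agree up to boundaries; cusp chords go
-- to degree one elements, which augmentations kill.
variable {β i R} in
theorem IsRotationMap.comp_eq
    {Φ : Alg (Fin (l + 1)) (Fin (N + 1)) →ₐ[ZMod 2] Alg (Fin (l + 1)) (Fin (N + 1))}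
    (h : IsRotationMap β i Φ) {ε : Alg (Fin (l + 1)) (Fin (N + 1)) →+* R}
    (hε : ε ∈ Aug (rainbow (wordLeft i β)) R) :
    ε.comp Φ.toRingHom = ε.comp (rotation β i).toRingHom := by
  have h' : ∀ x, diff (rainbow (wordRight β i)) x = 0 → ε (Φ x) = ε (rotation β i x) :=
    fun x hx => aug_map_eq hε (h.exists_eq_add_diff hx).choose_spec
  refine Alg.ringHom_ext (fun c => ?_) fun j => h' _ (diff_markedVal _ _)
  rcases c with c | j
  · exact h' _ (by rw [diff_chord, diffGenFrom_rainbow]; rfl)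
  · have hj : IsHomogeneous (rainbow (wordRight β i)) 1 (chord (.inr j)) := by
      have := isHomogeneous_chord (L := rainbow (wordRight β i)) (.inr j)
      rwa [degreeGenFrom_rainbow] at this
    exact (hε.2 1 _ one_ne_zero (h.isDGAMorphism.2 1 _ hj)).trans
      (hε.2 1 _ one_ne_zero ((isRotationMap_rotation β i).isDGAMorphism.2 1 _ hj)).symm

theorem bijOn_rotation : Set.BijOn (fun ε => ε.comp (rotation β i).toRingHom)
    (Aug (rainbow (wordLeft i β)) R) (Aug (rainbow (wordRight β i)) R) :=
  (bijOn_stab₁ β i R).comp ((bijOn_destab₂ β i R).comp (bijOn_slideTop β i R))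

variable {β i} in
theorem IsRotationMap.bijOn
    {Φ : Alg (Fin (l + 1)) (Fin (N + 1)) →ₐ[ZMod 2] Alg (Fin (l + 1)) (Fin (N + 1))}
    (h : IsRotationMap β i Φ) : Set.BijOn (fun ε => ε.comp Φ.toRingHom)
      (Aug (rainbow (wordLeft i β)) R) (Aug (rainbow (wordRight β i)) R) :=
  (bijOn_rotation β i R).congr fun _ hε => (h.comp_eq hε).symm

variable {β i} in
theorem IsRotationMap.exists_castSucc
    {Φ : Alg (Fin (l + 1)) (Fin (N + 1)) →ₐ[ZMod 2] Alg (Fin (l + 1)) (Fin (N + 1))}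
    (h : IsRotationMap β i Φ) (k : Fin l) : ∃ y, Φ (chord (.inl k.castSucc)) =
      chord (.inl k.succ) + diff (rainbow (wordLeft i β)) y := by
  rw [← rotation_castSucc β i]
  exact h.exists_eq_add_diff (by rw [diff_chord, diffGenFrom_rainbow]; rfl)

variable {β i} in
theorem IsRotationMap.exists_last
    {Φ : Alg (Fin (l + 1)) (Fin (N + 1)) →ₐ[ZMod 2] Alg (Fin (l + 1)) (Fin (N + 1))}
    (h : IsRotationMap β i Φ) : ∃ y, Φ (chord (.inl (Fin.last l))) =
      newChordImage β i + diff (rainbow (wordLeft i β)) y := by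
  rw [← rotation_last]
  exact h.exists_eq_add_diff (by rw [diff_chord, diffGenFrom_rainbow]; rfl)

end Augmentations
end CE


/-! ### Matrices in $SL_n$ over a field of characteristic two -/

namespace DBS

open Matrix

variable {N : ℕ} {F : Type*} [Field F]

theorem mem_Bplus {g : G N F} : g ∈ Bplus N F ↔ ∀ r c, c < r → g.1 r c = 0 :=
  ⟨fun h _ _ hrc => h hrc, fun h _ _ hrc => h _ _ hrc⟩

theorem mem_Bminus {g : G N F} : g ∈ Bminus N F ↔ ∀ r c, r < c → g.1 r c = 0 :=
  ⟨fun h _ _ hrc => h hrc, fun h _ _ hrc => h _ _ hrc⟩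

theorem mem_Uminus {g : G N F} :
    g ∈ Uminus N F ↔ (∀ r c, r < c → g.1 r c = 0) ∧ ∀ r, g.1 r r = 1 :=
  ⟨fun h => ⟨fun _ _ hrc => h.1 hrc, h.2⟩, fun h => ⟨fun _ _ hrc => h.1 _ _ hrc, h.2⟩⟩

theorem G.ext {g h : G N F} (H : ∀ r c, g.1 r c = h.1 r c) : g = h :=
  Subtype.ext (Matrix.ext H)

theorem coe_mul' (g h : G N F) : (g * h).1 = g.1 * h.1 := rfl

theorem one_apply' (r c : Fin (N + 1)) : (1 : G N F).1 r c = if r = c then 1 else 0 :=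
  Matrix.one_apply

/-- This rigidity makes the normal forms of orbits unique. -/
theorem eq_one_of_mem {g : G N F} (h1 : g ∈ Bplus N F) (h2 : g ∈ Uminus N F) : g = 1 := by
  rw [mem_Bplus] at h1
  rw [mem_Uminus] at h2
  refine G.ext fun r c => ?_
  rw [one_apply']
  rcases lt_trichotomy r c with h | h | h
  · rw [h2.1 r c h, if_neg h.ne]
  · rw [h, h2.2, if_pos rfl]
  · rw [h1 r c h, if_neg h.ne']

variable (i : Fin N)

theorem e_mul_apply (q : F) (g : G N F) (r c : Fin (N + 1)) :
    (e i q * g).1 r c = g.1 r c + if r = i.castSucc then q * g.1 i.succ c else 0 := by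
  change (transvection i.castSucc i.succ q * g.1) r c = _
  split_ifs with h
  · rw [h, transvection_mul_apply_same]
  · rw [transvection_mul_apply_of_ne _ _ _ _ h, add_zero]

theorem eNeg_mul_apply (q : F) (g : G N F) (r c : Fin (N + 1)) :
    (eNeg i q * g).1 r c = g.1 r c + if r = i.succ then q * g.1 i.castSucc c else 0 := by
  change (transvection i.succ i.castSucc q * g.1) r c = _
  split_ifs with h
  · rw [h, transvection_mul_apply_same]
  · rw [transvection_mul_apply_of_ne _ _ _ _ h, add_zero]

theorem mul_e_apply (q : F) (g : G N F) (r c : Fin (N + 1)) :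
    (g * e i q).1 r c = g.1 r c + if c = i.succ then q * g.1 r i.castSucc else 0 := by
  change (g.1 * transvection i.castSucc i.succ q) r c = _
  split_ifs with h
  · rw [h, mul_transvection_apply_same]
  · rw [mul_transvection_apply_of_ne _ _ _ _ h, add_zero]

theorem mul_eNeg_apply (q : F) (g : G N F) (r c : Fin (N + 1)) :
    (g * eNeg i q).1 r c = g.1 r c + if c = i.castSucc then q * g.1 r i.succ else 0 := by
  change (g.1 * transvection i.succ i.castSucc q) r c = _
  split_ifs with h
  · rw [h, mul_transvection_apply_same]
  · rw [mul_transvection_apply_of_ne _ _ _ _ h, add_zero]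

theorem e_apply (q : F) (r c : Fin (N + 1)) : (e i q).1 r c =
    (if r = c then 1 else 0) + if r = i.castSucc ∧ c = i.succ then q else 0 := by
  rw [← mul_one (e i q), e_mul_apply, one_apply', one_apply']
  simp only [ite_and, mul_ite, mul_one, mul_zero, eq_comm]

theorem eNeg_apply (q : F) (r c : Fin (N + 1)) : (eNeg i q).1 r c =
    (if r = c then 1 else 0) + if r = i.succ ∧ c = i.castSucc then q else 0 := by
  rw [← mul_one (eNeg i q), eNeg_mul_apply, one_apply', one_apply']
  simp only [ite_and, mul_ite, mul_one, mul_zero, eq_comm]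

theorem e_add (q q' : F) : e i q * e i q' = e i (q + q') := by
  refine G.ext fun r c => ?_
  have h : i.succ ≠ i.castSucc := i.castSucc_lt_succ.ne'
  rw [mul_e_apply, e_apply, e_apply, e_apply]
  by_cases hr : r = i.castSucc <;> by_cases hc : c = i.succ <;> simp [hr, hc, h.symm]

theorem e_zero : e i (0 : F) = 1 := by
  refine G.ext fun r c => ?_
  rw [e_apply, one_apply']
  simp

theorem e_mem_Bplus (q : F) : e i q ∈ Bplus N F := by
  rw [mem_Bplus]
  intro r c h
  have : i.castSucc < i.succ := i.castSucc_lt_succ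
  rw [e_apply, if_neg h.ne', if_neg (by rintro ⟨rfl, rfl⟩; exact lt_asymm h this), add_zero]

theorem eNeg_mem_Uminus (q : F) : eNeg i q ∈ Uminus N F := by
  rw [mem_Uminus]
  have : i.castSucc < i.succ := i.castSucc_lt_succ
  refine ⟨fun r c h => ?_, fun r => ?_⟩
  · rw [eNeg_apply, if_neg h.ne, if_neg (by rintro ⟨rfl, rfl⟩; exact lt_asymm h this), add_zero]
  · rw [eNeg_apply, if_pos rfl, if_neg (by rintro ⟨rfl, h⟩; exact this.ne' h), add_zero]

/-- The transposition that exchanges the levels `i` and `i + 1`. -/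
abbrev levelSwap : Equiv.Perm (Fin (N + 1)) := Equiv.swap i.castSucc i.succ

/-- A simple transposition inverts exactly one pair of indices. -/
theorem levelSwap_lt {r c : Fin (N + 1)} (h : c < r) (h' : ¬(c = i.castSucc ∧ r = i.succ)) :
    levelSwap i c < levelSwap i r := by
  simp only [levelSwap, Equiv.swap_apply_def]
  simp only [Fin.lt_def, Fin.ext_iff, Fin.val_succ, Fin.val_castSucc] at *
  split_ifs <;> (try simp only [Fin.val_succ, Fin.val_castSucc]) <;> omega

section CharTwo

variable [CharP F 2]

/-- Since $-1=1$, the element $\bar s_i$ is a permutation matrix. -/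
theorem sBar_mul_apply (g : G N F) (r c : Fin (N + 1)) :
    (sBar N F i * g).1 r c = g.1 (levelSwap i r) c := by
  have h : i.succ ≠ i.castSucc := i.castSucc_lt_succ.ne'
  rw [sBar, mul_assoc, mul_assoc]
  simp only [e_mul_apply, eNeg_mul_apply, CharTwo.neg_eq, one_mul]
  by_cases hr : r = i.castSucc
  · subst hr
    simp [h, h.symm]
    linear_combination g.1 i.castSucc c * CharTwo.two_eq_zero (R := F) +
      g.1 i.succ c * CharTwo.two_eq_zero (R := F)
  · by_cases hr' : r = i.succ
    · subst hr'
      simp [h]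
      linear_combination g.1 i.succ c * CharTwo.two_eq_zero (R := F)
    · simp [hr, hr', Equiv.swap_apply_of_ne_of_ne]

theorem mul_sBar_apply (g : G N F) (r c : Fin (N + 1)) :
    (g * sBar N F i).1 r c = g.1 r (levelSwap i c) := by
  have h : i.succ ≠ i.castSucc := i.castSucc_lt_succ.ne'
  rw [sBar, ← mul_assoc, ← mul_assoc]
  simp only [mul_e_apply, mul_eNeg_apply, CharTwo.neg_eq, one_mul]
  by_cases hr : c = i.succ
  · subst hr
    simp [h, h.symm]
    linear_combination g.1 r i.castSucc * CharTwo.two_eq_zero (R := F) +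
      g.1 r i.succ * CharTwo.two_eq_zero (R := F)
  · by_cases hr' : c = i.castSucc
    · subst hr'
      simp [h.symm]
      linear_combination g.1 r i.castSucc * CharTwo.two_eq_zero (R := F)
    · simp [hr, hr', Equiv.swap_apply_of_ne_of_ne]

theorem conj_sBar_apply (g : G N F) (r c : Fin (N + 1)) :
    (sBar N F i * g * sBar N F i).1 r c = g.1 (levelSwap i r) (levelSwap i c) := by
  rw [mul_sBar_apply, sBar_mul_apply]

theorem sBar_mul_self : sBar N F i * sBar N F i = 1 := by
  refine G.ext fun r c => ?_
  have h := conj_sBar_apply i (1 : G N F) r c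
  rw [mul_one] at h
  rw [h, one_apply', one_apply']
  simp only [EmbeddingLike.apply_eq_iff_eq]

theorem sBar_inv : (sBar N F i)⁻¹ = sBar N F i := inv_eq_of_mul_eq_one_left (sBar_mul_self i)

theorem sBar_mul_cancel (g : G N F) : sBar N F i * (sBar N F i * g) = g := by
  rw [← mul_assoc, sBar_mul_self, one_mul]

theorem e_inv (q : F) : (e i q)⁻¹ = e i q := by
  apply inv_eq_of_mul_eq_one_left
  rw [e_add, CharTwo.add_self_eq_zero, e_zero]

theorem conj_e (q : F) : sBar N F i * e i q * sBar N F i = eNeg i q := by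
  refine G.ext fun r c => ?_
  rw [conj_sBar_apply, e_apply, eNeg_apply]
  simp only [EmbeddingLike.apply_eq_iff_eq, levelSwap, Equiv.swap_apply_eq_iff,
    Equiv.swap_apply_left, Equiv.swap_apply_right]

/-- Conjugation permutes the indices by a transposition that inverts a single pair, so a single
entry is the obstruction to staying triangular. -/
theorem conj_mem_Bplus {g : G N F} (hg : g ∈ Bplus N F) (h : g.1 i.castSucc i.succ = 0) :
    sBar N F i * g * sBar N F i ∈ Bplus N F := by
  rw [mem_Bplus] at hg ⊢
  intro r c hrc
  rw [conj_sBar_apply]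
  by_cases h' : c = i.castSucc ∧ r = i.succ
  · rw [h'.1, h'.2, Equiv.swap_apply_left, Equiv.swap_apply_right, h]
  · exact hg _ _ (levelSwap_lt i hrc h')

theorem conj_mem_Bminus {g : G N F} (hg : g ∈ Bminus N F) (h : g.1 i.succ i.castSucc = 0) :
    sBar N F i * g * sBar N F i ∈ Bminus N F := by
  rw [mem_Bminus] at hg ⊢
  intro r c hrc
  rw [conj_sBar_apply]
  by_cases h' : r = i.castSucc ∧ c = i.succ
  · rw [h'.1, h'.2, Equiv.swap_apply_left, Equiv.swap_apply_right, h]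
  · exact hg _ _ (levelSwap_lt i hrc h')

theorem conj_mem_Uminus {g : G N F} (hg : g ∈ Uminus N F) (h : g.1 i.succ i.castSucc = 0) :
    sBar N F i * g * sBar N F i ∈ Uminus N F :=
  mem_Uminus.2 ⟨mem_Bminus.1 (conj_mem_Bminus i (Uminus_le_Bminus hg) h),
    fun r => by rw [conj_sBar_apply, (mem_Uminus.1 hg).2]⟩

theorem R_mul (q : F) (g : G N F) : (R i q)⁻¹ * g = sBar N F i * (e i q * g) := by
  rw [R, _root_.mul_inv_rev, sBar_inv, e_inv, mul_assoc]

/-- The matrices that move flags and those that count half-disks coincide; the comparison with the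
dga rests on this. -/
theorem R_apply (q : F) : (R i q).1 = CE.Z i q := by
  have h : i.succ ≠ i.castSucc := i.castSucc_lt_succ.ne'
  ext r c
  rw [R, mul_sBar_apply, e_apply, CE.Z, Matrix.of_apply]
  by_cases hc : c = i.castSucc
  · subst hc
    by_cases hr : r = i.castSucc
    · simp [hr, h.symm]
    · simp [hr, h.symm]
  · by_cases hc' : c = i.succ
    · subst hc'
      by_cases hr : r = i.castSucc
      · simp [hr, h, h.symm]
      · simp [hr, h, h.symm]
    · simp [hc, hc', Equiv.swap_apply_of_ne_of_ne]

end CharTwo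

theorem coe_prod (P : List (G N F)) : P.prod.1 = (P.map Subtype.val).prod := by
  induction P with
  | nil => rfl
  | cons g P ih =>
    rw [List.prod_cons, coe_mul', ih]
    exact List.prod_cons.symm

end DBS


/-! ### Bruhat cells and chains of flags -/

namespace DBS

open Matrix DoubleCoset

variable {N : ℕ} {F : Type*} [Field F]

section Groups

variable {Γ : Type*} [Group Γ] {H K : Subgroup Γ} {a b c s : Γ}

theorem mul_mem_doubleCoset (ha : a ∈ doubleCoset s (H : Set Γ) K) (hb : b ∈ H) (hc : c ∈ K) :
    b * a * c ∈ doubleCoset s (H : Set Γ) K := by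
  obtain ⟨x, hx, y, hy, rfl⟩ := mem_doubleCoset.1 ha
  exact mem_doubleCoset.2 ⟨b * x, H.mul_mem hb hx, y * c, K.mul_mem hy hc, by group⟩

theorem left_mul_mem_doubleCoset (ha : a ∈ doubleCoset s (H : Set Γ) K) (hb : b ∈ H) :
    b * a ∈ doubleCoset s (H : Set Γ) K := by
  simpa using mul_mem_doubleCoset ha hb K.one_mem

theorem right_mul_mem_doubleCoset (ha : a ∈ doubleCoset s (H : Set Γ) K) (hc : c ∈ K) :
    a * c ∈ doubleCoset s (H : Set Γ) K := by
  simpa using mul_mem_doubleCoset ha H.one_mem hc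

theorem base_mul_mem_doubleCoset (hc : c ∈ K) : s * c ∈ doubleCoset s (H : Set Γ) K :=
  mem_doubleCoset.2 ⟨1, H.one_mem, c, hc, by group⟩

theorem mul_base_mem_doubleCoset (hb : b ∈ H) : b * s ∈ doubleCoset s (H : Set Γ) K :=
  mem_doubleCoset.2 ⟨b, hb, 1, K.one_mem, by group⟩

end Groups

theorem Bplus_diag_ne_zero {g : G N F} (hg : g ∈ Bplus N F) (r : Fin (N + 1)) : g.1 r r ≠ 0 := by
  have h := diag_mul (f := (id : Fin (N + 1) → Fin (N + 1))) Function.injective_id hg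
    (blockTriangular_inv _ g hg) r
  rw [← coe_mul', mul_inv_cancel, one_apply', if_pos rfl] at h
  exact left_ne_zero_of_mul (h ▸ one_ne_zero)

theorem Bminus_diag_ne_zero {g : G N F} (hg : g ∈ Bminus N F) (r : Fin (N + 1)) :
    g.1 r r ≠ 0 := by
  have h := diag_mul (f := (OrderDual.toDual : Fin (N + 1) → (Fin (N + 1))ᵒᵈ))
    OrderDual.toDual.injective hg (blockTriangular_inv _ g hg) r
  rw [← coe_mul', mul_inv_cancel, one_apply', if_pos rfl] at h
  exact left_ne_zero_of_mul (h ▸ one_ne_zero)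

/-- The diagonal part of a lower triangular matrix. -/
theorem exists_diag {b : G N F} (hb : b ∈ Bminus N F) : ∃ t : G N F, t ∈ Bplus N F ∧
    t ∈ Bminus N F ∧ (∀ r c, r ≠ c → t.1 r c = 0) ∧ b * t⁻¹ ∈ Uminus N F ∧ t⁻¹ * b ∈ Uminus N F := by
  have hdet : (Matrix.diagonal fun r => b.1 r r).det = 1 := by
    rw [Matrix.det_diagonal, ← Matrix.det_of_isLowerTriangular _ hb]
    exact b.2
  let t : G N F := ⟨_, hdet⟩
  have ht : ∀ r c, r ≠ c → t.1 r c = 0 := fun r c h => Matrix.diagonal_apply_ne _ h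
  have ht' : t ∈ Bminus N F := mem_Bminus.2 fun r c h => ht r c h.ne
  have hti := (Bminus N F).inv_mem ht'
  have hinj := (OrderDual.toDual (α := Fin (N + 1))).injective
  have h1 : ∀ r, t.1 r r = b.1 r r := fun r => Matrix.diagonal_apply_eq _ r
  have h2 : ∀ r, t.1 r r * (t⁻¹).1 r r = 1 := fun r => by
    rw [← diag_mul hinj ht' hti, ← coe_mul', mul_inv_cancel, one_apply', if_pos rfl]
  refine ⟨t, mem_Bplus.2 fun r c h => ht r c h.ne', ht', ht, mem_Uminus.2
    ⟨mem_Bminus.1 ((Bminus N F).mul_mem hb hti), fun r => ?_⟩, mem_Uminus.2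
    ⟨mem_Bminus.1 ((Bminus N F).mul_mem hti hb), fun r => ?_⟩⟩
  · rw [coe_mul', diag_mul hinj hb hti, ← h1, h2]
  · rw [coe_mul', diag_mul hinj hti hb, ← h1, mul_comm, h2]

variable {m : ℕ} (i : Fin N)

theorem sum_eq_two_levels (f : Fin (N + 1) → F)
    (h : ∀ k, k ≠ i.castSucc → k ≠ i.succ → f k = 0) : ∑ k, f k = f i.castSucc + f i.succ :=
  Fintype.sum_eq_add _ _ i.castSucc_lt_succ.ne fun k hk => h k hk.1 hk.2

theorem R_mem (q : F) : R i q ∈ doubleCoset (sBar N F i) (Bplus N F : Set (G N F)) (Bplus N F) :=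
  mul_base_mem_doubleCoset (e_mem_Bplus i q)

/-- The matrices `R_{w_1}(q_1) ⋯ R_{w_k}(q_k)`. -/
def prodR {m : ℕ} (w : Fin m → Fin N) (q : Fin m → F) (k : Fin (m + 1)) : G N F :=
  Fin.partialProd (fun j => R (w j) (q j)) k

theorem prodR_zero (w : Fin m → Fin N) (q : Fin m → F) : prodR w q 0 = 1 := Fin.partialProd_zero _

theorem prodR_succ (w : Fin m → Fin N) (q : Fin m → F) (k : Fin m) :
    prodR w q k.succ = prodR w q k.castSucc * R (w k) (q k) := Fin.partialProd_succ _ _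

theorem prodR_cons (w : Fin (m + 1) → Fin N) (q : Fin (m + 1) → F) (k : Fin (m + 1)) :
    prodR w q k.succ = R (w 0) (q 0) * prodR (fun j => w j.succ) (fun j => q j.succ) k :=
  Fin.partialProd_succ' _ _

variable [CharP F 2]

/-- The intersection of two Bruhat cells. -/
theorem mul_sBar_mem_Bminus {w : G N F}
    (h1 : w ∈ doubleCoset (sBar N F i) (Bminus N F : Set (G N F)) (Bminus N F))
    (h2 : w ∈ doubleCoset (sBar N F i) (Bminus N F : Set (G N F)) (Bplus N F)) :
    w * sBar N F i ∈ Bminus N F := by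
  obtain ⟨b, hb, b', hb', rfl⟩ := mem_doubleCoset.1 h1
  obtain ⟨c, hc, c', hc', h⟩ := mem_doubleCoset.1 h2
  have hd : c⁻¹ * b ∈ Bminus N F := (Bminus N F).mul_mem ((Bminus N F).inv_mem hc) hb
  have e1 : sBar N F i * (c⁻¹ * b) * sBar N F i * b' = c' := by
    have : c⁻¹ * b * sBar N F i * b' = sBar N F i * c' := by
      rw [mul_assoc, mul_assoc, ← mul_assoc b, h]; group
    rw [mul_assoc, mul_assoc, ← mul_assoc _ _ b', this, sBar_mul_cancel]
  -- This entry of an upper triangular product is a nonzero diagonal entry times the entry `(i + 1,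
  -- i)` of `b'`, which therefore vanishes.
  have e2 := mem_Bplus.1 hc' i.succ i.castSucc i.castSucc_lt_succ
  rw [← e1, coe_mul', Matrix.mul_apply, sum_eq_two_levels i] at e2
  · rw [conj_sBar_apply, conj_sBar_apply, Equiv.swap_apply_left, Equiv.swap_apply_right,
      mem_Bminus.1 hd _ _ i.castSucc_lt_succ, zero_mul, zero_add] at e2
    have h0 := (mul_eq_zero.1 e2).resolve_left (Bminus_diag_ne_zero hd _)
    have := (Bminus N F).mul_mem hb (conj_mem_Bminus i hb' h0)
    simpa only [mul_assoc] using this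
  · intro k hk hk'
    rcases lt_or_gt_of_ne hk with hlt | hlt
    · rw [mem_Bminus.1 hb' _ _ hlt, mul_zero]
    · rw [conj_sBar_apply, Equiv.swap_apply_right, Equiv.swap_apply_of_ne_of_ne hk hk',
        mem_Bminus.1 hd _ _ hlt, zero_mul]

/-- The version for decorated flags. -/
theorem mul_sBar_mem_Uminus {w : G N F} (h1 : w * sBar N F i ∈ Bminus N F)
    (h2 : w ∈ doubleCoset (sBar N F i)⁻¹ (Uminus N F : Set (G N F)) (Uminus N F)) :
    w * sBar N F i ∈ Uminus N F := by
  obtain ⟨b, hb, b', hb', rfl⟩ := mem_doubleCoset.1 h2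
  rw [sBar_inv] at h1 ⊢
  have h : sBar N F i * b' * sBar N F i ∈ Bminus N F := by
    have := (Bminus N F).mul_mem ((Bminus N F).inv_mem (Uminus_le_Bminus hb)) h1
    simpa only [mul_assoc, inv_mul_cancel_left] using this
  -- Triangularity after conjugation kills the one critical entry of `b'`, so its conjugate is still
  -- unipotent.
  have h0 := mem_Bminus.1 h _ _ i.castSucc_lt_succ
  rw [conj_sBar_apply, Equiv.swap_apply_left, Equiv.swap_apply_right] at h0
  have := (Uminus N F).mul_mem hb (conj_mem_Uminus i hb' h0)
  simpa only [mul_assoc] using this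

/-- The intersection of two Bruhat cells, on the side of the upper triangular matrices. -/
theorem sBar_conj_mem_Bplus {b : G N F} (hb : b ∈ Bplus N F)
    (h : b * sBar N F i ∈ doubleCoset (sBar N F i) (Bminus N F : Set (G N F)) (Bplus N F)) :
    sBar N F i * b * sBar N F i ∈ Bplus N F := by
  obtain ⟨c, hc, c', hc', h⟩ := mem_doubleCoset.1 h
  have hd : c'⁻¹ ∈ Bplus N F := (Bplus N F).inv_mem hc'
  have e1 : b * (sBar N F i * c'⁻¹ * sBar N F i) = c := by
    rw [← mul_assoc, ← mul_assoc, h, mul_inv_cancel_right, mul_assoc, sBar_mul_self, mul_one]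
  -- Dually, this entry of a lower triangular product is the entry `(i, i + 1)` of `b` times a
  -- nonzero diagonal entry.
  have e2 := mem_Bminus.1 hc i.castSucc i.succ i.castSucc_lt_succ
  rw [← e1, coe_mul', Matrix.mul_apply, sum_eq_two_levels i] at e2
  · rw [conj_sBar_apply, conj_sBar_apply, Equiv.swap_apply_left, Equiv.swap_apply_right,
      mem_Bplus.1 hd _ _ i.castSucc_lt_succ, mul_zero, zero_add] at e2
    exact conj_mem_Bplus i hb ((mul_eq_zero.1 e2).resolve_right (Bplus_diag_ne_zero hd _))
  · intro k hk hk'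
    rcases lt_or_gt_of_ne hk with hlt | hlt
    · rw [mem_Bplus.1 hb _ _ hlt, zero_mul]
    · rw [conj_sBar_apply, Equiv.swap_apply_right, Equiv.swap_apply_of_ne_of_ne hk hk',
        mem_Bplus.1 hd _ _ hlt, mul_zero]

/-- The cell $B_+\bar s_iB_+$ is a union of cosets $R_i(q)B_+$. The parameter is chosen so that
$e_i(q)b$ has entry `0` at `(i, i + 1)` and can be moved past $\bar s_i$. -/
theorem exists_R_inv_mul_mem {g : G N F}
    (hg : g ∈ doubleCoset (sBar N F i) (Bplus N F : Set (G N F)) (Bplus N F)) :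
    ∃ q, (R i q)⁻¹ * g ∈ Bplus N F := by
  obtain ⟨b, hb, b', hb', rfl⟩ := mem_doubleCoset.1 hg
  have hne := Bplus_diag_ne_zero hb i.succ
  refine ⟨b.1 i.castSucc i.succ / b.1 i.succ i.succ, ?_⟩
  have h := conj_mem_Bplus i ((Bplus N F).mul_mem
    (e_mem_Bplus i (b.1 i.castSucc i.succ / b.1 i.succ i.succ)) hb) (by
      rw [e_mul_apply, if_pos rfl, div_mul_cancel₀ _ hne, CharTwo.add_self_eq_zero])
  rw [R_mul]
  have := (Bplus N F).mul_mem h hb'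
  simpa only [mul_assoc] using this

theorem R_inv_mul_R (q q' : F) : (R i q)⁻¹ * R i q' = eNeg i (q + q') := by
  rw [R_mul, R, ← mul_assoc (e i q), e_add, ← mul_assoc, conj_e]

/-- The quotient is $e_{-i}(q+q')$, which is upper triangular only if $q=q'$. -/
theorem R_inj {q q' : F} (h : (R i q)⁻¹ * R i q' ∈ Bplus N F) : q = q' := by
  rw [R_inv_mul_R] at h
  have := mem_Bplus.1 h _ _ i.castSucc_lt_succ
  rw [eNeg_apply, if_neg i.castSucc_lt_succ.ne', if_pos ⟨rfl, rfl⟩, zero_add] at this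
  exact CharTwo.add_eq_zero.1 this

theorem prodR_pos (w : Fin m → Fin N) (q : Fin m → F) (k : Fin m) :
    PosPlus (sBar N F (w k)) (prodR w q k.castSucc) (prodR w q k.succ) := by
  rw [PosPlus, prodR_succ, inv_mul_cancel_left]
  exact R_mem _ _

/-- A chain that starts at $B_+$ is parametrized one flag at a time: after translation by
$R_i(q)^{-1}$ the rest of the chain starts at $B_+$ again. -/
theorem exists_prodR (w : Fin m → Fin N) (x : Fin (m + 1) → G N F) (h0 : x 0 ∈ Bplus N F)
    (h : ∀ k : Fin m, PosPlus (sBar N F (w k)) (x k.castSucc) (x k.succ)) :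
    ∃ q : Fin m → F, ∀ k, (prodR w q k)⁻¹ * x k ∈ Bplus N F := by
  induction m with
  | zero =>
    refine ⟨fun _ => 0, fun k => ?_⟩
    obtain rfl : k = 0 := Fin.fin_one_eq_zero k
    rwa [prodR_zero, inv_one, one_mul]
  | succ m ih =>
    have h1 := left_mul_mem_doubleCoset (h 0) h0
    rw [show x 0 * ((x (Fin.castSucc 0))⁻¹ * x (Fin.succ 0)) = x (Fin.succ 0) from
      mul_inv_cancel_left _ _] at h1
    obtain ⟨q0, hq0⟩ := exists_R_inv_mul_mem _ h1
    obtain ⟨q, hq⟩ := ih (fun j => w j.succ) (fun k => (R (w 0) q0)⁻¹ * x k.succ) hq0 (fun k => by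
      have := h k.succ
      rw [PosPlus] at this ⊢
      simpa [mul_assoc] using this)
    refine ⟨Fin.cons q0 q, fun k => ?_⟩
    cases k using Fin.cases with
    | zero => rwa [prodR_zero, inv_one, one_mul]
    | succ k =>
      rw [prodR_cons, _root_.mul_inv_rev, mul_assoc]
      exact hq k

theorem prodR_inj {w : Fin m → Fin N} {q q' : Fin m → F}
    (h : ∀ k, (prodR w q k)⁻¹ * prodR w q' k ∈ Bplus N F) : q = q' := by
  induction m with
  | zero => exact Subsingleton.elim _ _
  | succ m ih =>
    have h0 : q 0 = q' 0 := by
      have := h (Fin.succ 0)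
      rw [prodR_cons, prodR_cons, prodR_zero, prodR_zero, mul_one, mul_one] at this
      exact R_inj _ this
    have h1 := ih (w := fun j => w j.succ) (q := fun j => q j.succ) (q' := fun j => q' j.succ)
      fun k => by
        have := h k.succ
        rwa [prodR_cons, prodR_cons, h0, _root_.mul_inv_rev, mul_assoc, inv_mul_cancel_left] at this
    funext k
    cases k using Fin.cases with
    | zero => exact h0
    | succ k => exact congrFun h1 k

end DBS


/-! ### Normal forms of orbits and the left reflection -/

namespace DBS

open Matrix DoubleCoset

variable {N : ℕ} {F : Type*} [Field F] {m : ℕ}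

/-- Representatives of `point w q`. -/
def pointChains (w : Fin m → Fin N) (q : Fin m → F) : Chains N F m 0 := ⟨prodR w q, fun _ => 1⟩

theorem posMixed_one_one {x : G N F} : PosMixed 1 1 x ↔
    x ∈ doubleCoset 1 (Bminus N F : Set (G N F)) (Bplus N F) := by rw [PosMixed, one_mul]

theorem posMixed_congr {s y y' x x' g : G N F} (hx : (g * x)⁻¹ * x' ∈ Bplus N F)
    (hy : y' * (y * g⁻¹)⁻¹ ∈ Bminus N F) (h : PosMixed s y x) : PosMixed s y' x' := by
  have := mul_mem_doubleCoset h hy hx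
  rw [PosMixed]
  convert this using 1
  group

variable [CharP F 2]

theorem point_mem {w : Fin m → Fin N} {q : Fin m → F} (h : PosMixed 1 1 (prodR w q (Fin.last m))) :
    point w q ∈ Conf w ![] := by
  refine ⟨pointChains w q, rfl, fun k => prodR_pos w q k, fun j => j.elim0, ?_, h⟩
  change PosMixed 1 1 (prodR w q 0)
  rw [prodR_zero, posMixed_one_one]
  have := mul_base_mem_doubleCoset (K := Bplus N F) (s := 1) (Bminus N F).one_mem
  rwa [mul_one] at this

/-- General position allows the first pair, with its decoration, to be moved to $(U_-,B_+)$; the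
bottom chain then has coordinates. -/
theorem exists_eq_point {w : Fin m → Fin N} {o : Orbits N F m 0} (ho : o ∈ Conf w ![]) :
    ∃ q, o = point w q ∧ PosMixed 1 1 (prodR w q (Fin.last m)) := by
  obtain ⟨c, rfl, hx, -, h0, hl⟩ := ho
  obtain ⟨b, hb, b', hb', h⟩ := mem_doubleCoset.1 h0
  obtain ⟨t, ht, -, -, hu, -⟩ := exists_diag hb
  rw [mul_one] at h
  -- The diagonal part of `b` is shifted to the other factor, so that the decoration, not only the
  -- flag, becomes standard.
  set g := t * b' * (c.x 0)⁻¹ with hg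
  have hy : c.y 0 * g⁻¹ = b * t⁻¹ := by
    rw [← mul_inv_eq_iff_eq_mul.2 (rfl : b * b' = b * b'), ← h, hg]; group
  have hx0 : g * c.x 0 = t * b' := by rw [hg]; group
  obtain ⟨q, hq⟩ := exists_prodR w (fun k => g * c.x k)
    (by rw [hx0]; exact (Bplus N F).mul_mem ht hb') (fun k => by
      have := hx k
      rw [PosPlus] at this ⊢
      simpa [mul_assoc] using this)
  have hs : SameOrbit c (pointChains w q) := by
    refine ⟨g, fun k => ?_, fun j => ?_, ?_⟩
    · have := (Bplus N F).inv_mem (hq k)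
      rwa [_root_.mul_inv_rev, inv_inv] at this
    · obtain rfl : j = 0 := Fin.fin_one_eq_zero j
      rw [hy]
      exact (Bminus N F).mul_mem (one_mem _) ((Bminus N F).inv_mem (Uminus_le_Bminus hu))
    · change _ * (c.y 0 * g⁻¹)⁻¹ ∈ _
      rw [hy]
      exact (Uminus N F).mul_mem (one_mem _) ((Uminus N F).inv_mem hu)
  exact ⟨q, Quotient.sound hs, posMixed_congr (hs.choose_spec.1 _) (hs.choose_spec.2.1 _) hl⟩

/-- An element relating two normal forms fixes $B_+$ and $U_-$, hence is `1`. -/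
theorem point_injective (w : Fin m → Fin N) : Function.Injective (point (F := F) w) := by
  intro q q' h
  obtain ⟨g, hx, -, hy⟩ := Quotient.exact h
  have h1 : g ∈ Bplus N F := by
    have := hx 0
    simp only [Fin.val_zero, List.take_zero, List.prod_nil, mul_one] at this
    simpa using this
  have h2 : g ∈ Uminus N F := by simpa using hy
  obtain rfl := eq_one_of_mem h1 h2
  refine prodR_inj (w := w) fun k => ?_
  have := hx k
  rwa [one_mul] at this

section Reflections

variable {l : ℕ} (i : Fin N) (β : Fin l → Fin N)

/-- Representatives of the left reflection of `point (wordLeft i β) q`. -/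
def leftChains (q : Fin (l + 1) → F) : Chains N F l 1 :=
  ⟨fun k => prodR (CE.wordLeft i β) q k.succ, Fin.cons (α := fun _ => G N F) (sBar N F i) fun _ => 1⟩

theorem prodR_wordLeft (q : Fin (l + 1) → F) (k : Fin (l + 1)) :
    prodR (CE.wordLeft i β) q k.succ = R i (q 0) * prodR β (fun j => q j.succ) k :=
  prodR_cons _ _ _

/-- In normal form the added flag is in position $s_i$ with both $B_+$ and $B_-$; the intersection
of the two cells leaves only $B_-\bar s_i$. -/
theorem leftReflects_point_iff (q : Fin (l + 1) → F) (d : Orbits N F l 1) :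
    LeftReflects i (point (CE.wordLeft i β) q) d ↔ d = ⟦leftChains i β q⟧ := by
  constructor
  · rintro ⟨c, z, hc, h1, h2, rfl⟩
    obtain ⟨g, hx, -, hy⟩ := Quotient.exact hc
    have hx0 : g⁻¹ * c.x 0 ∈ Bplus N F := by
      have := hx 0
      simpa using this
    have hy0 : c.y 0 * g ∈ Uminus N F := by
      have : c.y 0 * (1 * g⁻¹)⁻¹ ∈ Uminus N F := hy
      simpa using this
    have e1 : z * g ∈ doubleCoset (sBar N F i) (Bminus N F : Set (G N F)) (Bplus N F) := by
      have := right_mul_mem_doubleCoset h1 ((Bplus N F).inv_mem hx0)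
      convert this using 1
      group
    have e2 : z * g ∈ doubleCoset (sBar N F i) (Bminus N F : Set (G N F)) (Bminus N F) := by
      have := right_mul_mem_doubleCoset h2 (Uminus_le_Bminus hy0)
      convert this using 1
      group
    have e3 := mul_sBar_mem_Bminus i e2 e1
    have hs : SameOrbit (leftChains i β q)
        ⟨fun k => c.x k.succ, Fin.cons (α := fun _ => G N F) z c.y⟩ := by
      refine ⟨g, fun k => hx k.succ, fun j => ?_, hy⟩
      cases j using Fin.cases with
      | zero =>
        change z * (sBar N F i * g⁻¹)⁻¹ ∈ _
        rwa [_root_.mul_inv_rev, inv_inv, sBar_inv, ← mul_assoc]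
      | succ j =>
        obtain rfl : j = 0 := Fin.fin_one_eq_zero j
        exact Uminus_le_Bminus hy
    exact (Quotient.sound hs).symm
  · rintro rfl
    refine ⟨pointChains _ q, sBar N F i, rfl, ?_, ?_, rfl⟩
    · change _ * prodR (CE.wordLeft i β) q 0 ∈ doubleCoset (sBar N F i) _ _
      rw [prodR_zero]
      exact base_mul_mem_doubleCoset (one_mem _)
    · change sBar N F i * (1 : G N F)⁻¹ ∈ doubleCoset (sBar N F i) _ _
      rw [inv_one]
      exact base_mul_mem_doubleCoset (one_mem _)

theorem leftChains_mem {q : Fin (l + 1) → F}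
    (h : PosMixed 1 1 (prodR (CE.wordLeft i β) q (Fin.last (l + 1)))) :
    ⟦leftChains i β q⟧ ∈ Conf β ![i] := by
  refine ⟨leftChains i β q, rfl, fun k => prodR_pos (CE.wordLeft i β) q k.succ, fun j => ?_, ?_, h⟩
  · obtain rfl : j = 0 := Fin.fin_one_eq_zero j
    change sBar N F i * (1 : G N F)⁻¹ ∈ doubleCoset (sBar N F i) _ _
    rw [inv_one]
    exact base_mul_mem_doubleCoset (one_mem _)
  · change sBar N F i * prodR (CE.wordLeft i β) q (Fin.succ 0) ∈ _
    rw [prodR_wordLeft, prodR_zero, mul_one, R, ← mul_assoc, conj_e]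
    have := mul_base_mem_doubleCoset (K := Bplus N F) (s := 1)
      (Uminus_le_Bminus (eNeg_mem_Uminus i (q 0)))
    rwa [mul_one] at this

/-- The relating element `g` fixes $U_-$ and $B_-\bar s_i$ and takes $R_i(q_0)B_+$ to
$R_i(q'_0)B_+$. Hence $R_i(q'_0)^{-1}gR_i(q_0)$ lies in both $U_-$ and $B_+$ and is `1`. -/
theorem leftChains_injective {q q' : Fin (l + 1) → F}
    (h : (⟦leftChains i β q⟧ : Orbits N F l 1) = ⟦leftChains i β q'⟧) : q = q' := by
  obtain ⟨g, hx, hy, hy1⟩ := Quotient.exact h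
  have h1 : g ∈ Uminus N F := by
    have : (1 : G N F) * (1 * g⁻¹)⁻¹ ∈ Uminus N F := hy1
    simpa using this
  have h2 : sBar N F i * g * sBar N F i ∈ Bminus N F := by
    have : sBar N F i * (sBar N F i * g⁻¹)⁻¹ ∈ Bminus N F := hy 0
    rwa [_root_.mul_inv_rev, inv_inv, sBar_inv, ← mul_assoc] at this
  have h0 := mem_Bminus.1 h2 _ _ i.castSucc_lt_succ
  rw [conj_sBar_apply, Equiv.swap_apply_left, Equiv.swap_apply_right] at h0
  have h3 := conj_mem_Uminus i h1 h0
  have h4 : (R i (q' 0))⁻¹ * g * R i (q 0) = 1 := by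
    refine eq_one_of_mem ?_ ?_
    · have : (g * prodR (CE.wordLeft i β) q (Fin.succ 0))⁻¹ *
          prodR (CE.wordLeft i β) q' (Fin.succ 0) ∈ Bplus N F := hx 0
      rw [prodR_wordLeft, prodR_wordLeft, prodR_zero, prodR_zero, mul_one, mul_one] at this
      convert (Bplus N F).inv_mem this using 1
      group
    · have := (Uminus N F).mul_mem ((Uminus N F).mul_mem (eNeg_mem_Uminus i (q' 0)) h3)
        (eNeg_mem_Uminus i (q 0))
      rw [← conj_e, ← conj_e] at this
      convert this using 1
      rw [mul_assoc, R_mul, R]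
      simp only [mul_assoc, sBar_mul_cancel]
  have h5 : g = R i (q' 0) * (R i (q 0))⁻¹ := by
    rw [eq_mul_inv_iff_mul_eq, ← mul_one (R i (q' 0)), ← h4]; group
  -- The factors $\bar s_i$ cancel in $R_i(q'_0)R_i(q_0)^{-1}$, which leaves an element of $B_+$.
  have h6 : g = 1 := by
    refine eq_one_of_mem ?_ h1
    rw [h5, R, R, _root_.mul_inv_rev, mul_assoc, ← mul_assoc (sBar N F i), mul_inv_cancel, one_mul]
    exact (Bplus N F).mul_mem (e_mem_Bplus _ _) ((Bplus N F).inv_mem (e_mem_Bplus _ _))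
  refine prodR_inj (w := CE.wordLeft i β) fun k => ?_
  cases k using Fin.cases with
  | zero => rw [prodR_zero, prodR_zero, inv_one, one_mul]; exact one_mem _
  | succ k =>
    have := hx k
    rwa [h6, one_mul] at this

/-- This inverts the left reflection. The top chain is moved to $B_-\bar s_i$, $U_-$; the remaining
freedom brings the first bottom flag to some $R_i(p)B_+$, so that $B_+$ can be put in front of the
bottom chain. -/
theorem exists_eq_leftChains {o : Orbits N F l 1} (ho : o ∈ Conf β ![i]) :
    ∃ q, o = ⟦leftChains i β q⟧ ∧
      PosMixed 1 1 (prodR (CE.wordLeft i β) q (Fin.last (l + 1))) := by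
  obtain ⟨c, rfl, hx, hy, h0, hl⟩ := ho
  obtain ⟨b, hb, b', hb', h⟩ := mem_doubleCoset.1 (hy 0)
  change c.y 0 * (c.y 1)⁻¹ = b * sBar N F i * b' at h
  obtain ⟨t, ht, ht', hdiag, -, hu⟩ := exists_diag hb'
  set u := t⁻¹ * b' with hu'
  obtain ⟨a, ha, a', ha', h0'⟩ := mem_doubleCoset.1 h0
  rw [mul_one] at h0'
  have hst : sBar N F i * t * sBar N F i ∈ Bminus N F :=
    conj_mem_Bminus i ht' (hdiag _ _ i.castSucc_lt_succ.ne')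
  -- The diagonal part of `b'` is carried to the left of $\bar s_i$, where it is absorbed by an
  -- undecorated flag.
  set b₁ := b * (sBar N F i * t * sBar N F i) with hb₁'
  have hb₁ : b₁ ∈ Bminus N F := (Bminus N F).mul_mem hb hst
  have hy0 : c.y 0 = b₁ * sBar N F i * (u * c.y 1) := by
    rw [← inv_mul_cancel_right (c.y 0) (c.y 1), h, hb₁', hu']
    simp only [mul_assoc, sBar_mul_cancel, mul_inv_cancel_left]
  have hx0 : u * c.y 1 * c.x 0 = sBar N F i * (b₁⁻¹ * a) * a' := by
    have : c.y 0 * c.x 0 = a * a' := h0'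
    rw [hy0] at this
    rw [mul_assoc _ _ a', mul_assoc _ _ a', ← this]
    simp only [mul_assoc, inv_mul_cancel_left, sBar_mul_cancel]
  obtain ⟨t₁, ht₁, -, -, hv, -⟩ := exists_diag ((Bminus N F).mul_mem ((Bminus N F).inv_mem hb₁) ha)
  set v := b₁⁻¹ * a * t₁⁻¹ with hv'
  -- Multiplying by $e_{-i}(p)$ clears the entry `(i + 1, i)`, so that conjugation by $\bar s_i$
  -- stays in $U_-$.
  set p := v.1 i.succ i.castSucc with hp
  have hv₁ : v * eNeg i p ∈ Uminus N F := (Uminus N F).mul_mem hv (eNeg_mem_Uminus _ _)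
  have hv₁0 : (v * eNeg i p).1 i.succ i.castSucc = 0 := by
    rw [mul_eNeg_apply, if_pos rfl, (mem_Uminus.1 hv).2, mul_one, ← hp, CharTwo.add_self_eq_zero]
  set g₂ := sBar N F i * (v * eNeg i p) * sBar N F i with hg₂
  have hg₂U : g₂ ∈ Uminus N F := conj_mem_Uminus i hv₁ hv₁0
  set g := g₂⁻¹ * (u * c.y 1) with hg
  have hgx : (R i p)⁻¹ * (g * c.x 0) ∈ Bplus N F := by
    have e1 : u * c.y 1 * c.x 0 = g₂ * R i p * (t₁ * a') := by
      rw [hx0, hg₂, R]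
      have : b₁⁻¹ * a = v * t₁ := by rw [hv']; group
      rw [this, ← mul_one v, ← e_zero (F := F) i]
      -- In characteristic two $\bar s_ie_i(p)\bar s_i=e_{-i}(p)$ is its own inverse.
      have h2 : eNeg i p * sBar N F i * e i p * sBar N F i = 1 := by
        rw [mul_assoc, mul_assoc, ← mul_assoc (sBar N F i), conj_e, ← conj_e]
        simp only [mul_assoc, sBar_mul_cancel]
        rw [← mul_assoc (e i p), e_add, CharTwo.add_self_eq_zero, e_zero, one_mul, sBar_mul_self]
      rw [e_zero, mul_one]
      have h3 : sBar N F i * (v * eNeg i p) * sBar N F i * (e i p * sBar N F i) * (t₁ * a') =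
          sBar N F i * v * (eNeg i p * sBar N F i * e i p * sBar N F i) * (t₁ * a') := by
        simp only [mul_assoc]
      rw [h3, h2]
      simp only [mul_assoc, mul_one]
    have e2 : (R i p)⁻¹ * (g * c.x 0) = t₁ * a' := by
      rw [hg, mul_assoc, e1]; group
    rw [e2]
    exact (Bplus N F).mul_mem ht₁ ha'
  obtain ⟨q, hq⟩ := exists_prodR (CE.wordLeft i β)
    (Fin.cons (α := fun _ => G N F) 1 fun k => g * c.x k) (one_mem _) (fun k => by
      cases k using Fin.cases with
      | zero =>
        change (1 : G N F)⁻¹ * (g * c.x 0) ∈ doubleCoset (sBar N F i) _ _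
        rw [inv_one, one_mul]
        have := right_mul_mem_doubleCoset (R_mem i p) hgx
        rwa [mul_inv_cancel_left] at this
      | succ k =>
        have : (c.x k.castSucc)⁻¹ * c.x k.succ ∈ doubleCoset (sBar N F (β k)) _ _ := hx k
        change (g * c.x k.castSucc)⁻¹ * (g * c.x k.succ) ∈ doubleCoset (sBar N F (β k)) _ _
        simpa [mul_assoc] using this)
  have hy1 : (1 : G N F) * (c.y 1 * g⁻¹)⁻¹ ∈ Uminus N F := by
    have : (1 : G N F) * (c.y 1 * g⁻¹)⁻¹ = g₂⁻¹ * u := by rw [hg]; group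
    rw [this]
    exact (Uminus N F).mul_mem ((Uminus N F).inv_mem hg₂U) hu
  have hs : SameOrbit c (leftChains i β q) := by
    refine ⟨g, fun k => ?_, fun j => ?_, hy1⟩
    · have := (Bplus N F).inv_mem (hq k.succ)
      rwa [_root_.mul_inv_rev, inv_inv] at this
    · cases j using Fin.cases with
      | zero =>
        change sBar N F i * (c.y 0 * g⁻¹)⁻¹ ∈ _
        have e1 : sBar N F i * g₂ = v * eNeg i p * sBar N F i := by
          rw [hg₂, mul_assoc, sBar_mul_cancel]
        have e2 : c.y 0 * g⁻¹ = b₁ * (v * eNeg i p) * sBar N F i := by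
          rw [hy0, hg, mul_assoc b₁ (v * _), ← e1]
          group
        rw [e2, _root_.mul_inv_rev, mul_inv_cancel_left]
        exact (Bminus N F).inv_mem ((Bminus N F).mul_mem hb₁ (Uminus_le_Bminus hv₁))
      | succ j =>
        obtain rfl : j = 0 := Fin.fin_one_eq_zero j
        exact Uminus_le_Bminus hy1
  exact ⟨q, Quotient.sound hs, posMixed_congr (hs.choose_spec.1 (Fin.last l))
    (hs.choose_spec.2.1 (Fin.last 1)) hl⟩

end Reflections

end DBS


/-! ### The right reflection -/

namespace DBS

open Matrix DoubleCoset

variable {N : ℕ} {F : Type*} [Field F] [CharP F 2] {l : ℕ} (i : Fin N) (β : Fin l → Fin N)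

theorem prodR_wordRight_castSucc (q : Fin l → F) (a : F) (k : Fin (l + 1)) :
    prodR (CE.wordRight β i) (Fin.snoc (α := fun _ => F) q a) k.castSucc = prodR β q k := by
  induction k using Fin.induction with
  | zero => rw [Fin.castSucc_zero, prodR_zero, prodR_zero]
  | succ k ih =>
    rw [← Fin.succ_castSucc, prodR_succ, ih, prodR_succ, CE.wordRight, Fin.snoc_castSucc,
      Fin.snoc_castSucc]

theorem prodR_wordRight_last (q : Fin l → F) (a : F) :
    prodR (CE.wordRight β i) (Fin.snoc (α := fun _ => F) q a) (Fin.last (l + 1)) =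
      prodR β q (Fin.last l) * R i a := by
  rw [← Fin.succ_last, prodR_succ, prodR_wordRight_castSucc, CE.wordRight, Fin.snoc_last,
    Fin.snoc_last]

/-- Representatives of the right reflection, before they are brought to the standard form. -/
def rightChains (q : Fin (l + 1) → F) (L : G N F) : Chains N F (l + 1) 0 :=
  ⟨Fin.snoc (α := fun _ => G N F) (leftChains i β q).x (L * sBar N F i), fun _ => sBar N F i⟩

/-- The last bottom flag is $LB_+$. The flag $L\bar s_iB_+$ is in position $s_i$ with it and with
$B_-$, and by the intersection of the two cells no other is. Compatibility singles out the
decoration $U_-\bar s_i$ in the same way. -/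
theorem rightReflects_leftChains_iff {q : Fin (l + 1) → F} {L U : G N F} (hL : L ∈ Bminus N F)
    (hU : U ∈ Bplus N F) (h : prodR (CE.wordLeft i β) q (Fin.last (l + 1)) = L * U)
    (d : Orbits N F (l + 1) 0) :
    RightReflects i ⟦leftChains i β q⟧ d ↔ d = ⟦rightChains i β q L⟧ := by
  constructor
  · rintro ⟨c, z, hc, h1, h2, h3, rfl⟩
    obtain ⟨g, hx, hy, hy1⟩ := Quotient.exact hc
    have hyU : c.y 1 * g ∈ Uminus N F := by
      have : c.y 1 * (1 * g⁻¹)⁻¹ ∈ Uminus N F := hy1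
      simpa using this
    have hy0 : c.y 0 * g * sBar N F i ∈ Bminus N F := by
      have : c.y 0 * (sBar N F i * g⁻¹)⁻¹ ∈ Bminus N F := hy 0
      rwa [_root_.mul_inv_rev, inv_inv, sBar_inv, ← mul_assoc] at this
    have hyc : c.y 0 * g ∈ doubleCoset (sBar N F i)⁻¹ (Uminus N F : Set (G N F)) (Uminus N F) := by
      have h1 : c.y 0 * (c.y 1)⁻¹ ∈ doubleCoset (sBar N F i)⁻¹ _ _ := h1
      have := right_mul_mem_doubleCoset h1 hyU
      convert this using 1
      group
    have hy0U := mul_sBar_mem_Uminus i hy0 hyc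
    have hxl : (g * (L * U))⁻¹ * c.x (Fin.last l) ∈ Bplus N F := by
      rw [← h]
      exact hx (Fin.last l)
    have hz : (L * U)⁻¹ * (g⁻¹ * z) ∈
        doubleCoset (sBar N F i) (Bplus N F : Set (G N F)) (Bplus N F) := by
      have := left_mul_mem_doubleCoset h2 hxl
      convert this using 1
      group
    obtain ⟨b, hb, b', hb', hbb'⟩ := mem_doubleCoset.1 hz
    have hz' : g⁻¹ * z ∈ doubleCoset (sBar N F i) (Bminus N F : Set (G N F)) (Bplus N F) := by
      have h3 : c.y 1 * z ∈ doubleCoset (sBar N F i) _ _ := h3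
      have := left_mul_mem_doubleCoset h3 ((Bminus N F).inv_mem (Uminus_le_Bminus hyU))
      convert this using 1
      group
    have hgz : g⁻¹ * z = L * (U * b * sBar N F i * b') := by
      rw [inv_mul_eq_iff_eq_mul] at hbb'
      rw [hbb']
      simp only [mul_assoc]
    have hUb : U * b * sBar N F i ∈
        doubleCoset (sBar N F i) (Bminus N F : Set (G N F)) (Bplus N F) := by
      have := mul_mem_doubleCoset hz' ((Bminus N F).inv_mem hL) ((Bplus N F).inv_mem hb')
      rw [hgz] at this
      convert this using 1
      group
    have hc := sBar_conj_mem_Bplus i ((Bplus N F).mul_mem hU hb) hUb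
    have hs : SameOrbit (rightChains i β q L)
        ⟨Fin.snoc (α := fun _ => G N F) c.x z, fun j => c.y j.castSucc⟩ := by
      have hyU' : c.y 0 * (sBar N F i * g⁻¹)⁻¹ ∈ Uminus N F := by
        rwa [_root_.mul_inv_rev, inv_inv, sBar_inv, ← mul_assoc]
      refine ⟨g, fun k => ?_, fun j => ?_, hyU'⟩
      · cases k using Fin.lastCases with
        | last =>
          rw [rightChains]
          simp only [Fin.snoc_last]
          have e1 : (g * (L * sBar N F i))⁻¹ * z = sBar N F i * (U * b) * sBar N F i * b' := by
            rw [_root_.mul_inv_rev, mul_assoc, hgz, _root_.mul_inv_rev, sBar_inv]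
            simp only [mul_assoc, inv_mul_cancel_left]
          rw [e1]
          exact (Bplus N F).mul_mem hc hb'
        | cast k =>
          rw [rightChains]
          simp only [Fin.snoc_castSucc]
          exact hx k
      · obtain rfl : j = 0 := Fin.fin_one_eq_zero j
        exact Uminus_le_Bminus hyU'
    exact (Quotient.sound hs).symm
  · rintro rfl
    have hy : (fun j : Fin 1 => (leftChains i β q).y j.castSucc) = fun _ => sBar N F i :=
      funext fun j => by rw [Fin.fin_one_eq_zero j]; rfl
    refine ⟨leftChains i β q, L * sBar N F i, rfl, ?_, ?_, ?_, by rw [hy]; rfl⟩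
    · change sBar N F i * (1 : G N F)⁻¹ ∈ doubleCoset (sBar N F i)⁻¹ _ _
      rw [inv_one, sBar_inv]
      exact base_mul_mem_doubleCoset (one_mem _)
    · change (prodR (CE.wordLeft i β) q (Fin.last (l + 1)))⁻¹ * (L * sBar N F i) ∈
        doubleCoset (sBar N F i) _ _
      rw [h, _root_.mul_inv_rev, mul_assoc, inv_mul_cancel_left]
      exact mul_base_mem_doubleCoset ((Bplus N F).inv_mem hU)
    · change (1 : G N F) * (L * sBar N F i) ∈ doubleCoset (sBar N F i) _ _
      rw [one_mul]
      exact mul_base_mem_doubleCoset hL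

/-- Translation by $R_i(q_0)^{-1}$ restores $B_+$ and $U_-$. The new coordinate $q$ is the one for
which $Ue_i(q)$ has entry `0` at `(i, i + 1)`, so that its conjugate by $\bar s_i$ stays in $B_+$.
-/
theorem rightChains_eq_point {q : Fin (l + 1) → F} {L U : G N F}
    (hU : U ∈ Bplus N F) (h : prodR (CE.wordLeft i β) q (Fin.last (l + 1)) = L * U) :
    (⟦rightChains i β q L⟧ : Orbits N F (l + 1) 0) = point (CE.wordRight β i)
      (Fin.snoc (α := fun _ => F) (fun j => q j.succ)
        (U.1 i.castSucc i.succ / U.1 i.castSucc i.castSucc)) := by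
  have hy : (1 : G N F) * (sBar N F i * ((R i (q 0))⁻¹)⁻¹)⁻¹ ∈ Uminus N F := by
    rw [inv_inv, one_mul, _root_.mul_inv_rev, R_mul, sBar_inv, ← mul_assoc, conj_e]
    exact eNeg_mem_Uminus _ _
  have hs : SameOrbit (rightChains i β q L) (pointChains (CE.wordRight β i)
      (Fin.snoc (α := fun _ => F) (fun j => q j.succ)
        (U.1 i.castSucc i.succ / U.1 i.castSucc i.castSucc))) := by
    refine ⟨(R i (q 0))⁻¹, fun k => ?_, fun j => Uminus_le_Bminus hy, hy⟩
    cases k using Fin.lastCases with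
    | last =>
      rw [rightChains, pointChains]
      simp only [Fin.snoc_last]
      rw [prodR_wordRight_last]
      have e1 : prodR β (fun j => q j.succ) (Fin.last l) = (R i (q 0))⁻¹ * (L * U) := by
        rw [← h, ← Fin.succ_last, prodR_wordLeft, inv_mul_cancel_left]
      have h0 := conj_mem_Bplus i ((Bplus N F).mul_mem hU
        (e_mem_Bplus i (U.1 i.castSucc i.succ / U.1 i.castSucc i.castSucc))) (by
          rw [mul_e_apply, if_pos rfl, div_mul_cancel₀ _ (Bplus_diag_ne_zero hU _),
            CharTwo.add_self_eq_zero])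
      convert h0 using 1
      rw [e1]
      simp only [_root_.mul_inv_rev, inv_inv, sBar_inv, mul_assoc, inv_mul_cancel_left,
        mul_inv_cancel_left]
      rfl
    | cast k =>
      rw [rightChains, pointChains]
      simp only [Fin.snoc_castSucc]
      change ((R i (q 0))⁻¹ * prodR (CE.wordLeft i β) q k.succ)⁻¹ * _ ∈ _
      rw [prodR_wordRight_castSucc, prodR_wordLeft, inv_mul_cancel_left, inv_mul_cancel]
      exact one_mem _
  exact Quotient.sound hs

end DBS


/-! ### Gaussian elimination over a field -/

namespace CE

section FieldMatrices

variable {N : ℕ} {F : Type*} [Field F] [CharP F 2]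

/-- Elimination of a product of a lower and an upper triangular matrix. -/
theorem esteps_mul {X : ℕ → ℕ → F} {L U : Fin (N + 1) → Fin (N + 1) → F} {t : ℕ → F}
    (hX : ∀ r c : Fin (N + 1), X r c = ∑ j, L r j * U j c)
    (hL : ∀ r c, r < c → L r c = 0) (hU : ∀ r c, c < r → U r c = 0)
    (ht : ∀ j : Fin (N + 1), t j * (L j j * U j j) = 1) (k : ℕ) (hk : k ≤ N + 1)
    (r c : Fin (N + 1)) :
    esteps t 0 X k r c = ∑ j : Fin (N + 1), if k ≤ j.val then L r j * U j c else 0 := by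
  induction k generalizing r c with
  | zero => simpa [esteps] using hX r c
  | succ k ih =>
    have ih := ih (by omega)
    set kk : Fin (N + 1) := ⟨k, hk⟩ with hkk
    -- Triangularity leaves a single term of the sum in the pivot column, and likewise in the pivot
    -- row.
    have h1 : ∀ r : Fin (N + 1), esteps t 0 X k r kk = L r kk * U kk kk := fun r => by
      rw [ih, Fintype.sum_eq_single kk]
      · rw [if_pos le_rfl]
      · intro j hj
        split_ifs with h
        · rw [hU _ _ (lt_of_le_of_ne (Fin.le_def.2 h) hj.symm), mul_zero]
        · rfl
    have h2 : ∀ c : Fin (N + 1), esteps t 0 X k kk c = L kk kk * U kk c := fun c => by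
      rw [ih, Fintype.sum_eq_single kk]
      · rw [if_pos le_rfl]
      · intro j hj
        split_ifs with h
        · rw [hL _ _ (lt_of_le_of_ne (Fin.le_def.2 h) hj.symm), zero_mul]
        · rfl
    have h3 : ∀ j : Fin (N + 1), (if k ≤ j.val then L r j * U j c else 0) =
        (if k + 1 ≤ j.val then L r j * U j c else 0) +
          if j = kk then L r kk * U kk c else 0 := by
      intro j
      by_cases hj : j = kk
      · rw [hj, if_pos le_rfl, if_neg (by simp [hkk]), if_pos rfl, zero_add]
      · have : j.val ≠ k := fun h => hj (Fin.ext h)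
        rw [if_neg hj, add_zero]
        congr 1
        exact propext ⟨fun h => by omega, fun h => by omega⟩
    rw [esteps, estep, Nat.zero_add, ih, show k = kk.val from rfl, h1, h2,
      Finset.sum_congr rfl fun j _ => h3 j, Finset.sum_add_distrib, Finset.sum_ite_eq',
      if_pos (Finset.mem_univ _)]
    have h4 := ht kk
    linear_combination L r kk * U kk c * h4 + L r kk * U kk c * CharTwo.two_eq_zero (R := F)

/-- An invertible pivot clears its row and column, and later steps do not refill them. -/
theorem esteps_of_lt {X : ℕ → ℕ → F} {t : ℕ → F} {n : ℕ}
    (ht : ∀ j < n, t j * pivot t X j = 1) (k : ℕ) (hk : k ≤ n) (r c : ℕ) (h : r < k ∨ c < k) :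
    esteps t 0 X k r c = 0 := by
  induction k generalizing r c with
  | zero => omega
  | succ k ih =>
    have ih := ih (by omega)
    have h2 := CharTwo.two_eq_zero (R := F)
    have hp : t k * esteps t 0 X k k k = 1 := ht k (by omega)
    rw [esteps, estep, Nat.zero_add]
    by_cases h1 : r < k ∨ c < k
    · rw [ih r c h1]
      rcases h1 with h1 | h1
      · rw [ih r k (.inl h1)]; ring
      · rw [ih k c (.inr h1)]; ring
    · obtain h1 | h1 : r = k ∨ c = k := by omega
      · rw [h1]
        linear_combination esteps t 0 X k k c * hp + esteps t 0 X k k c * h2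
      · rw [h1]
        linear_combination esteps t 0 X k r k * hp + esteps t 0 X k r k * h2

/-- Each step has added a term of rank one, which is added back here; no pivot needs to be
invertible. -/
theorem eq_sum_esteps (X : ℕ → ℕ → F) (t : ℕ → F) (k r c : ℕ) : X r c = esteps t 0 X k r c +
    ∑ j ∈ Finset.range k, esteps t 0 X j r j * t j * esteps t 0 X j j c := by
  induction k with
  | zero => simp [esteps]
  | succ k ih =>
    rw [Finset.sum_range_succ, esteps, estep, Nat.zero_add]
    linear_combination ih - esteps t 0 X k r k * t k * esteps t 0 X k k c *
      CharTwo.two_eq_zero (R := F)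

end FieldMatrices

end CE

/-! ### Triangular factorization from the elimination -/

namespace DBS

open Matrix DoubleCoset

variable {N : ℕ} {F : Type*} [Field F] [CharP F 2]

theorem apply_eq_wordMat {m : ℕ} (w : Fin m → Fin N) (q : Fin m → F) (r c : Fin (N + 1)) :
    (prodR w q (Fin.last m)).1 r c = CE.wordMat w q r c := by
  rw [← CE.prod_Z_eq_wordMat, prodR, Fin.partialProd, Fin.val_last, List.take_of_length_le (by simp),
    coe_prod, show (List.ofFn fun k => CE.Z (w k) (q k)) = (List.ofFn fun k => R (w k) (q k)).map
      (fun g : G N F => g.1) by simp only [List.map_ofFn, Function.comp_def, R_apply]]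
  rfl

/-- A matrix is a product of a lower and an upper triangular one if all pivots are invertible; the
upper triangular factor is read off from the elimination. -/
theorem exists_factorization {X : G N F} {M : ℕ → ℕ → F} {t : ℕ → F}
    (hM : ∀ r c : Fin (N + 1), X.1 r c = M r c)
    (ht : ∀ j < N + 1, t j * CE.pivot t M j = 1) : ∃ L U : G N F, L ∈ Bminus N F ∧ U ∈ Bplus N F ∧
      X = L * U ∧ ∀ r c : Fin (N + 1), U.1 r c = CE.esteps t 0 M r r c := by
  -- The columns are scaled by the inverse pivots, so `L₀` has diagonal `1` and the pivots stay on
  -- the diagonal of `U₀`.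
  let L₀ : Matrix (Fin (N + 1)) (Fin (N + 1)) F :=
    Matrix.of fun r c => CE.esteps t 0 M c r c * t c
  let U₀ : Matrix (Fin (N + 1)) (Fin (N + 1)) F := Matrix.of fun r c => CE.esteps t 0 M r r c
  have hz := CE.esteps_of_lt ht
  have hL : ∀ r c, r < c → L₀ r c = 0 := fun r c h => by
    change CE.esteps t 0 M c r c * t c = 0
    rw [hz _ (by omega) _ _ (.inl h), zero_mul]
  have hU : ∀ r c, c < r → U₀ r c = 0 := fun r c h => hz _ (by omega) _ _ (.inr h)
  have hdL : L₀.det = 1 := by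
    rw [Matrix.det_of_isLowerTriangular _ fun r c h => hL r c h]
    refine Finset.prod_eq_one fun r _ => ?_
    have := ht r r.2
    rwa [mul_comm] at this
  have hLU : X.1 = L₀ * U₀ := by
    ext r c
    rw [hM, CE.eq_sum_esteps M t (N + 1), hz _ le_rfl _ _ (.inl r.2), zero_add,
      Matrix.mul_apply, Finset.sum_range]
    rfl
  have hdU : U₀.det = 1 := by
    have := X.2
    rwa [hLU, Matrix.det_mul, hdL, one_mul] at this
  exact ⟨⟨L₀, hdL⟩, ⟨U₀, hdU⟩, mem_Bminus.2 hL, mem_Bplus.2 hU, Subtype.ext hLU, fun r c => rfl⟩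

end DBS

/-! ### Augmentations over a field -/

namespace CE

section FieldAugmentations

variable {N m : ℕ} {F : Type*} [Field F] [CharP F 2] (w : Fin m → Fin N)

/-- The values of the marked points, indexed by natural numbers. -/
noncomputable def natVal (t : Fin (N + 1) → F) (k : ℕ) : F :=
  if h : k < N + 1 then t ⟨k, h⟩ else 0

theorem natVal_val (t : Fin (N + 1) → F) (j : Fin (N + 1)) : natVal t j = t j := dif_pos j.2

theorem map_esteps_wordMat (ε : Alg (Fin m) (Fin (N + 1)) →+* F) (k r c : ℕ) :
    ε (esteps (markedNat _ N) 0 (wordMat w fun k => chord (.inl k)) k r c) =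
      esteps (natVal fun j => ε (markedVal j)) 0 (wordMat w fun k => ε (chord (.inl k))) k r c := by
  rw [map_esteps]
  refine esteps_congr (fun k _ _ => ?_) (fun r c _ _ => ?_) (Nat.zero_le _) (Nat.zero_le _)
  · simp only [markedNat, natVal]
    split_ifs
    · rfl
    · exact map_zero ε
  · rw [map_wordMat]

theorem aug_mul_pivot {ε : Alg (Fin m) (Fin (N + 1)) →+* F} (hε : ε ∈ Aug (rainbow w) F)
    (j : ℕ) (hj : j < N + 1) : natVal (fun j => ε (markedVal j)) j *
      pivot (natVal fun j => ε (markedVal j)) (wordMat w fun k => ε (chord (.inl k))) j = 1 := by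
  have h := hε.1 (chord (.inr ⟨j, hj⟩))
  rw [diff_chord, diffGenFrom_rainbow, Sum.elim_inr, map_add, pivot, map_esteps_wordMat] at h
  rw [pivot, natVal, dif_pos hj, ← CharTwo.add_eq_zero.1 h, ← map_mul, marked_mul_inv, map_one]

/-- The augmentation with given values on the degree `0` generators. -/
noncomputable def augOf (q : Fin m → F) (t : Fin (N + 1) → Fˣ) :
    Alg (Fin m) (Fin (N + 1)) →+* F :=
  letI := ZMod.algebra F 2
  (lift (Sum.elim q fun _ => 0) t).toRingHom

theorem augOf_chord (q : Fin m → F) (t : Fin (N + 1) → Fˣ) (c : Fin m ⊕ Fin (N + 1)) :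
    augOf q t (chord c) = Sum.elim q (fun _ => 0) c := by
  let _ := ZMod.algebra F 2
  exact lift_chord _ _ _

theorem augOf_markedVal (q : Fin m → F) (t : Fin (N + 1) → Fˣ) (j : Fin (N + 1)) :
    augOf q t (markedVal j) = t j := by
  let _ := ZMod.algebra F 2
  exact lift_markedVal _ _ _

/-- If the marked points are inverse to the pivots, all boundaries of chords go to zero; sending the
cusp chords to zero takes care of the grading. -/
theorem augOf_mem {q : Fin m → F} {t : Fin (N + 1) → Fˣ}
    (h : ∀ j : Fin (N + 1), (t j : F) * pivot (natVal fun j => (t j : F)) (wordMat w q) j = 1) :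
    augOf q t ∈ Aug (rainbow w) F := by
  have hinv : ∀ j, augOf q t (((marked j)⁻¹ : (Alg (Fin m) (Fin (N + 1)))ˣ) : Alg _ _) =
      pivot (natVal fun j => (t j : F)) (wordMat w q) j := fun j => by
    have h1 : augOf q t (markedVal j) *
        augOf q t (((marked j)⁻¹ : (Alg (Fin m) (Fin (N + 1)))ˣ) : Alg _ _) = 1 := by
      rw [← map_mul, marked_mul_inv, map_one]
    rw [augOf_markedVal] at h1
    exact mul_left_cancel₀ (t j).ne_zero (h1.trans (h j).symm)
  refine ⟨fun x => ?_, fun d x hd hx => ?_⟩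
  · have hd : ∀ c, augOf q t (diffGenFrom Slice.empty (rainbow w) c) = 0 := by
      intro c
      rw [diffGenFrom_rainbow]
      rcases c with k | j
      · exact map_zero _
      · rw [Sum.elim_inr, map_add, hinv, pivot, pivot, map_esteps_wordMat]
        simp only [augOf_chord, augOf_markedVal, Sum.elim_inl]
        exact CharTwo.add_self_eq_zero _
    induction x using Alg.induction with
    | h0 => simp
    | h1 => simp
    | hadd x y hx hy => rw [diff_add, map_add, hx, hy, add_zero]
    | hmul x y hx hy => rw [diff_mul, map_add, map_mul, map_mul, hx, hy, mul_zero, zero_mul, add_zero]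
    | hc c => rw [diff_chord, hd]
    | ht j => rw [diff_markedVal, map_zero]
    | hti j => rw [diff_marked_inv, map_zero]
  -- A word of nonzero degree contains a cusp chord.
  · have key : ∀ v : Words (Fin m) (Fin (N + 1)), wordDegree (rainbow w) v = 1 ∨
        augOf q t (MonoidAlgebra.of (ZMod 2) _ v) = 0 := by
      intro v
      induction v using Monoid.Coprod.induction_on with
      | inl v =>
        induction v using FreeMonoid.inductionOn' with
        | one => left; simp
        | of_mul c v ih =>
          rcases ih with ih | ih
          · rcases c with k | j
            · left
              rw [map_mul, map_mul, ih, mul_one]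
              simp [wordDegree, degreeGenFrom_rainbow]
            · right
              rw [map_mul, map_mul, map_mul, show augOf q t (MonoidAlgebra.of (ZMod 2) _
                (Monoid.Coprod.inl (FreeMonoid.of (Sum.inr j)))) = 0 from augOf_chord q t (.inr j),
                zero_mul]
          · right
            rw [map_mul, map_mul, map_mul, ih, mul_zero]
      | inr v => left; simp [wordDegree]
      | mul v v' h h' =>
        rcases h with h | h
        · rcases h' with h' | h'
          · left; rw [map_mul, h, h', mul_one]
          · right; rw [map_mul, map_mul, h', mul_zero]
        · right; rw [map_mul, map_mul, h, zero_mul]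
    let _ := ZMod.algebra F 2
    change lift (Sum.elim q fun _ => 0) t x = 0
    rw [lift, MonoidAlgebra.lift_apply]
    refine Finset.sum_eq_zero fun v hv => ?_
    have h1 := hx v (Finsupp.mem_support_iff.1 hv)
    have h2 := (key v).resolve_left fun h => hd (by
      rw [h1] at h
      exact ofAdd_eq_one.1 h)
    have h3 : lift (Sum.elim q fun _ => 0) t (MonoidAlgebra.of (ZMod 2) _ v) = 0 := h2
    rw [lift, MonoidAlgebra.lift_of] at h3
    dsimp only
    rw [h3, smul_zero]

/-- An augmentation of a rainbow closure is determined by its values on the crossings. -/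
theorem aug_ext {ε ε' : Alg (Fin m) (Fin (N + 1)) →+* F} (hε : ε ∈ Aug (rainbow w) F)
    (hε' : ε' ∈ Aug (rainbow w) F) (h : ∀ k, ε (chord (.inl k)) = ε' (chord (.inl k))) :
    ε = ε' := by
  have ht : ∀ j, natVal (fun j => ε (markedVal j)) j = natVal (fun j => ε' (markedVal j)) j := by
    intro j
    -- The pivot at `j` depends only on the marked points below `j`.
    induction j using Nat.strong_induction_on with
    | _ j ih =>
      by_cases hj : j < N + 1
      · have h1 := aug_mul_pivot w hε j hj
        have h2 := aug_mul_pivot w hε' j hj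
        have h3 : pivot (natVal fun j => ε (markedVal j)) (wordMat w fun k => ε (chord (.inl k))) j =
            pivot (natVal fun j => ε' (markedVal j)) (wordMat w fun k => ε' (chord (.inl k))) j :=
          esteps_congr (fun k _ hk => ih k (by omega)) (fun r c _ _ => by simp only [h])
            (Nat.zero_le _) (Nat.zero_le _)
        rw [h3] at h1
        exact mul_right_cancel₀ (right_ne_zero_of_mul (h2 ▸ one_ne_zero)) (h1.trans h2.symm)
      · rw [natVal, natVal, dif_neg hj, dif_neg hj]
  refine Alg.ringHom_ext (fun c => ?_) fun j => ?_
  · rcases c with k | j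
    · exact h k
    · rw [aug_map_eq_zero_of_degree hε (by rw [degreeGenFrom_rainbow]; rfl),
        aug_map_eq_zero_of_degree hε' (by rw [degreeGenFrom_rainbow]; rfl)]
  · have := ht j
    rwa [natVal_val, natVal_val] at this

end FieldAugmentations

end CE


/-! ### The map `gamma`, the reflections and the commutative diagram -/

namespace DBS

open Matrix DoubleCoset

variable {N : ℕ} {F : Type*} [Field F] [CharP F 2]

section Gamma

variable {m : ℕ} (w : Fin m → Fin N)

theorem exists_factorization_of_mem_Aug {ε : CE.Alg (Fin m) (Fin (N + 1)) →+* F}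
    (hε : ε ∈ CE.Aug (CE.rainbow w) F) : ∃ L U : G N F, L ∈ Bminus N F ∧ U ∈ Bplus N F ∧
      prodR w (fun k => ε (CE.chord (.inl k))) (Fin.last m) = L * U ∧
      ∀ r c : Fin (N + 1), U.1 r c = CE.esteps (CE.natVal fun j => ε (CE.markedVal j)) 0
        (CE.wordMat w fun k => ε (CE.chord (.inl k))) r r c :=
  exists_factorization (apply_eq_wordMat w _) (CE.aug_mul_pivot w hε)

/-- Invertible pivots, a triangular factorization of the matrix and general position of the last
pair of flags are one condition on the coordinates; the marked points are then the inverse pivots.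
-/
theorem bijOn_gamma : Set.BijOn (gamma w) (CE.Aug (CE.rainbow w) F) (Conf w ![]) := by
  refine ⟨fun ε hε => ?_, fun ε hε ε' hε' h => ?_, fun o ho => ?_⟩
  · obtain ⟨L, U, hL, hU, h, -⟩ := exists_factorization_of_mem_Aug w hε
    refine point_mem ?_
    rw [posMixed_one_one, h]
    exact mem_doubleCoset.2 ⟨L, hL, U, hU, by rw [mul_one]⟩
  · exact CE.aug_ext w hε hε' fun k => congrFun (point_injective w h) k
  · obtain ⟨q, rfl, hq⟩ := exists_eq_point ho
    obtain ⟨L, hL, U, hU, h⟩ := mem_doubleCoset.1 (posMixed_one_one.1 hq)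
    rw [mul_one] at h
    have hne : ∀ j, L.1 j j * U.1 j j ≠ 0 := fun j =>
      mul_ne_zero (Bminus_diag_ne_zero hL j) (Bplus_diag_ne_zero hU j)
    have hX : ∀ r c : Fin (N + 1), CE.wordMat w q r c = ∑ j, L.1 r j * U.1 j c := fun r c => by
      rw [← apply_eq_wordMat, h, coe_mul', Matrix.mul_apply]
    -- The pivots of a product `L * U` are the products of the diagonal entries.
    let t : Fin (N + 1) → Fˣ := fun j => (Units.mk0 _ (hne j))⁻¹
    have ht : ∀ j, (t j : F) * (L.1 j j * U.1 j j) = 1 := fun j => by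
      simp only [t, Units.val_inv_eq_inv_val, Units.val_mk0]
      exact inv_mul_cancel₀ (hne j)
    have he := CE.esteps_mul hX (mem_Bminus.1 hL) (mem_Bplus.1 hU)
      (t := CE.natVal fun j => (t j : F)) (fun j => by rw [CE.natVal_val, ht])
    refine ⟨CE.augOf q t, CE.augOf_mem w fun j => ?_, ?_⟩
    · rw [CE.pivot, he _ j.2.le, Fintype.sum_eq_single j, if_pos le_rfl, ht]
      intro k hk
      split_ifs with hjk
      · rw [mem_Bminus.1 hL _ _ (lt_of_le_of_ne (Fin.le_def.2 hjk) hk.symm), zero_mul]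
      · rfl
    · rw [gamma]
      simp only [CE.augOf_chord, Sum.elim_inl]

end Gamma

section Reflections

variable {l : ℕ} (i : Fin N) (β : Fin l → Fin N)

theorem exists_factorization_of_posMixed {x : G N F} (h : PosMixed 1 1 x) :
    ∃ L U : G N F, L ∈ Bminus N F ∧ U ∈ Bplus N F ∧ x = L * U := by
  obtain ⟨L, hL, U, hU, h⟩ := mem_doubleCoset.1 (posMixed_one_one.1 h)
  exact ⟨L, U, hL, hU, by rw [h, mul_one]⟩

theorem existsUnique_leftReflects {c : Orbits N F (l + 1) 0} (hc : c ∈ Conf (CE.wordLeft i β) ![]) :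
    ∃ d, ∀ d', LeftReflects i c d' ↔ d' = d := by
  obtain ⟨q, rfl, -⟩ := exists_eq_point hc
  exact ⟨_, leftReflects_point_iff i β q⟩

theorem existsUnique_rightReflects {c : Orbits N F l 1} (hc : c ∈ Conf β ![i]) :
    ∃ d, ∀ d', RightReflects i c d' ↔ d' = d := by
  obtain ⟨q, rfl, h⟩ := exists_eq_leftChains i β hc
  obtain ⟨L, U, hL, hU, h⟩ := exists_factorization_of_posMixed h
  exact ⟨_, rightReflects_leftChains_iff i β hL hU h⟩

open Classical in
/-- The left reflection. -/
noncomputable def left (c : Orbits N F (l + 1) 0) : Orbits N F l 1 :=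
  if h : ∃ d, ∀ d', LeftReflects i c d' ↔ d' = d then h.choose else ⟦⟨1, 1⟩⟧

open Classical in
/-- The right reflection. -/
noncomputable def right (c : Orbits N F l 1) : Orbits N F (l + 1) 0 :=
  if h : ∃ d, ∀ d', RightReflects i c d' ↔ d' = d then h.choose else ⟦⟨1, 1⟩⟧

/-- On the cell a reflection exists and is unique, so the default value in `left` is never taken. -/
theorem leftReflects_iff {c : Orbits N F (l + 1) 0} (hc : c ∈ Conf (CE.wordLeft i β) ![])
    (d : Orbits N F l 1) : LeftReflects i c d ↔ d = left i c := by
  have h := existsUnique_leftReflects i β hc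
  rw [left, dif_pos h]
  exact h.choose_spec d

theorem rightReflects_iff {c : Orbits N F l 1} (hc : c ∈ Conf β ![i])
    (d : Orbits N F (l + 1) 0) : RightReflects i c d ↔ d = right i c := by
  have h := existsUnique_rightReflects i β hc
  rw [right, dif_pos h]
  exact h.choose_spec d

theorem left_point {q : Fin (l + 1) → F}
    (h : PosMixed 1 1 (prodR (CE.wordLeft i β) q (Fin.last (l + 1)))) :
    left i (point (CE.wordLeft i β) q) = ⟦leftChains i β q⟧ :=
  ((leftReflects_iff i β (point_mem h) _).1 ((leftReflects_point_iff i β q _).2 rfl)).symm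

theorem bijOn_left : Set.BijOn (left (F := F) i) (Conf (CE.wordLeft i β) ![]) (Conf β ![i]) := by
  refine ⟨fun o ho => ?_, fun o ho o' ho' h => ?_, fun o ho => ?_⟩
  · obtain ⟨q, rfl, hq⟩ := exists_eq_point ho
    rw [left_point i β hq]
    exact leftChains_mem i β hq
  · obtain ⟨q, rfl, hq⟩ := exists_eq_point ho
    obtain ⟨q', rfl, hq'⟩ := exists_eq_point ho'
    rw [left_point i β hq, left_point i β hq'] at h
    rw [leftChains_injective i β h]
  · obtain ⟨q, rfl, hq⟩ := exists_eq_leftChains i β ho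
    exact ⟨_, point_mem hq, left_point i β hq⟩

theorem map_newChordImage (ε : CE.Alg (Fin (l + 1)) (Fin (N + 1)) →+* F) :
    ε (CE.newChordImage β i) = ε (CE.markedVal i.castSucc) *
      CE.esteps (CE.natVal fun j => ε (CE.markedVal j)) 0
        (CE.wordMat (CE.wordLeft i β) fun k => ε (CE.chord (.inl k))) i i (i + 1) := by
  rw [CE.newChordImage_eq, map_mul, CE.map_esteps_wordMat]

/-- The reflections realize the rotation. -/
theorem gamma_comp_eq
    {Φ : CE.Alg (Fin (l + 1)) (Fin (N + 1)) →ₐ[ZMod 2] CE.Alg (Fin (l + 1)) (Fin (N + 1))}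
    (hΦ : CE.IsRotationMap β i Φ) {ε : CE.Alg (Fin (l + 1)) (Fin (N + 1)) →+* F}
    (hε : ε ∈ CE.Aug (CE.rainbow (CE.wordLeft i β)) F) :
    gamma (CE.wordRight β i) (ε.comp Φ.toRingHom) =
      right i (left i (gamma (CE.wordLeft i β) ε)) := by
  obtain ⟨L, U, hL, hU, h, hUe⟩ := exists_factorization_of_mem_Aug _ hε
  have hq : PosMixed 1 1 (prodR (CE.wordLeft i β) (fun k => ε (CE.chord (.inl k)))
      (Fin.last (l + 1))) := by
    rw [posMixed_one_one, h]
    exact mem_doubleCoset.2 ⟨L, hL, U, hU, by rw [mul_one]⟩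
  have h1 : right i (left i (gamma (CE.wordLeft i β) ε)) = point (CE.wordRight β i)
      (Fin.snoc (α := fun _ => F) (fun j => ε (CE.chord (.inl j.succ)))
        (U.1 i.castSucc i.succ / U.1 i.castSucc i.castSucc)) := by
    rw [gamma, left_point i β hq, ← rightChains_eq_point i β hU h]
    exact ((rightReflects_iff i β (leftChains_mem i β hq) _).1
      ((rightReflects_leftChains_iff i β hL hU h _).2 rfl)).symm
  rw [h1, hΦ.comp_eq hε, gamma]
  congr 1
  funext k
  cases k using Fin.lastCases with
  | last =>
    rw [Fin.snoc_last]
    change ε (CE.rotation β i _) = _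
    rw [CE.rotation_last, map_newChordImage, hUe, hUe]
    -- The entry $U_{ii}$ is the pivot at level `i`, inverse to $t_i$, so the quotient
    -- $U_{i,i+1}/U_{ii}$ is $t_i$ times an eliminated entry.
    have hp := CE.aug_mul_pivot _ hε i (by omega)
    rw [CE.natVal, dif_pos (by omega)] at hp
    have hp' : ε (CE.markedVal i.castSucc) * CE.esteps (CE.natVal fun j => ε (CE.markedVal j)) 0
        (CE.wordMat (CE.wordLeft i β) fun k => ε (CE.chord (.inl k))) i i i = 1 := hp
    rw [Fin.val_castSucc, Fin.val_succ, eq_div_iff (right_ne_zero_of_mul (hp' ▸ one_ne_zero))]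
    linear_combination CE.esteps (CE.natVal fun j => ε (CE.markedVal j)) 0
        (CE.wordMat (CE.wordLeft i β) fun k => ε (CE.chord (.inl k))) i i (i + 1) * hp'
  | cast k =>
    rw [Fin.snoc_castSucc]
    change ε (CE.rotation β i _) = _
    rw [CE.rotation_castSucc]

/-- In the commutative square all other maps are already bijections, and `left` after `gamma`
reaches the whole cell. -/
theorem bijOn_right : Set.BijOn (right (F := F) i) (Conf β ![i]) (Conf (CE.wordRight β i) ![]) := by
  have h1 := (bijOn_left (F := F) i β).comp (bijOn_gamma (CE.wordLeft i β))
  have h2 := (bijOn_gamma (F := F) (CE.wordRight β i)).comp (CE.bijOn_rotation β i F)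
  have h3 : Set.BijOn (right i ∘ (left i ∘ gamma (CE.wordLeft i β)))
      (CE.Aug (CE.rainbow (CE.wordLeft i β)) F) (Conf (CE.wordRight β i) ![]) :=
    h2.congr fun ε hε => gamma_comp_eq i β (CE.isRotationMap_rotation β i) hε
  rwa [Set.bijOn_comp_iff h1.injOn, h1.image_eq] at h3

end Reflections

end DBS



theorem proposition4p5 {N l : ℕ} (i : Fin N) (β : Fin l → Fin N) :
    -- the cyclic rotation induces a dga morphism with the stated values on degree `0` chords
    (∃ Φ, CE.IsRotationMap β i Φ ∧
      (∀ k : Fin l, Φ (CE.chord (Sum.inl k.castSucc)) = CE.chord (Sum.inl k.succ)) ∧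
      Φ (CE.chord (Sum.inl (Fin.last l))) = CE.newChordImage β i) ∧
    -- every dga morphism induced by it has these values in homology, and
    -- induces an isomorphism of augmentation varieties
    (∀ Φ, CE.IsRotationMap β i Φ →
      CE.IsDGAMorphism (CE.rainbow (CE.wordRight β i)) (CE.rainbow (CE.wordLeft i β)) Φ ∧
      (∀ k : Fin l, ∃ y, Φ (CE.chord (Sum.inl k.castSucc))
        = CE.chord (Sum.inl k.succ) + CE.diff (CE.rainbow (CE.wordLeft i β)) y) ∧
      (∃ y, Φ (CE.chord (Sum.inl (Fin.last l)))
        = CE.newChordImage β i + CE.diff (CE.rainbow (CE.wordLeft i β)) y) ∧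
      ∀ (R : Type*) [CommRing R], Set.BijOn (fun ε => ε.comp Φ.toRingHom)
        (CE.Aug (CE.rainbow (CE.wordLeft i β)) R) (CE.Aug (CE.rainbow (CE.wordRight β i)) R)) ∧
    -- the commutative diagram
    ∀ (F : Type*) [Field F] [CharP F 2],
      Set.BijOn (DBS.gamma (CE.wordLeft i β))
        (CE.Aug (CE.rainbow (CE.wordLeft i β)) F) (DBS.Conf (CE.wordLeft i β) ![]) ∧
      Set.BijOn (DBS.gamma (CE.wordRight β i))
        (CE.Aug (CE.rainbow (CE.wordRight β i)) F) (DBS.Conf (CE.wordRight β i) ![]) ∧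
      ∃ (left : DBS.Orbits N F (l + 1) 0 → DBS.Orbits N F l 1)
        (right : DBS.Orbits N F l 1 → DBS.Orbits N F (l + 1) 0),
        Set.BijOn left (DBS.Conf (CE.wordLeft i β) ![]) (DBS.Conf β ![i]) ∧
        (∀ c ∈ DBS.Conf (CE.wordLeft i β) ![], ∀ d, DBS.LeftReflects i c d ↔ d = left c) ∧
        Set.BijOn right (DBS.Conf β ![i]) (DBS.Conf (CE.wordRight β i) ![]) ∧
        (∀ c ∈ DBS.Conf β ![i], ∀ d, DBS.RightReflects i c d ↔ d = right c) ∧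
        ∀ Φ, CE.IsRotationMap β i Φ → ∀ ε ∈ CE.Aug (CE.rainbow (CE.wordLeft i β)) F,
          DBS.gamma (CE.wordRight β i) (ε.comp Φ.toRingHom)
            = right (left (DBS.gamma (CE.wordLeft i β) ε)) := by
  refine ⟨⟨CE.rotation β i, CE.isRotationMap_rotation β i, CE.rotation_castSucc β i,
    CE.rotation_last β i⟩, fun Φ hΦ => ⟨hΦ.isDGAMorphism, hΦ.exists_castSucc, hΦ.exists_last,
    fun R _ => hΦ.bijOn R⟩, fun F _ _ => ⟨DBS.bijOn_gamma _, DBS.bijOn_gamma _, DBS.left i,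
    DBS.right i, DBS.bijOn_left i β, fun c hc => DBS.leftReflects_iff i β hc, DBS.bijOn_right i β,
    fun c hc => DBS.rightReflects_iff i β hc, fun Φ hΦ ε hε => DBS.gamma_comp_eq i β hΦ hε⟩⟩
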